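/- Let $G$ be a connected plane graph with $n$ vertices, given by its combinatorial embedding (the circular order of the edges around each vertex). Each vertex $v$ has a weight $\omega(v)\in\mathbb R$, and $x_0$ is a vertex of $G$. For $U\subseteq V(G)$ and $\delta\in\mathbb R$ put $\kappa_\le(U,\delta)=|\{v\in U : \omega(v)\le\delta\}|$. Let $G^*$ be the dual graph. A closed walk $\gamma$ in $G^*$ is *non-crossing* if an infinitesimal perturbation $\gamma_\varepsilon$ of the curve $\gamma$ is a simple closed curve; $V_{\mathrm{int}}(\gamma,G)$ denotes the set of vertices of $G$ in the bounded component of the complement of $\gamma_\varepsilon$. Let $\Pi=\{\pi_1,\dots,\pi_\ell\}$ be a family of walks in $G^*$, each with at least one edge, with a total of $m$ edges counted with multiplicity. Computations are done on a random access machine with words of logarithmically many bits (all integers that occur in the preprocessing, or in a query with $k$ pieces, are bounded by a fixed polynomial in the input size, the query size included), on which real numbers can be stored, copied and compared at unit cost. Then, if $G$ has no loops and no parallel edges, after $O(n(n+m))$ preprocessing time we can answer queries of the following type, any number of them: given a value $\delta\in\mathbb R$ and a non-crossing closed walk $\gamma$ in $G^*$, described as a concatenation of $k$ subwalks of walks from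 $\Pi$ (each given by the index of the walk and its first and last position), such that $\gamma$ is oriented clockwise and contains $x_0$ in its interior, return $\kappa_\le(V_{\mathrm{int}}(\gamma,G),\delta)$ in $O(k+\log n)$ time. If loops and parallel edges are allowed and $G$ has $e$ edges, the same holds with $O(n(n+e+m))$ preprocessing time. The algorithms and the constants do not depend on $G$, $\omega$, $x_0$, $\Pi$ or the query. -/

import Mathlib

/-! ### Plane graphs, given by a combinatorial embedding -/

/-- A connected plane graph (loops and parallel edges allowed) with vertex set `Fin n` and set of
arcs `Fin D`, given by its combinatorial embedding. Every arc comes with its reversal, so there are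
`D / 2` edges. `rot d` is the arc that follows `d` in the clockwise order of the arcs leaving the
tail of `d`.  The arc that follows `d` on the boundary of the face to the left of `d` is then
`rot (rev d)`, so the faces are the cycles of `rev.trans rot`, except that the graph with a single
vertex and no arc has one face. Planarity is Euler's formula. -/
structure PlaneGraph (n D : ℕ) where
  tail : Fin D → Fin n
  rev : Equiv.Perm (Fin D)
  rot : Equiv.Perm (Fin D)
  rev_rev : ∀ d, rev (rev d) = d
  rev_ne : ∀ d, rev d ≠ d
  rot_sameCycle : ∀ d d', rot.SameCycle d d' ↔ tail d = tail d'
  connected : ∀ u v,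
    Relation.ReflTransGen (fun x y => ∃ d, tail d = x ∧ tail (rev d) = y) u v
  euler : 2 * n + 2 * max 1 (Nat.card (Quotient (Equiv.Perm.SameCycle.setoid (rev.trans rot))))
    = D + 4

namespace PlaneGraph

variable {n D : ℕ} (G : PlaneGraph n D)

/-- The head of an arc. -/
def head (d : Fin D) : Fin n := G.tail (G.rev d)

/-- No loops and no parallel edges. -/
def Simple : Prop :=
  (∀ d, G.tail d ≠ G.head d) ∧
    ∀ d d', G.tail d = G.tail d' → G.head d = G.head d' → d = d'

/-- The next arc on the boundary of the face to the left of an arc. -/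
def faceNext : Equiv.Perm (Fin D) := G.rev.trans G.rot

/-- `d` and `d'` have the same face to their left. -/
def SameFace (d d' : Fin D) : Prop := G.faceNext.SameCycle d d'

/-! The arcs of the dual graph are indexed by the arcs of `G`: the dual arc of `d` crosses `d` from
left to right, so it goes from the face left of `d` to the face left of `rev d`.  The dual arc of
`rev d` is its reversal. -/

/-- `d₁` and `d₂` are consecutive arcs of a walk in the dual graph: the dual arc of `d₁` ends at the
face where the dual arc of `d₂` starts. -/
def DualAdj (d₁ d₂ : Fin D) : Prop := G.SameFace (G.rev d₁) d₂

/-- Walks in the dual graph, as lists of dual arcs. -/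
def IsDualWalk (π : List (Fin D)) : Prop := π.IsChain G.DualAdj

/-- Closed walks in the dual graph; `finRotate` is the cyclic successor of an index. -/
def IsClosedDualWalk (γ : List (Fin D)) : Prop :=
  γ ≠ [] ∧ ∀ i : Fin γ.length, G.DualAdj (γ.get i) (γ.get (finRotate _ i))

/-! ### Perturbations of closed dual walks, their interior and orientation

A pair `(d, s)` with `0 ≤ s ≤ 1` is the point at fraction `s` along the arc `d`, from tail to head,
looked at from the face to the left of `d`. The same point of the edge looked at from the other side
is `(rev d, 1 - s)`. The points `(d, s)` with `d` on a face `f` form the boundary circle of the open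
disk `f`, where `(d, 1)` and `(faceNext d, 0)` are the same place.

A perturbation of the closed walk `γ` is given, up to isotopy, by numbers `p i`: the `i`-th arc of
the walk crosses the arc `γ i` of `G` in the point at fraction `p i` from its tail. Between two
consecutive crossings the perturbed curve runs inside a face of `G`, as a chord of that disk. -/

/-- Starting at the boundary point `x` of a face and following the boundary of the face (face to the
left) one meets, within one turn and after leaving `x`, first `z` and strictly later `y`. -/
def OnArc (x z y : Fin D × ℝ) : Prop :=
  ∃ i j : ℕ, (G.faceNext ^ i) x.1 = z.1 ∧ (G.faceNext ^ j) x.1 = y.1 ∧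
    0 < i + z.2 - x.2 ∧ i + z.2 - x.2 < j + y.2 - x.2 ∧
    j + y.2 - x.2 < Function.minimalPeriod G.faceNext x.1

/-- The chord with ends `x`, `y` of a face separates the boundary points `z` and `w` of it. -/
def Separates (x y z w : Fin D × ℝ) : Prop := Xor (G.OnArc x z y) (G.OnArc x w y)

variable (γ : List (Fin D)) (p : Fin γ.length → ℝ)

/-- The start of the `i`-th chord: the `i`-th crossing, looked at from the face just entered. -/
def chordStart (i : Fin γ.length) : Fin D × ℝ := (G.rev (γ.get i), 1 - p i)

/-- The end of the `i`-th chord: the next crossing, looked at from the face about to be left. -/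
def chordEnd (i : Fin γ.length) : Fin D × ℝ :=
  (γ.get (finRotate _ i), p (finRotate _ i))

/-- The perturbation `p` of `γ` is a simple closed curve: it crosses the edges in interior points
that are pairwise distinct, and its chords are pairwise disjoint. A closed walk in the dual graph is
non-crossing if it has such a perturbation. -/
structure IsSimplePerturbation : Prop where
  pos : ∀ i, 0 < p i
  lt_one : ∀ i, p i < 1
  ne_of_eq : ∀ i j, i ≠ j → γ.get i = γ.get j → p i ≠ p j
  ne_of_rev : ∀ i j, γ.get i = G.rev (γ.get j) → p i ≠ 1 - p j
  noncrossing : ∀ i j,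
    ¬ G.Separates (G.chordStart γ p i) (chordEnd γ p i) (G.chordStart γ p j) (chordEnd γ p j)

/-- `x` is a point of `G` that is not on the perturbed curve. -/
def IsFree (x : Fin D × ℝ) : Prop :=
  0 ≤ x.2 ∧ x.2 ≤ 1 ∧ ∀ i, x ≠ (γ.get i, p i) ∧ x ≠ (G.rev (γ.get i), 1 - p i)

/-- Elementary moves of a point off the perturbed curve: go to the other side of an edge, or go
through a face to a boundary point that no chord separates from the current one. -/
inductive Move : Fin D × ℝ → Fin D × ℝ → Prop
  | flip (d : Fin D) (s : ℝ) : G.IsFree γ p (d, s) → Move (d, s) (G.rev d, 1 - s)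
  | face (x y : Fin D × ℝ) : G.IsFree γ p x → G.IsFree γ p y → G.SameFace x.1 y.1 →
      (∀ i, ¬ G.Separates (G.chordStart γ p i) (chordEnd γ p i) x y) → Move x y

/-- `x` and `y` lie in the same connected component of the complement of the perturbed curve. -/
def SameRegion (x y : Fin D × ℝ) : Prop := Relation.EqvGen (G.Move γ p) x y

/-- The outer face of the embedding is the face to the left of the arc `o`. The dual graph has a
vertex in the outer face, and infinity lies in that face at the corner where the arc `o` leaves its
tail, that is, not separated from this corner by the dual edges. The point `x` is in the interior of
the perturbed curve if it is not in the component of infinity. -/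
def Inside (o : Fin D) (x : Fin D × ℝ) : Prop := ¬ G.SameRegion γ p x (o, 0)

/-- The set `V_int(γ, G)` of vertices of `G` in the interior of the perturbed curve. -/
def interiorVertices (o : Fin D) : Set (Fin n) :=
  {v | ∃ d, G.tail d = v ∧ G.Inside γ p o (d, 0)}

/-- The perturbed curve is traversed clockwise, with the interior immediately to its right. Crossing
the arc `γ i` from left to right, the curve has the tail of `γ i` to its right. -/
def IsClockwise (o : Fin D) : Prop :=
  ∀ i, ∃ s, s < p i ∧ (∀ s', s ≤ s' → s' < p i → G.IsFree γ p (γ.get i, s')) ∧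
    G.Inside γ p o (γ.get i, s)

end PlaneGraph

/-! ### The machine model: a random access machine that can store and compare reals

The words are integers; their size is controlled by `State.Fits` below. There are registers,
a memory of words and a memory of reals, each cell addressed by a word, and a read-only input that
consists of a list of words and a list of reals. Reals can only be copied and compared. -/

inductive Instr
  /-- `r i := c` -/
  | const (i : ℕ) (c : ℤ)
  /-- `r i := r j + r k` -/
  | add (i j k : ℕ)
  /-- `r i := r j - r k` -/
  | sub (i j k : ℕ)
  /-- `r i := r j * r k` -/
  | mul (i j k : ℕ)
  /-- `r i := r j / r k`, rounded -/
  | div (i j k : ℕ)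
  /-- `r i := words[r j]` -/
  | load (i j : ℕ)
  /-- `words[r i] := r j` -/
  | store (i j : ℕ)
  /-- `r i := wordInput[r j]` -/
  | read (i j : ℕ)
  /-- `reals[r i] := reals[r j]` -/
  | realCopy (i j : ℕ)
  /-- `reals[r i] := realInput[r j]` -/
  | realRead (i j : ℕ)
  /-- continue with instruction number `l` if `r i ≤ r j` -/
  | jumpLe (i j l : ℕ)
  /-- continue with instruction number `l` if `reals[r i] ≤ reals[r j]` -/
  | realJumpLe (i j l : ℕ)

structure Memory where
  words : ℤ → ℤ
  reals : ℤ → ℝ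

/-- The memory before any computation. -/
noncomputable def Memory.blank : Memory := ⟨fun _ => 0, fun _ => 0⟩

structure MachineInput where
  words : List ℤ
  reals : List ℝ

structure State where
  pc : ℕ
  regs : ℕ → ℤ
  mem : Memory

/-- The state in which a program is started on a given memory. -/
def State.start (M : Memory) : State := ⟨0, fun _ => 0, M⟩

/-- All words have absolute value at most `B`. -/
def State.Fits (B : ℕ) (s : State) : Prop :=
  (∀ i, |s.regs i| ≤ B) ∧ ∀ a, |s.mem.words a| ≤ B

namespace State

def setReg (s : State) (i : ℕ) (c : ℤ) : State :=
  ⟨s.pc + 1, Function.update s.regs i c, s.mem⟩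

def setWord (s : State) (a c : ℤ) : State :=
  ⟨s.pc + 1, s.regs, ⟨Function.update s.mem.words a c, s.mem.reals⟩⟩

def setReal (s : State) (a : ℤ) (x : ℝ) : State :=
  ⟨s.pc + 1, s.regs, ⟨s.mem.words, Function.update s.mem.reals a x⟩⟩

end State

/-- The effect of one instruction. -/
noncomputable def Instr.exec (inp : MachineInput) (s : State) : Instr → State
  | const i c => s.setReg i c
  | add i j k => s.setReg i (s.regs j + s.regs k)
  | sub i j k => s.setReg i (s.regs j - s.regs k)
  | mul i j k => s.setReg i (s.regs j * s.regs k)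
  | div i j k => s.setReg i (s.regs j / s.regs k)
  | load i j => s.setReg i (s.mem.words (s.regs j))
  | store i j => s.setWord (s.regs i) (s.regs j)
  | read i j => s.setReg i (inp.words.getD (s.regs j).toNat 0)
  | realCopy i j => s.setReal (s.regs i) (s.mem.reals (s.regs j))
  | realRead i j => s.setReal (s.regs i) (inp.reals.getD (s.regs j).toNat 0)
  | jumpLe i j l => ⟨if s.regs i ≤ s.regs j then l else s.pc + 1, s.regs, s.mem⟩
  | realJumpLe i j l =>
      ⟨if s.mem.reals (s.regs i) ≤ s.mem.reals (s.regs j) then l else s.pc + 1, s.regs, s.mem⟩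

/-- One step of a program; the machine has halted when the program counter is outside it. -/
noncomputable def step (prog : List Instr) (inp : MachineInput) (s : State) : State :=
  match prog[s.pc]? with
  | none => s
  | some instr => instr.exec inp s

/-- Started on the memory `M`, the program halts after at most `t` steps in the state `s`, and all
words that occur during the computation have absolute value at most `B`. -/
def HaltsWithin (prog : List Instr) (inp : MachineInput) (M : Memory) (t B : ℕ) (s : State) :
    Prop :=
  (step prog inp)^[t] (State.start M) = s ∧ prog.length ≤ s.pc ∧
    ∀ i ≤ t, ((step prog inp)^[i] (State.start M)).Fits B

/-! ### Inputs and queries -/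

/-- The input of the preprocessing: the embedded graph, the vertex `x₀`, the family of walks (their
number, their lengths, and then their arcs one after the other), and the vertex weights. -/
noncomputable def preprocessingInput {n D : ℕ} (G : PlaneGraph n D) (x₀ : Fin n)
    (walks : List (List (Fin D))) (ω : Fin n → ℝ) : MachineInput where
  words := [(n : ℤ), (D : ℤ), (walks.length : ℤ), (x₀.val : ℤ)] ++
    List.ofFn (fun d => ((G.tail d).val : ℤ)) ++
    List.ofFn (fun d => ((G.rev d).val : ℤ)) ++
    List.ofFn (fun d => ((G.rot d).val : ℤ)) ++
    walks.map (fun π => (π.length : ℤ)) ++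
    walks.flatten.map (fun d => (d.val : ℤ))
  reals := List.ofFn ω

/-- A description of a subwalk of one of the walks: the walk with number `idx`, from its position
`lo` (included) to its position `hi` (excluded), positions counted from zero. -/
structure Piece where
  idx : ℕ
  lo : ℕ
  hi : ℕ

/-- The piece describes a subwalk of one of the given walks. -/
def Piece.Valid {D : ℕ} (walks : List (List (Fin D))) (c : Piece) : Prop :=
  c.idx < walks.length ∧ c.lo ≤ c.hi ∧ c.hi ≤ (walks.getD c.idx []).length

/-- The subwalk described by a piece. -/
def Piece.subwalk {D : ℕ} (walks : List (List (Fin D))) (c : Piece) : List (Fin D) :=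
  ((walks.getD c.idx []).take c.hi).drop c.lo

/-- The concatenation of the subwalks described by the pieces. -/
def concatPieces {D : ℕ} (walks : List (List (Fin D))) (q : List Piece) : List (Fin D) :=
  q.flatMap (Piece.subwalk walks)

/-- The input of a query: the number of pieces, the pieces, and the real number `δ`. -/
noncomputable def queryInput (q : List Piece) (δ : ℝ) : MachineInput where
  words := (q.length : ℤ) :: q.flatMap (fun c => [(c.idx : ℤ), (c.lo : ℤ), (c.hi : ℤ)])
  reals := [δ]

/-- `κ_≤(U, δ)`, the number of vertices of `U` with weight at most `δ`. -/
noncomputable def countLe {n : ℕ} (ω : Fin n → ℝ) (U : Set (Fin n)) (δ : ℝ) : ℕ :=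
  {v | v ∈ U ∧ ω v ≤ δ}.ncard

/-! The combinatorial core is a count of signed crossings with a spanning tree rooted at `x₀`. If a
clockwise curve crosses an arc along its dual arc, the tail of the arc is on the inside and the head
on the outside; for the reversed dual arc it is the other way round. Hence, for every arc `e`, the
crossings of `e`, counted with sign, sum to the indicator of the tail being interior minus that of
the head (`sum_crossings`). Along the tree path from `x₀` to `v` these differences telescope to `1 -
[v interior]`, since `x₀` is interior (`sum_path`). Summing over a set `U` of vertices gives `|U| -
|U ∩ interior|` (`sum_table`).

After exchanging the two summations, each dual arc `d` of the curve contributes a number that does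
not depend on the curve: the number of vertices of `U` whose tree path uses `d`, minus the same for
`rev d`. Only the sets `U` of the `r` lightest vertices matter, `0 ≤ r ≤ n`. For each of them the
prefix sums of these contributions along the concatenation of all walks form one row of a table with
`(n + 1) * (m + 1)` cells. A query finds the right `r` by binary search and spends two table entries
on each piece (`sum_subwalk`, `countLe_interiorVertices`).

The one topological fact needed is that the left side of a clockwise curve is not interior
(`not_inside_of_left`). It follows from connectedness of `G` alone: otherwise every vertex would be
interior, including one in the region of infinity. No Jordan curve theorem is used. Euler's formula
enters only through `card_arcs_le`, which removes the number of arcs from the time bound for simple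
graphs.

Time allows simple methods: ranks by pairwise comparison in `O(n²)`, a tree grown by `n` scans of
all arcs, and an update of the arc counts along a single tree path between consecutive rows. The
programs are written in a small structured language whose states carry a step counter;
`Cmd.reach_compile` transfers weakest preconditions, step counts and word bounds to the machine. -/

/-! ### A structured language with a weakest precondition calculus -/

/-- The word at a position of the input. -/
def MachineInput.word (inp : MachineInput) (z : ℤ) : ℤ := inp.words.getD z.toNat 0

/-- The real number at a position of the input. -/
def MachineInput.real (inp : MachineInput) (z : ℤ) : ℝ := inp.reals.getD z.toNat 0

/-- Word expressions over variables, eight word arrays and the word input. -/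
inductive WExp
  | const (c : ℤ)
  | var (x : ℕ)
  | add (e f : WExp)
  | sub (e f : WExp)
  | mul (e f : WExp)
  | div (e f : WExp)
  | arr (a : Fin 8) (e : WExp)
  | input (e : WExp)

/-- States of the structured language; `time` counts the machine steps made so far. -/
structure AState where
  var : ℕ → ℤ
  arr : Fin 8 → ℤ → ℤ
  rarr : Fin 8 → ℤ → ℝ
  time : ℕ

namespace AState

def setVar (s : AState) (x : ℕ) (v : ℤ) (t : ℕ) : AState :=
  ⟨Function.update s.var x v, s.arr, s.rarr, s.time + t⟩

def setArr (s : AState) (a : Fin 8) (i v : ℤ) (t : ℕ) : AState :=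
  ⟨s.var, Function.update s.arr a (Function.update (s.arr a) i v), s.rarr, s.time + t⟩

def setReal (s : AState) (a : Fin 8) (i : ℤ) (v : ℝ) (t : ℕ) : AState :=
  ⟨s.var, s.arr, Function.update s.rarr a (Function.update (s.rarr a) i v), s.time + t⟩

def tick (s : AState) (t : ℕ) : AState := ⟨s.var, s.arr, s.rarr, s.time + t⟩

end AState

/-- The odd registers hold intermediate results, the even ones hold variables. -/
def tmpReg (t : ℕ) : ℕ := 2 * t + 1

namespace WExp

def eval (inp : MachineInput) (s : AState) : WExp → ℤ
  | const c => c
  | var x => s.var x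
  | add e f => e.eval inp s + f.eval inp s
  | sub e f => e.eval inp s - f.eval inp s
  | mul e f => e.eval inp s * f.eval inp s
  | div e f => e.eval inp s / f.eval inp s
  | arr a e => s.arr a (e.eval inp s)
  | input e => inp.word (e.eval inp s)

/-- The code of an expression has no jumps, so its length is also its running time. A variable costs
two instructions because a move is an addition to zero. -/
def cost : WExp → ℕ
  | const _ => 1
  | var _ => 2
  | add e f => e.cost + f.cost + 1
  | sub e f => e.cost + f.cost + 1
  | mul e f => e.cost + f.cost + 1
  | div e f => e.cost + f.cost + 1
  | arr _ e => e.cost + 5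
  | input e => e.cost + 1

/-- The words that occur in the evaluation have absolute value at most `B`. -/
def Ok (B : ℕ) (inp : MachineInput) (s : AState) : WExp → Prop
  | const c => |c| ≤ B
  | var _ => True
  | add e f => e.Ok B inp s ∧ f.Ok B inp s ∧ |e.eval inp s + f.eval inp s| ≤ B
  | sub e f => e.Ok B inp s ∧ f.Ok B inp s ∧ |e.eval inp s - f.eval inp s| ≤ B
  | mul e f => e.Ok B inp s ∧ f.Ok B inp s ∧ |e.eval inp s * f.eval inp s| ≤ B
  | div e f => e.Ok B inp s ∧ f.Ok B inp s ∧ |e.eval inp s / f.eval inp s| ≤ B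
  | arr _ e => e.Ok B inp s ∧ 8 * |e.eval inp s| + 8 ≤ B
  | input e => e.Ok B inp s

/-- The result goes to temporary `t` and a right operand to `t + 1`, so lower temporaries survive.
The eight arrays are interleaved: cell `i` of array `a` has address `8 * i + a`. -/
def compile : WExp → ℕ → List Instr
  | const c, t => [.const (tmpReg t) c]
  | var x, t => [.const (tmpReg t) 0, .add (tmpReg t) (2 * x) (tmpReg t)]
  | add e f, t => e.compile t ++ (f.compile (t + 1) ++
      [.add (tmpReg t) (tmpReg t) (tmpReg (t + 1))])
  | sub e f, t => e.compile t ++ (f.compile (t + 1) ++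
      [.sub (tmpReg t) (tmpReg t) (tmpReg (t + 1))])
  | mul e f, t => e.compile t ++ (f.compile (t + 1) ++
      [.mul (tmpReg t) (tmpReg t) (tmpReg (t + 1))])
  | div e f, t => e.compile t ++ (f.compile (t + 1) ++
      [.div (tmpReg t) (tmpReg t) (tmpReg (t + 1))])
  | arr a e, t => e.compile t ++ [.const (tmpReg (t + 1)) 8,
      .mul (tmpReg t) (tmpReg t) (tmpReg (t + 1)), .const (tmpReg (t + 1)) (a.val : ℤ),
      .add (tmpReg t) (tmpReg t) (tmpReg (t + 1)), .load (tmpReg t) (tmpReg t)]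
  | input e, t => e.compile t ++ [.read (tmpReg t) (tmpReg t)]

theorem length_compile (e : WExp) (t : ℕ) : (e.compile t).length = e.cost := by
  induction e generalizing t <;> simp [compile, cost, *] <;> omega

/-- The address of a cell of an array. -/
def addr (a : Fin 8) (e : WExp) : WExp := add (mul e (const 8)) (const (a.val : ℤ))

end WExp

/-- Conditions: comparisons of words and of reals. -/
inductive Cond
  | le (e f : WExp)
  | rle (a : Fin 8) (e : WExp) (b : Fin 8) (f : WExp)

namespace Cond

def holds (inp : MachineInput) (s : AState) : Cond → Prop
  | le e f => e.eval inp s ≤ f.eval inp s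
  | rle a e b f => s.rarr a (e.eval inp s) ≤ s.rarr b (f.eval inp s)

def cost : Cond → ℕ
  | le e f => e.cost + f.cost + 1
  | rle a e b f => (WExp.addr a e).cost + (WExp.addr b f).cost + 1

def Ok (B : ℕ) (inp : MachineInput) (s : AState) : Cond → Prop
  | le e f => e.Ok B inp s ∧ f.Ok B inp s
  | rle a e b f => (WExp.addr a e).Ok B inp s ∧ (WExp.addr b f).Ok B inp s

def compile : Cond → ℕ → List Instr
  | le e f, l => e.compile 0 ++ (f.compile 1 ++ [.jumpLe (tmpReg 0) (tmpReg 1) l])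
  | rle a e b f, l => (WExp.addr a e).compile 0 ++ ((WExp.addr b f).compile 1 ++
      [.realJumpLe (tmpReg 0) (tmpReg 1) l])

theorem length_compile (b : Cond) (l : ℕ) : (b.compile l).length = b.cost := by
  cases b <;> simp [compile, cost, WExp.length_compile] <;> omega

end Cond

inductive Cmd
  | skip
  | assign (x : ℕ) (e : WExp)
  | store (a : Fin 8) (e f : WExp)
  | realCopy (a : Fin 8) (e : WExp) (b : Fin 8) (f : WExp)
  | realRead (a : Fin 8) (e f : WExp)
  | seq (c d : Cmd)
  | ite (b : Cond) (c d : Cmd)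
  | loop (b : Cond) (c : Cmd)

infixr:60 " ;; " => Cmd.seq

namespace Cmd

def size : Cmd → ℕ
  | skip => 0
  | assign _ e => e.cost + 2
  | store a e f => (WExp.addr a e).cost + f.cost + 1
  | realCopy a e b f => (WExp.addr a e).cost + (WExp.addr b f).cost + 1
  | realRead a e f => (WExp.addr a e).cost + f.cost + 1
  | seq c d => c.size + d.size
  | ite b c d => b.cost + d.size + 1 + c.size
  | loop b c => b.cost + 1 + c.size + 1

/-- Jump targets are absolute, hence the position argument. The else branch comes first because the
conditional jump is taken when the condition holds; `jumpLe 0 0` always jumps. -/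
def compile : Cmd → ℕ → List Instr
  | skip, _ => []
  | assign x e, _ => e.compile 0 ++ [.const (tmpReg 1) 0, .add (2 * x) (tmpReg 0) (tmpReg 1)]
  | store a e f, _ => (WExp.addr a e).compile 0 ++ (f.compile 1 ++ [.store (tmpReg 0) (tmpReg 1)])
  | realCopy a e b f, _ => (WExp.addr a e).compile 0 ++ ((WExp.addr b f).compile 1 ++
      [.realCopy (tmpReg 0) (tmpReg 1)])
  | realRead a e f, _ => (WExp.addr a e).compile 0 ++ (f.compile 1 ++
      [.realRead (tmpReg 0) (tmpReg 1)])
  | seq c d, p => c.compile p ++ d.compile (p + c.size)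
  | ite b c d, p => b.compile (p + b.cost + d.size + 1) ++ (d.compile (p + b.cost) ++
      ([.jumpLe 0 0 (p + b.cost + d.size + 1 + c.size)] ++ c.compile (p + b.cost + d.size + 1)))
  | loop b c, p => b.compile (p + b.cost + 1) ++ ([.jumpLe 0 0 (p + b.cost + 1 + c.size + 1)] ++
      (c.compile (p + b.cost + 1) ++ [.jumpLe 0 0 p]))

theorem length_compile (c : Cmd) (p : ℕ) : (c.compile p).length = c.size := by
  induction c generalizing p <;>
    simp [compile, size, WExp.length_compile, Cond.length_compile, *] <;> omega

/-- The weakest precondition for termination with the postcondition `Q` and with words of absolute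
value at most `B`. -/
def wp (B : ℕ) (inp : MachineInput) : Cmd → (AState → Prop) → AState → Prop
  | skip, Q => Q
  | assign x e, Q => fun s => e.Ok B inp s ∧ Q (s.setVar x (e.eval inp s) (e.cost + 2))
  | store a e f, Q => fun s => (WExp.addr a e).Ok B inp s ∧ f.Ok B inp s ∧
      Q (s.setArr a (e.eval inp s) (f.eval inp s) ((WExp.addr a e).cost + f.cost + 1))
  | realCopy a e b f, Q => fun s => (WExp.addr a e).Ok B inp s ∧ (WExp.addr b f).Ok B inp s ∧
      Q (s.setReal a (e.eval inp s) (s.rarr b (f.eval inp s))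
        ((WExp.addr a e).cost + (WExp.addr b f).cost + 1))
  | realRead a e f, Q => fun s => (WExp.addr a e).Ok B inp s ∧ f.Ok B inp s ∧
      Q (s.setReal a (e.eval inp s) (inp.real (f.eval inp s))
        ((WExp.addr a e).cost + f.cost + 1))
  | seq c d, Q => wp B inp c (wp B inp d Q)
  | ite b c d, Q => fun s => b.Ok B inp s ∧
      (b.holds inp s → wp B inp c Q (s.tick b.cost)) ∧
      -- The extra step is the jump over the code of the then branch.
      (¬ b.holds inp s → wp B inp d (fun s' => Q (s'.tick 1)) (s.tick b.cost))
  -- Here `k` bounds the number of tests of the condition; starting the recursion with `False`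
  -- builds termination in.
  | loop b c, Q => fun s => ∃ k : ℕ, Nat.rec (motive := fun _ => AState → Prop)
      (fun _ => False)
      (fun _ R s => b.Ok B inp s ∧
        (b.holds inp s → wp B inp c (fun s' => R (s'.tick 1)) (s.tick b.cost)) ∧
        (¬ b.holds inp s → Q (s.tick (b.cost + 1)))) k s

end Cmd

/-! ### Correctness of the compiler -/

/-- The list `l` of instructions stands in the program at the position `p`. -/
def CodeAt (prog : List Instr) (p : ℕ) (l : List Instr) : Prop :=
  ∀ k, k < l.length → prog[p + k]? = l[k]?

theorem codeAt_append {prog : List Instr} {p : ℕ} {l l' : List Instr} :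
    CodeAt prog p (l ++ l') ↔ CodeAt prog p l ∧ CodeAt prog (p + l.length) l' := by
  constructor
  · intro h
    refine ⟨fun k hk => ?_, fun k hk => ?_⟩
    · rw [h k (by simp; omega), List.getElem?_append_left hk]
    · rw [add_assoc, h (l.length + k) (by simp; omega), List.getElem?_append_right (by omega)]
      simp
  · rintro ⟨h, h'⟩ k hk
    by_cases hl : k < l.length
    · rw [h k hl, List.getElem?_append_left hl]
    · rw [List.getElem?_append_right (by omega), ← h' (k - l.length) (by simp at hk; omega)]
      congr 1
      omega

theorem codeAt_cons {prog : List Instr} {p : ℕ} {a : Instr} {l : List Instr} :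
    CodeAt prog p (a :: l) ↔ prog[p]? = some a ∧ CodeAt prog (p + 1) l := by
  rw [← List.singleton_append, codeAt_append]
  simp [CodeAt]

/-- The program runs from `s` to `s'` in `t` steps, with words of absolute value at most `B`. -/
def Reach (prog : List Instr) (inp : MachineInput) (B t : ℕ) (s s' : State) : Prop :=
  (step prog inp)^[t] s = s' ∧ ∀ i ≤ t, ((step prog inp)^[i] s).Fits B

section Reach

variable {prog : List Instr} {inp : MachineInput} {B : ℕ}

theorem Reach.refl {s : State} (h : s.Fits B) : Reach prog inp B 0 s s := by
  refine ⟨rfl, fun i hi => ?_⟩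
  obtain rfl : i = 0 := by omega
  exact h

theorem Reach.fits {t : ℕ} {s s' : State} (h : Reach prog inp B t s s') : s'.Fits B :=
  h.1 ▸ h.2 t le_rfl

theorem Reach.trans {t t' : ℕ} {s s' s'' : State} (h : Reach prog inp B t s s')
    (h' : Reach prog inp B t' s' s'') : Reach prog inp B (t + t') s s'' := by
  refine ⟨by rw [add_comm, Function.iterate_add_apply, h.1, h'.1], fun i hi => ?_⟩
  by_cases hit : i ≤ t
  · exact h.2 i hit
  · obtain ⟨j, rfl⟩ : ∃ j, i = j + t := ⟨i - t, by omega⟩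
    rw [Function.iterate_add_apply, h.1]
    exact h'.2 j (by omega)

theorem Reach.single {s : State} {a : Instr} (h : prog[s.pc]? = some a) (hs : s.Fits B)
    (hs' : (a.exec inp s).Fits B) : Reach prog inp B 1 s (a.exec inp s) := by
  have hstep : step prog inp s = a.exec inp s := by simp [step, h]
  refine ⟨hstep, fun i hi => ?_⟩
  interval_cases i
  · exact hs
  · simpa [hstep] using hs'

theorem State.Fits.setReg {s : State} (h : s.Fits B) (i : ℕ) {c : ℤ} (hc : |c| ≤ B) :
    (s.setReg i c).Fits B := by
  refine ⟨fun j => ?_, h.2⟩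
  simp only [State.setReg, Function.update_apply]
  split_ifs
  exacts [hc, h.1 j]

theorem State.Fits.setWord {s : State} (h : s.Fits B) (i : ℤ) {c : ℤ} (hc : |c| ≤ B) :
    (s.setWord i c).Fits B := by
  refine ⟨h.1, fun j => ?_⟩
  simp only [State.setWord, Function.update_apply]
  split_ifs
  exacts [hc, h.2 j]

/-- One step that changes a register. -/
theorem Reach.setReg {s : State} {a : Instr} {i : ℕ} {c : ℤ} (h : prog[s.pc]? = some a)
    (ha : a.exec inp s = s.setReg i c) (hs : s.Fits B) (hc : |c| ≤ B) :
    Reach prog inp B 1 s (s.setReg i c) :=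
  ha ▸ Reach.single h hs (ha ▸ hs.setReg i hc)

end Reach

/-- The machine state `st` represents the state `s` of the structured language. -/
structure Represents (B : ℕ) (s : AState) (st : State) : Prop where
  var : ∀ x, st.regs (2 * x) = s.var x
  arr : ∀ (a : Fin 8) (i : ℤ), st.mem.words (i * 8 + (a.val : ℤ)) = s.arr a i
  rarr : ∀ (a : Fin 8) (i : ℤ), st.mem.reals (i * 8 + (a.val : ℤ)) = s.rarr a i
  fits : st.Fits B

theorem Represents.tick {B : ℕ} {s : AState} {st : State} (h : Represents B s st) (t : ℕ) :
    Represents B (s.tick t) st := ⟨h.var, h.arr, h.rarr, h.fits⟩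

theorem Represents.of_eq {B : ℕ} {s : AState} {st st' : State} (h : Represents B s st)
    (hr : ∀ x, st'.regs (2 * x) = st.regs (2 * x)) (hm : st'.mem = st.mem) (hf : st'.Fits B) :
    Represents B s st' :=
  ⟨fun x => (hr x).trans (h.var x), fun a i => hm ▸ h.arr a i, fun a i => hm ▸ h.rarr a i, hf⟩

/-- The effect of the code of an expression with result register `tmpReg t`. -/
structure EvalStep (B : ℕ) (t : ℕ) (v : ℤ) (len : ℕ) (st st' : State) : Prop where
  pc : st'.pc = st.pc + len
  mem : st'.mem = st.mem
  val : st'.regs (tmpReg t) = v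
  even : ∀ x, st'.regs (2 * x) = st.regs (2 * x)
  low : ∀ x < t, st'.regs (tmpReg x) = st.regs (tmpReg x)
  fits : st'.Fits B

theorem tmpReg_inj {a b : ℕ} : tmpReg a = tmpReg b ↔ a = b := by simp [tmpReg]

theorem two_mul_ne_tmpReg (a b : ℕ) : 2 * a ≠ tmpReg b := by simp [tmpReg]; omega

theorem EvalStep.setReg {B t len : ℕ} {v w : ℤ} {st st' : State}
    (h : EvalStep B t v len st st') (hw : |w| ≤ B) :
    EvalStep B t w (len + 1) st (st'.setReg (tmpReg t) w) where
  pc := by simp [State.setReg, h.pc]; omega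
  mem := h.mem
  val := by simp [State.setReg]
  even x := by simp [State.setReg, two_mul_ne_tmpReg, h.even]
  low x hx := by simp [State.setReg, tmpReg_inj, hx.ne, h.low x hx]
  fits := h.fits.setReg _ hw

theorem EvalStep.setReg_succ {B t len : ℕ} {v w : ℤ} {st st' : State}
    (h : EvalStep B t v len st st') (hw : |w| ≤ B) :
    EvalStep B t v (len + 1) st (st'.setReg (tmpReg (t + 1)) w) where
  pc := by simp [State.setReg, h.pc]; omega
  mem := h.mem
  val := by simp [State.setReg, tmpReg_inj, h.val]
  even x := by simp [State.setReg, two_mul_ne_tmpReg, h.even]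
  low x hx := by
    have : x ≠ t + 1 := by omega
    simp [State.setReg, tmpReg_inj, this, h.low x hx]
  fits := h.fits.setReg _ hw

theorem EvalStep.comp {B t len len' : ℕ} {v w : ℤ} {st st' st'' : State}
    (h : EvalStep B t v len st st') (h' : EvalStep B (t + 1) w len' st' st'') :
    EvalStep B t v (len + len') st st'' where
  pc := by rw [h'.pc, h.pc]; omega
  mem := h'.mem.trans h.mem
  val := (h'.low t (by omega)).trans h.val
  even x := (h'.even x).trans (h.even x)
  low x hx := (h'.low x (by omega)).trans (h.low x hx)
  fits := h'.fits

theorem Represents.evalStep {B t len : ℕ} {v : ℤ} {s : AState} {st st' : State}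
    (h : Represents B s st) (h' : EvalStep B t v len st st') : Represents B s st' :=
  h.of_eq h'.even h'.mem h'.fits

section Compile

variable {prog : List Instr} {inp : MachineInput} {B : ℕ}

theorem WExp.addr_ok {a : Fin 8} {e : WExp} {s : AState} (h : e.Ok B inp s)
    (hB : 8 * |e.eval inp s| + 8 ≤ B) : (WExp.addr a e).Ok B inp s := by
  have ha := a.isLt
  refine ⟨⟨h, ?_, ?_⟩, ?_, ?_⟩ <;> simp only [WExp.Ok, WExp.eval] <;> grind

/-- The code of a binary operation. -/
theorem reach_binop {e f : WExp} {t : ℕ} {s : AState} {w : ℤ} {a : Instr}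
    (he : ∀ {t : ℕ} {st : State}, CodeAt prog st.pc (e.compile t) → Represents B s st →
      ∃ st', Reach prog inp B e.cost st st' ∧ EvalStep B t (e.eval inp s) e.cost st st')
    (hf : ∀ {t : ℕ} {st : State}, CodeAt prog st.pc (f.compile t) → Represents B s st →
      ∃ st', Reach prog inp B f.cost st st' ∧ EvalStep B t (f.eval inp s) f.cost st st')
    (ha : ∀ st : State, st.regs (tmpReg t) = e.eval inp s →
      st.regs (tmpReg (t + 1)) = f.eval inp s → a.exec inp st = st.setReg (tmpReg t) w)
    (hw : |w| ≤ B) {st : State}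
    (hc : CodeAt prog st.pc (e.compile t ++ (f.compile (t + 1) ++ [a])))
    (hs : Represents B s st) :
    ∃ st', Reach prog inp B (e.cost + f.cost + 1) st st' ∧
      EvalStep B t w (e.cost + f.cost + 1) st st' := by
  rw [codeAt_append, codeAt_append, codeAt_cons] at hc
  obtain ⟨h1, h2, h3, -⟩ := hc
  simp only [WExp.length_compile] at h2 h3
  obtain ⟨st1, r1, e1⟩ := he h1 hs
  rw [← e1.pc] at h2 h3
  obtain ⟨st2, r2, e2⟩ := hf h2 (hs.evalStep e1)
  rw [← e2.pc] at h3
  have e12 := e1.comp e2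
  exact ⟨_, (r1.trans r2).trans (Reach.setReg h3 (ha st2 e12.val e2.val) e2.fits hw),
    e12.setReg hw⟩

/-- Values of variables and array cells need no bound in `Ok`, since a represented state already
fits into `B`; values read from the input are bounded by `hin`. -/
theorem WExp.reach_compile (hin : ∀ v ∈ inp.words, |v| ≤ (B : ℤ)) (e : WExp) {s : AState}
    (hok : e.Ok B inp s) {t : ℕ} {st : State} (hc : CodeAt prog st.pc (e.compile t))
    (hs : Represents B s st) :
    ∃ st', Reach prog inp B e.cost st st' ∧ EvalStep B t (e.eval inp s) e.cost st st' := by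
  induction e generalizing t st with
  | const c =>
    have h0 : EvalStep B t (st.regs (tmpReg t)) 0 st st :=
      ⟨rfl, rfl, rfl, fun _ => rfl, fun _ _ => rfl, hs.fits⟩
    exact ⟨_, Reach.setReg (codeAt_cons.1 hc).1 rfl hs.fits hok, h0.setReg hok⟩
  | var x =>
    have h0 : EvalStep B t (st.regs (tmpReg t)) 0 st st :=
      ⟨rfl, rfl, rfl, fun _ => rfl, fun _ _ => rfl, hs.fits⟩
    simp only [WExp.compile, codeAt_cons] at hc
    have hz : |(0 : ℤ)| ≤ B := by simp
    have h1 := h0.setReg hz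
    have hx : |s.var x| ≤ B := by rw [← hs.var]; exact hs.fits.1 _
    refine ⟨_, (Reach.setReg hc.1 rfl hs.fits hz).trans (Reach.setReg (i := tmpReg t)
      (c := s.var x) hc.2.1 ?_ h1.fits hx), h1.setReg hx⟩
    · simp [Instr.exec, State.setReg, two_mul_ne_tmpReg, hs.var]
  | add e f he hf =>
    exact reach_binop (he hok.1) (hf hok.2.1) (fun st h h' => by simp [Instr.exec, h, h'])
      hok.2.2 hc hs
  | sub e f he hf =>
    exact reach_binop (he hok.1) (hf hok.2.1) (fun st h h' => by simp [Instr.exec, h, h'])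
      hok.2.2 hc hs
  | mul e f he hf =>
    exact reach_binop (he hok.1) (hf hok.2.1) (fun st h h' => by simp [Instr.exec, h, h'])
      hok.2.2 hc hs
  | div e f he hf =>
    exact reach_binop (he hok.1) (hf hok.2.1) (fun st h h' => by simp [Instr.exec, h, h'])
      hok.2.2 hc hs
  | arr a e he =>
    simp only [WExp.compile, codeAt_append, codeAt_cons, WExp.length_compile] at hc
    obtain ⟨st1, r1, e1⟩ := he hok.1 hc.1 hs
    rw [← e1.pc] at hc
    obtain ⟨-, c2, c3, c4, c5, c6, -⟩ := hc
    have hv := hok.2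
    have ha := a.isLt
    have b2 : |(8 : ℤ)| ≤ B := by grind
    have b3 : |e.eval inp s * 8| ≤ B := by grind
    have b4 : |(a.val : ℤ)| ≤ B := by grind
    have b5 : |e.eval inp s * 8 + (a.val : ℤ)| ≤ B := by grind
    have b6 : |s.arr a (e.eval inp s)| ≤ B := by rw [← hs.arr]; exact hs.fits.2 _
    have e2 := e1.setReg_succ b2
    have e3 := e2.setReg b3
    have e4 := e3.setReg_succ b4
    have e5 := e4.setReg b5
    have e6 := e5.setReg b6
    refine ⟨_, r1.trans ((((Reach.setReg c2 rfl e1.fits b2).trans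
      (Reach.setReg c3 ?_ e2.fits b3)).trans (Reach.setReg c4 rfl e3.fits b4)).trans
      (Reach.setReg c5 ?_ e4.fits b5) |>.trans (Reach.setReg c6 ?_ e5.fits b6)), e6⟩
    · simp [Instr.exec, State.setReg, tmpReg_inj, e1.val]
    · simp [Instr.exec, State.setReg, tmpReg_inj]
    · rw [Instr.exec, e5.val, e5.mem, hs.arr]
  | input e he =>
    simp only [WExp.compile, codeAt_append, codeAt_cons, WExp.length_compile] at hc
    obtain ⟨st1, r1, e1⟩ := he hok hc.1 hs
    rw [← e1.pc] at hc
    have hv : |inp.word (e.eval inp s)| ≤ B := by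
      rw [MachineInput.word, List.getD_eq_getElem?_getD]
      cases h : inp.words[(e.eval inp s).toNat]? with
      | none => simp
      | some v => exact hin v (List.mem_of_getElem? h)
    refine ⟨_, r1.trans (Reach.setReg hc.2.1 ?_ e1.fits hv), e1.setReg hv⟩
    rw [Instr.exec, e1.val]
    rfl

/-- Two expressions evaluated one after the other. -/
theorem WExp.reach_compile_pair (hin : ∀ v ∈ inp.words, |v| ≤ (B : ℤ)) {e f : WExp} {s : AState}
    (he : e.Ok B inp s) (hf : f.Ok B inp s) {a : Instr} {st : State}
    (hc : CodeAt prog st.pc (e.compile 0 ++ (f.compile 1 ++ [a]))) (hs : Represents B s st) :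
    ∃ st', Reach prog inp B (e.cost + f.cost) st st' ∧ st'.pc = st.pc + (e.cost + f.cost) ∧
      Represents B s st' ∧ st'.regs (tmpReg 0) = e.eval inp s ∧
      st'.regs (tmpReg 1) = f.eval inp s ∧ prog[st'.pc]? = some a := by
  simp only [codeAt_append, codeAt_cons, WExp.length_compile] at hc
  obtain ⟨st1, r1, e1⟩ := e.reach_compile hin he hc.1 hs
  rw [← e1.pc] at hc
  obtain ⟨st2, r2, e2⟩ := f.reach_compile hin hf hc.2.1 (hs.evalStep e1)
  rw [← e2.pc] at hc
  have e12 := e1.comp e2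
  exact ⟨st2, r1.trans r2, e12.pc, hs.evalStep e12, e12.val, e2.val, hc.2.2.1⟩

theorem Represents.jump {s : AState} {st : State} (h : Represents B s st) (p : ℕ) :
    Represents B s ⟨p, st.regs, st.mem⟩ := ⟨h.var, h.arr, h.rarr, h.fits⟩

theorem Cond.reach_compile (hin : ∀ v ∈ inp.words, |v| ≤ (B : ℤ)) (b : Cond) {s : AState}
    (hok : b.Ok B inp s) {l : ℕ} {st : State} (hc : CodeAt prog st.pc (b.compile l))
    (hs : Represents B s st) :
    ∃ st', Reach prog inp B b.cost st st' ∧ Represents B (s.tick b.cost) st' ∧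
      (b.holds inp s → st'.pc = l) ∧ (¬ b.holds inp s → st'.pc = st.pc + b.cost) := by
  cases b with
  | le e f =>
    obtain ⟨st1, r1, p1, h1, v, v', hi⟩ := WExp.reach_compile_pair hin hok.1 hok.2 hc hs
    refine ⟨_, r1.trans (Reach.single hi h1.fits (h1.jump _).fits), (h1.jump _).tick _, ?_, ?_⟩
    · intro h
      simp only [Cond.holds] at h
      simp [Instr.exec, v, v', h]
    · intro h
      simp only [Cond.holds] at h
      simp only [Instr.exec, v, v', h, if_false, p1, Cond.cost]
      omega
  | rle a e b f =>
    obtain ⟨st1, r1, p1, h1, v, v', hi⟩ := WExp.reach_compile_pair hin hok.1 hok.2 hc hs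
    have w : st1.mem.reals (st1.regs (tmpReg 0)) = s.rarr a (e.eval inp s) := by
      rw [v, ← h1.rarr]; rfl
    have w' : st1.mem.reals (st1.regs (tmpReg 1)) = s.rarr b (f.eval inp s) := by
      rw [v', ← h1.rarr]; rfl
    refine ⟨_, r1.trans (Reach.single hi h1.fits (h1.jump _).fits), (h1.jump _).tick _, ?_, ?_⟩
    · intro h
      simp only [Cond.holds] at h
      simp [Instr.exec, w, w', h]
    · intro h
      simp only [Cond.holds] at h
      simp only [Instr.exec, w, w', h, if_false, p1, Cond.cost]
      omega

theorem Represents.setVar {s : AState} {st : State} (h : Represents B s st) (x : ℕ) {v : ℤ}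
    (hv : |v| ≤ B) (t : ℕ) : Represents B (s.setVar x v t) (st.setReg (2 * x) v) where
  var y := by
    by_cases hxy : y = x
    · simp [State.setReg, AState.setVar, hxy]
    · simp [State.setReg, AState.setVar, hxy, h.var]
  arr := h.arr
  rarr := h.rarr
  fits := h.fits.setReg _ hv

/-- The residue modulo 8 of an address determines its array, so different arrays never share a cell.
-/
theorem address_inj {a b : Fin 8} {i j : ℤ} :
    i * 8 + (a.val : ℤ) = j * 8 + (b.val : ℤ) ↔ a = b ∧ i = j := by
  have ha := a.isLt
  have hb := b.isLt
  rw [Fin.ext_iff]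
  omega

theorem Represents.setArr {s : AState} {st : State} (h : Represents B s st) (a : Fin 8) (i : ℤ)
    {v : ℤ} (hv : |v| ≤ B) (t : ℕ) :
    Represents B (s.setArr a i v t) (st.setWord (i * 8 + (a.val : ℤ)) v) where
  var := h.var
  arr b j := by
    simp only [State.setWord, AState.setArr, Function.update_apply, address_inj]
    by_cases hb : b = a
    · subst hb
      by_cases hj : j = i <;> simp [hj, h.arr]
    · simp [hb, h.arr]
  rarr := h.rarr
  fits := h.fits.setWord _ hv

theorem Represents.setReal {s : AState} {st : State} (h : Represents B s st) (a : Fin 8) (i : ℤ)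
    (v : ℝ) (t : ℕ) :
    Represents B (s.setReal a i v t) (st.setReal (i * 8 + (a.val : ℤ)) v) where
  var := h.var
  arr := h.arr
  rarr b j := by
    simp only [State.setReal, AState.setReal, Function.update_apply, address_inj]
    by_cases hb : b = a
    · subst hb
      by_cases hj : j = i <;> simp [hj, h.rarr]
    · simp [hb, h.rarr]
  fits := h.fits

theorem Reach.jump {p : ℕ} {s : AState} {st : State} (h : prog[st.pc]? = some (.jumpLe 0 0 p))
    (hs : Represents B s st) : Reach prog inp B 1 st ⟨p, st.regs, st.mem⟩ := by
  have := Reach.single (inp := inp) h hs.fits (by simpa [Instr.exec] using (hs.jump p).fits)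
  simpa [Instr.exec] using this

/-- Soundness of the calculus. The elapsed `time` of the abstract state is exactly the number of
machine steps, so a time bound in a postcondition bounds the machine. -/
theorem Cmd.reach_compile (hin : ∀ v ∈ inp.words, |v| ≤ (B : ℤ)) (c : Cmd)
    {Q : AState → Prop} {s : AState} (hwp : c.wp B inp Q s) {st : State}
    (hc : CodeAt prog st.pc (c.compile st.pc)) (hs : Represents B s st) :
    ∃ st' s' t, Reach prog inp B t st st' ∧ st'.pc = st.pc + c.size ∧ Represents B s' st' ∧
      s'.time = s.time + t ∧ Q s' := by
  induction c generalizing Q s st with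
  | skip => exact ⟨st, s, 0, Reach.refl hs.fits, rfl, hs, rfl, hwp⟩
  | assign x e =>
    simp only [Cmd.compile, codeAt_append, codeAt_cons, WExp.length_compile] at hc
    obtain ⟨hok, hQ⟩ := hwp
    obtain ⟨st1, r1, e1⟩ := e.reach_compile hin hok hc.1 hs
    rw [← e1.pc] at hc
    have hz : |(0 : ℤ)| ≤ B := by simp
    have hv : |e.eval inp s| ≤ B := by rw [← e1.val]; exact e1.fits.1 _
    have e2 := e1.setReg_succ hz
    have h2 := hs.evalStep e2
    refine ⟨_, _, _, r1.trans ((Reach.setReg hc.2.1 rfl e1.fits hz).trans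
      (Reach.setReg (c := e.eval inp s) hc.2.2.1 ?_ e2.fits hv)), ?_,
      h2.setVar x hv (e.cost + 2), ?_, hQ⟩
    · simp [Instr.exec, State.setReg, tmpReg_inj, e1.val]
    · simp [State.setReg, e1.pc, Cmd.size]; omega
    · simp [AState.setVar]
  | store a e f =>
    obtain ⟨hok, hok', hQ⟩ := hwp
    obtain ⟨st1, r1, p1, h1, v, v', hi⟩ := WExp.reach_compile_pair hin hok hok' hc hs
    have hv : |f.eval inp s| ≤ B := by rw [← v']; exact h1.fits.1 _
    have h2 := h1.setArr a (e.eval inp s) hv ((WExp.addr a e).cost + f.cost + 1)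
    have he : Instr.exec inp st1 (.store (tmpReg 0) (tmpReg 1)) =
        st1.setWord (e.eval inp s * 8 + (a.val : ℤ)) (f.eval inp s) := by
      rw [Instr.exec, v, v']; rfl
    refine ⟨_, _, _, r1.trans (he ▸ Reach.single hi h1.fits (he ▸ h2.fits)), ?_, h2, ?_, hQ⟩
    · simp [State.setWord, p1, Cmd.size]; omega
    · simp [AState.setArr]
  | realCopy a e b f =>
    obtain ⟨hok, hok', hQ⟩ := hwp
    obtain ⟨st1, r1, p1, h1, v, v', hi⟩ := WExp.reach_compile_pair hin hok hok' hc hs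
    have h2 := h1.setReal a (e.eval inp s) (s.rarr b (f.eval inp s))
      ((WExp.addr a e).cost + (WExp.addr b f).cost + 1)
    have he : Instr.exec inp st1 (.realCopy (tmpReg 0) (tmpReg 1)) =
        st1.setReal (e.eval inp s * 8 + (a.val : ℤ)) (s.rarr b (f.eval inp s)) := by
      rw [Instr.exec, v, v', ← h1.rarr]; rfl
    refine ⟨_, _, _, r1.trans (he ▸ Reach.single hi h1.fits (he ▸ h2.fits)), ?_, h2, ?_, hQ⟩
    · simp [State.setReal, p1, Cmd.size]; omega
    · simp [AState.setReal]
  | realRead a e f =>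
    obtain ⟨hok, hok', hQ⟩ := hwp
    obtain ⟨st1, r1, p1, h1, v, v', hi⟩ := WExp.reach_compile_pair hin hok hok' hc hs
    have h2 := h1.setReal a (e.eval inp s) (inp.real (f.eval inp s))
      ((WExp.addr a e).cost + f.cost + 1)
    have he : Instr.exec inp st1 (.realRead (tmpReg 0) (tmpReg 1)) =
        st1.setReal (e.eval inp s * 8 + (a.val : ℤ)) (inp.real (f.eval inp s)) := by
      rw [Instr.exec, v, v']; rfl
    refine ⟨_, _, _, r1.trans (he ▸ Reach.single hi h1.fits (he ▸ h2.fits)), ?_, h2, ?_, hQ⟩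
    · simp [State.setReal, p1, Cmd.size]; omega
    · simp [AState.setReal]
  | seq c d hc1 hd1 =>
    simp only [Cmd.compile, codeAt_append, Cmd.length_compile] at hc
    obtain ⟨st1, s1, t1, r1, p1, h1, u1, q1⟩ := hc1 hwp hc.1 hs
    rw [← p1] at hc
    obtain ⟨st2, s2, t2, r2, p2, h2, u2, q2⟩ := hd1 q1 hc.2 h1
    exact ⟨st2, s2, _, r1.trans r2, by rw [p2, p1, Cmd.size, add_assoc], h2,
      by rw [u2, u1, add_assoc], q2⟩
  | ite b c d hc1 hd1 =>
    simp only [Cmd.compile, codeAt_append, codeAt_cons, Cmd.length_compile, Cond.length_compile,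
      List.length_singleton] at hc
    obtain ⟨hok, hT, hF⟩ := hwp
    obtain ⟨st1, r1, h1, pT, pF⟩ := b.reach_compile hin hok hc.1 hs
    by_cases hb : b.holds inp s
    · have hp := pT hb
      rw [← hp] at hc
      obtain ⟨st2, s2, t2, r2, p2, h2, u2, q2⟩ := hc1 (hT hb) hc.2.2.2 h1
      refine ⟨st2, s2, _, r1.trans r2, ?_, h2, ?_, q2⟩
      · rw [p2, hp, Cmd.size]; omega
      · rw [u2, AState.tick, add_assoc]
    · have hp := pF hb
      rw [← hp] at hc
      obtain ⟨st2, s2, t2, r2, p2, h2, u2, q2⟩ := hd1 (hF hb) hc.2.1 h1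
      rw [← p2] at hc
      refine ⟨_, s2.tick 1, _, (r1.trans r2).trans (Reach.jump hc.2.2.1.1 h2), ?_,
        (h2.jump _).tick 1, ?_, q2⟩
      · simp only [Cmd.size]; omega
      · simp only [AState.tick, u2]; omega
  | loop b c hc1 =>
    have hcode := hc
    simp only [Cmd.compile, codeAt_append, codeAt_cons, Cmd.length_compile, Cond.length_compile,
      List.length_singleton] at hc
    obtain ⟨k, hk⟩ := hwp
    -- An inner induction on the number of tests: after the body the machine jumps back to `st.pc`,
    -- where the same code stands.
    induction k generalizing s st with
    | zero => exact hk.elim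
    | succ k ih =>
      obtain ⟨hok, hT, hF⟩ := hk
      obtain ⟨st1, r1, h1, pT, pF⟩ := b.reach_compile hin hok hc.1 hs
      by_cases hb : b.holds inp s
      · have hp := pT hb
        obtain ⟨-, -, hc2, hc3, -⟩ := hc
        rw [← hp] at hc2 hc3
        obtain ⟨st2, s2, t2, r2, p2, h2, u2, q2⟩ := hc1 (hT hb) hc2 h1
        rw [← p2] at hc3
        have r3 := Reach.jump (inp := inp) hc3 h2
        obtain ⟨st4, s4, t4, r4, p4, h4, u4, q4⟩ :=
          ih ((h2.jump st.pc).tick 1) hcode (by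
            simpa only [Cmd.compile, codeAt_append, codeAt_cons, Cmd.length_compile,
              Cond.length_compile, List.length_singleton] using hcode) q2
        refine ⟨st4, s4, _, (r1.trans r2).trans (r3.trans r4), p4, h4, ?_, q4⟩
        simp only [u4, u2, AState.tick]
        omega
      · have hp := pF hb
        rw [← hp] at hc
        refine ⟨_, _, _, r1.trans (Reach.jump hc.2.1.1 h1), ?_, (h1.jump _).tick 1, ?_, hF hb⟩
        · simp only [Cmd.size]; omega
        · simp only [AState.tick]; omega

/-- A structured program, run from the start on a memory. -/
theorem Cmd.haltsWithin_of_wp (hin : ∀ v ∈ inp.words, |v| ≤ (B : ℤ)) {c : Cmd} {M : Memory}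
    (hM : ∀ a, |M.words a| ≤ (B : ℤ)) {Q : AState → Prop}
    (hwp : c.wp B inp Q ⟨fun _ => 0, fun a i => M.words (i * 8 + (a.val : ℤ)),
      fun a i => M.reals (i * 8 + (a.val : ℤ)), 0⟩) :
    ∃ (s : State) (s' : AState), HaltsWithin (c.compile 0) inp M s'.time B s ∧
      Represents B s' s ∧ Q s' := by
  have h0 : Represents B ⟨fun _ => 0, fun a i => M.words (i * 8 + (a.val : ℤ)),
      fun a i => M.reals (i * 8 + (a.val : ℤ)), 0⟩ (State.start M) :=
    ⟨fun _ => rfl, fun _ _ => rfl, fun _ _ => rfl, fun _ => by simp [State.start], hM⟩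
  obtain ⟨st, s', t, r, p, h, u, q⟩ := Cmd.reach_compile (prog := c.compile 0) hin c hwp
    (fun k _ => by simp [State.start]) h0
  refine ⟨st, s', ⟨?_, ?_, ?_⟩, h, q⟩
  · rw [u]; simpa using r.1
  · rw [p, Cmd.length_compile]; omega
  · rw [u]; simpa using r.2

end Compile

/-! ### Rules for the weakest precondition calculus -/

namespace Cmd

variable {B : ℕ} {inp : MachineInput}

theorem wp_mono {c : Cmd} {Q Q' : AState → Prop} (h : ∀ s, Q s → Q' s) {s : AState}
    (hc : c.wp B inp Q s) : c.wp B inp Q' s := by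
  induction c generalizing Q Q' s with
  | skip => exact h _ hc
  | assign | store | realCopy | realRead => simp only [wp] at hc ⊢; tauto
  | seq c d ihc ihd => exact ihc (fun s' => ihd h) hc
  | ite b c d ihc ihd =>
    exact ⟨hc.1, fun hb => ihc h (hc.2.1 hb), fun hb => ihd (fun _ => h _) (hc.2.2 hb)⟩
  | loop b c ih =>
    obtain ⟨k, hk⟩ := hc
    refine ⟨k, ?_⟩
    induction k generalizing s with
    | zero => exact hk
    | succ k ihk =>
      exact ⟨hk.1, fun hb => ih (fun s' hs' => ihk hs') (hk.2.1 hb), fun hb => h _ (hk.2.2 hb)⟩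

/-- The variables assigned by a command. -/
def vars : Cmd → List ℕ
  | assign x _ => [x]
  | seq c d => c.vars ++ d.vars
  | ite _ c d => c.vars ++ d.vars
  | loop _ c => c.vars
  | _ => []

/-- The word arrays changed by a command. -/
def arrs : Cmd → List (Fin 8)
  | store a _ _ => [a]
  | seq c d => c.arrs ++ d.arrs
  | ite _ c d => c.arrs ++ d.arrs
  | loop _ c => c.arrs
  | _ => []

/-- The real arrays changed by a command. -/
def rarrs : Cmd → List (Fin 8)
  | realCopy a _ _ _ => [a]
  | realRead a _ _ => [a]
  | seq c d => c.rarrs ++ d.rarrs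
  | ite _ c d => c.rarrs ++ d.rarrs
  | loop _ c => c.rarrs
  | _ => []

end Cmd

/-- The states `s` and `s'` agree outside the given variables, word arrays and real arrays. -/
structure Agree (X : List ℕ) (A R : List (Fin 8)) (s s' : AState) : Prop where
  var : ∀ x ∉ X, s'.var x = s.var x
  arr : ∀ a ∉ A, s'.arr a = s.arr a
  rarr : ∀ a ∉ R, s'.rarr a = s.rarr a

theorem Agree.refl (X : List ℕ) (A R : List (Fin 8)) (s : AState) : Agree X A R s s :=
  ⟨fun _ _ => rfl, fun _ _ => rfl, fun _ _ => rfl⟩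

theorem Agree.tick {X : List ℕ} {A R : List (Fin 8)} {s s' : AState} (h : Agree X A R s s')
    (t : ℕ) : Agree X A R s (s'.tick t) := ⟨h.var, h.arr, h.rarr⟩

theorem Agree.setVar {X : List ℕ} {A R : List (Fin 8)} {s s' : AState} (h : Agree X A R s s')
    {x : ℕ} (hx : x ∈ X) (v : ℤ) (t : ℕ) : Agree X A R s (s'.setVar x v t) where
  var y hy := by
    have : y ≠ x := by rintro rfl; exact hy hx
    simp [AState.setVar, this, h.var y hy]
  arr := h.arr
  rarr := h.rarr

theorem Agree.setArr {X : List ℕ} {A R : List (Fin 8)} {s s' : AState} (h : Agree X A R s s')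
    {a : Fin 8} (ha : a ∈ A) (i v : ℤ) (t : ℕ) : Agree X A R s (s'.setArr a i v t) where
  var := h.var
  arr b hb := by
    have : b ≠ a := by rintro rfl; exact hb ha
    simp [AState.setArr, this, h.arr b hb]
  rarr := h.rarr

theorem Agree.setReal {X : List ℕ} {A R : List (Fin 8)} {s s' : AState} (h : Agree X A R s s')
    {a : Fin 8} (ha : a ∈ R) (i : ℤ) (v : ℝ) (t : ℕ) : Agree X A R s (s'.setReal a i v t) where
  var := h.var
  arr := h.arr
  rarr b hb := by
    have : b ≠ a := by rintro rfl; exact hb ha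
    simp [AState.setReal, this, h.rarr b hb]

namespace Cmd

variable {B : ℕ} {inp : MachineInput}

/-- A frame rule: what a command cannot write is found syntactically, so specifications need to
mention only what they establish. -/
theorem wp_agree {c : Cmd} {X : List ℕ} {A R : List (Fin 8)} (hX : c.vars ⊆ X) (hA : c.arrs ⊆ A)
    (hR : c.rarrs ⊆ R) {Q : AState → Prop} {r s : AState} (hs : Agree X A R r s)
    (hc : c.wp B inp Q s) : c.wp B inp (fun s' => Q s' ∧ Agree X A R r s') s := by
  induction c generalizing Q s with
  | skip => exact ⟨hc, hs⟩
  | assign x e => exact ⟨hc.1, hc.2, hs.setVar (hX (by simp [vars])) _ _⟩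
  | store a e f => exact ⟨hc.1, hc.2.1, hc.2.2, hs.setArr (hA (by simp [arrs])) _ _ _⟩
  | realCopy a e b f => exact ⟨hc.1, hc.2.1, hc.2.2, hs.setReal (hR (by simp [rarrs])) _ _ _⟩
  | realRead a e f => exact ⟨hc.1, hc.2.1, hc.2.2, hs.setReal (hR (by simp [rarrs])) _ _ _⟩
  | seq c d ihc ihd =>
    simp only [vars, arrs, rarrs, List.append_subset] at hX hA hR
    exact wp_mono (fun s' h => ihd hX.2 hA.2 hR.2 h.2 h.1) (ihc hX.1 hA.1 hR.1 hs hc)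
  | ite b c d ihc ihd =>
    simp only [vars, arrs, rarrs, List.append_subset] at hX hA hR
    exact ⟨hc.1, fun hb => ihc hX.1 hA.1 hR.1 (hs.tick _) (hc.2.1 hb), fun hb =>
      wp_mono (fun s' h => ⟨h.1, h.2.tick 1⟩) (ihd hX.2 hA.2 hR.2 (hs.tick _) (hc.2.2 hb))⟩
  | loop b c ih =>
    obtain ⟨k, hk⟩ := hc
    refine ⟨k, ?_⟩
    induction k generalizing s with
    | zero => exact hk
    | succ k ihk =>
      exact ⟨hk.1, fun hb => wp_mono (fun s' h => ihk (h.2.tick 1) h.1)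
        (ih hX hA hR (hs.tick _) (hk.2.1 hb)), fun hb => ⟨hk.2.2 hb, hs.tick _⟩⟩

/-- A specification of a command, together with what the command does not change. -/
theorem wp_call {c : Cmd} {P Q : AState → Prop} {s : AState} (hc : c.wp B inp P s)
    (h : ∀ s', Agree c.vars c.arrs c.rarrs s s' → P s' → Q s') : c.wp B inp Q s :=
  wp_mono (fun s' hs' => h s' hs'.2 hs'.1)
    (wp_agree (fun _ => id) (fun _ => id) (fun _ => id) (Agree.refl _ _ _ _) hc)

theorem wp_skip {Q : AState → Prop} {s : AState} : skip.wp B inp Q s ↔ Q s := Iff.rfl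

theorem wp_assign {x : ℕ} {e : WExp} {Q : AState → Prop} {s : AState} :
    (assign x e).wp B inp Q s ↔
      e.Ok B inp s ∧ Q (s.setVar x (e.eval inp s) (e.cost + 2)) := Iff.rfl

theorem wp_store {a : Fin 8} {e f : WExp} {Q : AState → Prop} {s : AState} :
    (store a e f).wp B inp Q s ↔ (WExp.addr a e).Ok B inp s ∧ f.Ok B inp s ∧
      Q (s.setArr a (e.eval inp s) (f.eval inp s) ((WExp.addr a e).cost + f.cost + 1)) := Iff.rfl

theorem wp_realCopy {a b : Fin 8} {e f : WExp} {Q : AState → Prop} {s : AState} :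
    (realCopy a e b f).wp B inp Q s ↔ (WExp.addr a e).Ok B inp s ∧ (WExp.addr b f).Ok B inp s ∧
      Q (s.setReal a (e.eval inp s) (s.rarr b (f.eval inp s))
        ((WExp.addr a e).cost + (WExp.addr b f).cost + 1)) := Iff.rfl

theorem wp_realRead {a : Fin 8} {e f : WExp} {Q : AState → Prop} {s : AState} :
    (realRead a e f).wp B inp Q s ↔ (WExp.addr a e).Ok B inp s ∧ f.Ok B inp s ∧
      Q (s.setReal a (e.eval inp s) (inp.real (f.eval inp s))
        ((WExp.addr a e).cost + f.cost + 1)) := Iff.rfl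

theorem wp_seq {c d : Cmd} {Q : AState → Prop} {s : AState} :
    (c ;; d).wp B inp Q s ↔ c.wp B inp (fun s' => d.wp B inp Q s') s := Iff.rfl

theorem wp_ite {b : Cond} {c d : Cmd} {Q : AState → Prop} {s : AState} :
    (ite b c d).wp B inp Q s ↔ b.Ok B inp s ∧
      (b.holds inp s → c.wp B inp Q (s.tick b.cost)) ∧
      (¬ b.holds inp s → d.wp B inp (fun s' => Q (s'.tick 1)) (s.tick b.cost)) := Iff.rfl

/-- Loops with an invariant and a measure. -/
theorem wp_loop {b : Cond} {c : Cmd} {Q : AState → Prop} {s : AState} (I : AState → Prop)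
    (μ : AState → ℕ) (hs : I s)
    (h : ∀ s', Agree c.vars c.arrs c.rarrs s s' → I s' → b.Ok B inp s' ∧
      (b.holds inp s' → c.wp B inp (fun s'' => I (s''.tick 1) ∧ μ (s''.tick 1) < μ s')
        (s'.tick b.cost)) ∧
      (¬ b.holds inp s' → Q (s'.tick (b.cost + 1)))) :
    (loop b c).wp B inp Q s := by
  -- The measure bounds the number of runs of the body; the additional unit pays for the last,
  -- failing test.
  suffices H : ∀ N s', I s' → Agree c.vars c.arrs c.rarrs s s' → μ s' < N →
      Nat.rec (motive := fun _ => AState → Prop) (fun _ => False)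
        (fun _ R s => b.Ok B inp s ∧
          (b.holds inp s → c.wp B inp (fun s' => R (s'.tick 1)) (s.tick b.cost)) ∧
          (¬ b.holds inp s → Q (s.tick (b.cost + 1)))) N s' from
    ⟨μ s + 1, H _ s hs (Agree.refl _ _ _ _) (Nat.lt_succ_self _)⟩
  intro N
  induction N with
  | zero => intro s' _ _ hs'; omega
  | succ N ih =>
    intro s' hI ha hN
    obtain ⟨hok, hT, hF⟩ := h s' ha hI
    exact ⟨hok, fun hb => wp_mono (fun s'' h'' => ih _ h''.1.1 (h''.2.tick 1) (by omega))
      (wp_agree (fun _ => id) (fun _ => id) (fun _ => id) (ha.tick _) (hT hb)), hF⟩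

/-- The loop in which the variable `x` runs from `0` to the value of the variable `y`, excluded. -/
def forTo (x y : ℕ) (c : Cmd) : Cmd :=
  assign x (.const 0) ;;
    loop (.le (.add (.var x) (.const 1)) (.var y)) (c ;; assign x (.add (.var x) (.const 1)))

/-- The invariant does not see the clock; `T` bounds one run of the body. The overhead 14 per round
is 7 for the test, 6 for the increment and 1 for the jump back; 11 is 3 for the initialization and 8
for the failing test with the exit jump. In `hstep` the counter is updated by hand because the
increment follows the body. -/
theorem wp_forTo {x y : ℕ} {c : Cmd} {Q : AState → Prop} {s : AState} (n T : ℕ)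
    (I : ℕ → (ℕ → ℤ) → (Fin 8 → ℤ → ℤ) → (Fin 8 → ℤ → ℝ) → Prop)
    (hx : x ∉ c.vars) (hy : y ∉ c.vars) (hxy : y ≠ x) (hn : s.var y = (n : ℤ)) (hB : n + 1 ≤ B)
    (h0 : I 0 (Function.update s.var x 0) s.arr s.rarr)
    (hstep : ∀ k < n, ∀ s', s'.var x = (k : ℤ) → Agree (x :: c.vars) c.arrs c.rarrs s s' →
      I k s'.var s'.arr s'.rarr → c.wp B inp (fun s'' => s''.time ≤ s'.time + T ∧
        I (k + 1) (Function.update s''.var x ((k + 1 : ℕ) : ℤ)) s''.arr s''.rarr) s')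
    (hQ : ∀ s', s'.var x = (n : ℤ) → Agree (x :: c.vars) c.arrs c.rarrs s s' →
      s'.time ≤ s.time + (T + 14) * n + 11 → I n s'.var s'.arr s'.rarr → Q s') :
    (forTo x y c).wp B inp Q s := by
  have h1 : |(1 : ℤ)| ≤ B := by simp; omega
  rw [forTo, wp_seq, wp_assign]
  refine ⟨by simp [WExp.Ok], wp_loop
    (fun s' => ∃ k ≤ n, s'.var x = k ∧ Agree (x :: c.vars) c.arrs c.rarrs s s' ∧
      s'.time ≤ s.time + (T + 14) * k + 3 ∧ I k s'.var s'.arr s'.rarr)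
    (fun s' => n - (s'.var x).toNat) ?_ ?_⟩
  · exact ⟨0, n.zero_le, by simp [AState.setVar, WExp.eval], (Agree.refl _ _ _ _).setVar (by simp) _ _,
      by simp [AState.setVar, WExp.cost], h0⟩
  rintro s' - ⟨k, hk, hkx, ha, ht, hI⟩
  have hyn : s'.var y = n := by rw [ha.var y (by simp [hxy, hy]), hn]
  have hk1 : |(k : ℤ) + 1| ≤ B := by grind
  refine ⟨?_, ?_, ?_⟩
  · simpa [Cond.Ok, WExp.Ok, WExp.eval, hkx] using And.intro (by omega : 1 ≤ B) hk1
  · intro hb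
    simp only [Cond.holds, WExp.eval, hkx, hyn] at hb
    have hkn : k < n := by omega
    rw [wp_seq]
    refine wp_mono ?_ (wp_agree (List.subset_cons_self _ _) (fun _ => id) (fun _ => id)
      (ha.tick _) (wp_agree (X := c.vars) (fun _ => id) (fun _ => id) (fun _ => id)
        (Agree.refl _ _ _ _) (hstep k hkn _ hkx (ha.tick _) hI)))
    rintro s'' ⟨⟨⟨ht', hI'⟩, ha'⟩, ha''⟩
    have hx'' : s''.var x = k := by rw [ha'.var x hx]; exact hkx
    rw [wp_assign]
    simp only [WExp.Ok, WExp.eval, hx'', true_and, WExp.cost]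
    refine ⟨⟨h1, hk1⟩, ⟨k + 1, hkn, by simp [AState.setVar, AState.tick],
      (ha''.setVar (by simp) _ _).tick _, ?_, by simpa [AState.setVar, AState.tick] using hI'⟩, ?_⟩
    · simp only [AState.setVar, AState.tick, Cond.cost, WExp.cost] at ht' ⊢
      grind
    · simp [AState.setVar, AState.tick, hkx]
      omega
  · intro hb
    simp only [Cond.holds, WExp.eval, hkx, hyn] at hb
    obtain rfl : k = n := by omega
    refine hQ _ hkx (ha.tick _) ?_ hI
    simp only [AState.tick, Cond.cost, WExp.cost]
    omega

end Cmd

/-! ### The regions of a perturbed closed dual walk -/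

/-- Iterating the cyclic successor from `i` reaches every index, so a property can be carried once
round a closed walk. -/
theorem finRotate_induction {n : ℕ} {P : Fin n → Prop} {i : Fin n} (hi : P i)
    (h : ∀ j, P j → P (finRotate n j)) (j : Fin n) : P j := by
  cases n with
  | zero => exact i.elim0
  | succ n =>
    have key : ∀ k : ℕ, P (i + Fin.ofNat (n + 1) k) := by
      intro k
      induction k with
      | zero => simpa using hi
      | succ k ih =>
        have := h _ ih
        rw [finRotate_apply, add_assoc] at this
        convert this using 2
        ext
        simp [Fin.val_add]
    have := key (j - i).val
    simpa using this

namespace PlaneGraph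

variable {n D : ℕ} {G : PlaneGraph n D}

/-- A chord that ends outside a segment of an arc has the ends of the segment on the same side. -/
theorem onArc_segment {x y : Fin D × ℝ} {d : Fin D} {s s' : ℝ} (hx : x.2 < 1) (hy : 0 < y.2)
    (hy' : y.2 < 1) (hs : 0 ≤ s) (hss : s ≤ s') (hs' : s' ≤ 1)
    (hxd : x.1 = d → s ≤ x.2 → s' ≤ x.2) (hyd : y.1 = d → s < y.2 → s' < y.2) :
    G.OnArc x (d, s) y ↔ G.OnArc x (d, s') y := by
  constructor
  · rintro ⟨i, j, hi, hj, h1, h2, h3⟩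
    refine ⟨i, j, hi, hj, ?_, ?_, h3⟩
    · simp only at h1 ⊢
      linarith
    · simp only at h2 ⊢
      -- Moving to `s'` can pass the end of the chord only if both are on the same arc; if that end
      -- is on a later arc, `s' ≤ 1` leaves no room to reach it.
      rcases lt_trichotomy i j with hij | rfl | hij
      · have : (i : ℝ) + 1 ≤ j := by exact_mod_cast hij
        linarith
      · have := hyd (hj.symm.trans hi) (by linarith)
        linarith
      · have : (j : ℝ) + 1 ≤ i := by exact_mod_cast hij
        linarith
  · rintro ⟨i, j, hi, hj, h1, h2, h3⟩
    refine ⟨i, j, hi, hj, ?_, ?_, h3⟩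
    · simp only at h1 ⊢
      rcases Nat.eq_zero_or_pos i with rfl | hi0
      · simp only [pow_zero, Equiv.Perm.one_apply] at hi
        by_contra hc
        have := hxd hi (by push_cast at hc; linarith)
        push_cast at h1
        linarith
      · have : (1 : ℝ) ≤ i := by exact_mod_cast hi0
        linarith
    · simp only at h2 ⊢
      linarith

/-- Both descriptions give the same distance from `x`, written `i + 1` or `(i + 1) + 0`. Distance
zero, where the arc index has no predecessor, is excluded since the point must come strictly after
`x`. -/
theorem onArc_corner {x y : Fin D × ℝ} (d : Fin D) (hx0 : 0 ≤ x.2) :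
    G.OnArc x (d, 1) y ↔ G.OnArc x (G.faceNext d, 0) y := by
  constructor
  · rintro ⟨i, j, hi, hj, h1, h2, h3⟩
    refine ⟨i + 1, j, ?_, hj, ?_, ?_, h3⟩
    · rw [pow_succ', Equiv.Perm.mul_apply, hi]
    · push_cast; simp only at h1 ⊢; linarith
    · push_cast; simp only at h2 ⊢; linarith
  · rintro ⟨i, j, hi, hj, h1, h2, h3⟩
    cases i with
    | zero => simp only [Nat.cast_zero] at h1; linarith
    | succ i =>
      refine ⟨i, j, ?_, hj, ?_, ?_, h3⟩
      · rw [pow_succ', Equiv.Perm.mul_apply] at hi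
        exact G.faceNext.injective hi
      · push_cast at h1; simp only at h1 ⊢; linarith
      · push_cast at h2; simp only at h2 ⊢; linarith

variable {γ : List (Fin D)} {p : Fin γ.length → ℝ}

theorem isFree_flip {d : Fin D} {s : ℝ} (h : G.IsFree γ p (d, s)) :
    G.IsFree γ p (G.rev d, 1 - s) := by
  obtain ⟨h0, h1, h⟩ := h
  simp only at h0 h1
  refine ⟨by simp only; linarith, by simp only; linarith, fun i => ⟨fun hi => (h i).2 ?_, fun hi => (h i).1 ?_⟩⟩
  · rw [Prod.mk.injEq] at hi ⊢
    exact ⟨by rw [← hi.1, G.rev_rev], by linarith [hi.2]⟩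
  · rw [Prod.mk.injEq] at hi ⊢
    exact ⟨G.rev.injective hi.1, by linarith [hi.2]⟩

theorem sameRegion_flip {d : Fin D} {s : ℝ} (h : G.IsFree γ p (d, s)) :
    G.SameRegion γ p (d, s) (G.rev d, 1 - s) := .rel _ _ (.flip d s h)

theorem SameRegion.symm {x y : Fin D × ℝ} (h : G.SameRegion γ p x y) : G.SameRegion γ p y x :=
  Relation.EqvGen.symm _ _ h

theorem SameRegion.trans {x y z : Fin D × ℝ} (h : G.SameRegion γ p x y)
    (h' : G.SameRegion γ p y z) : G.SameRegion γ p x z :=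
  Relation.EqvGen.trans _ _ _ h h'

theorem SameRegion.inside_iff {x y : Fin D × ℝ} (h : G.SameRegion γ p x y) (o : Fin D) :
    G.Inside γ p o x ↔ G.Inside γ p o y :=
  not_congr ⟨fun h' => h.symm.trans h', fun h' => h.trans h'⟩

/-- A segment of an arc without crossings lies in one region. -/
theorem sameRegion_segment (hp : G.IsSimplePerturbation γ p) {d : Fin D} {s s' : ℝ} (hss : s ≤ s')
    (h : ∀ t, s ≤ t → t ≤ s' → G.IsFree γ p (d, t)) : G.SameRegion γ p (d, s) (d, s') := by
  have hs := h s le_rfl hss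
  have hs' := h s' hss le_rfl
  have key : ∀ j, G.OnArc (G.chordStart γ p j) (d, s) (chordEnd γ p j) ↔
      G.OnArc (G.chordStart γ p j) (d, s') (chordEnd γ p j) := by
    intro j
    have h1 := hp.pos j
    have h2 := hp.pos (finRotate _ j)
    have h3 := hp.lt_one (finRotate _ j)
    refine onArc_segment (by simp [chordStart, h1]) h2 h3 hs.1 hss hs'.2.1 ?_ ?_
    · rintro rfl hle
      by_contra hc
      exact ((h _ hle (not_le.1 hc).le).2.2 j).2 rfl
    · rintro rfl hle
      by_contra hc
      exact ((h _ hle.le (not_lt.1 hc)).2.2 _).1 rfl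
  refine .rel _ _ (.face _ _ hs hs' (Equiv.Perm.SameCycle.refl _ _) fun j hj => ?_)
  rw [Separates, key j] at hj
  simp at hj

theorem isFree_zero (hp : G.IsSimplePerturbation γ p) (d : Fin D) : G.IsFree γ p (d, 0) := by
  refine ⟨le_rfl, zero_le_one, fun i => ⟨fun h => ?_, fun h => ?_⟩⟩ <;> rw [Prod.mk.injEq] at h
  · linarith [hp.pos i, h.2]
  · linarith [hp.lt_one i, h.2]

theorem isFree_one (hp : G.IsSimplePerturbation γ p) (d : Fin D) : G.IsFree γ p (d, 1) := by
  simpa [G.rev_rev] using isFree_flip (isFree_zero hp (G.rev d))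

/-- Flipping `(d, 0)` gives `(rev d, 1)`, and the next arc on that face is `rot d`. The two points
are the same corner, so no chord separates them. -/
theorem sameRegion_rot (hp : G.IsSimplePerturbation γ p) (d : Fin D) :
    G.SameRegion γ p (d, 0) (G.rot d, 0) := by
  have h1 := sameRegion_flip (isFree_zero hp d)
  rw [sub_zero] at h1
  refine h1.trans (.rel _ _ (.face _ _ (isFree_one hp _) (isFree_zero hp _) ?_ fun j hj => ?_))
  · refine ⟨1, ?_⟩
    simp [faceNext, G.rev_rev]
  · have h2 := hp.lt_one j
    have h3 : G.faceNext (G.rev d) = G.rot d := by simp [faceNext, G.rev_rev]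
    rw [Separates, onArc_corner _ (by simp [chordStart, h2.le]), h3] at hj
    simp at hj

theorem sameRegion_of_tail_eq (hp : G.IsSimplePerturbation γ p) {d d' : Fin D}
    (h : G.tail d = G.tail d') : G.SameRegion γ p (d, 0) (d', 0) := by
  obtain ⟨k, -, rfl⟩ := ((G.rot_sameCycle d d').2 h).exists_pow_eq'
  clear h
  induction k with
  | zero => exact .refl _
  | succ k ih =>
    rw [pow_succ', Equiv.Perm.mul_apply]
    exact ih.trans (sameRegion_rot hp _)

/-- All arcs leaving a vertex start in the same region, so the existential in the definition may be
tested on any one of them. -/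
theorem mem_interiorVertices (hp : G.IsSimplePerturbation γ p) {o d : Fin D} :
    G.tail d ∈ G.interiorVertices γ p o ↔ G.Inside γ p o (d, 0) := by
  constructor
  · rintro ⟨d', h, h'⟩
    exact ((sameRegion_of_tail_eq hp h).inside_iff o).1 h'
  · exact fun h => ⟨d, rfl, h⟩

theorem head_mem_interiorVertices (hp : G.IsSimplePerturbation γ p) {o d : Fin D} :
    G.head d ∈ G.interiorVertices γ p o ↔ G.Inside γ p o (d, 1) := by
  rw [head, mem_interiorVertices hp, (sameRegion_flip (isFree_zero hp (G.rev d))).inside_iff o,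
    G.rev_rev, sub_zero]

/-- The points that immediately follow two consecutive crossings on the crossed arcs, and so lie to
the left of the curve, are in the same region. -/
theorem sameRegion_left (hp : G.IsSimplePerturbation γ p) (hγ : G.IsClosedDualWalk γ)
    {i : Fin γ.length} {t t' : ℝ} (ht : p i < t)
    (hf : ∀ s, p i < s → s ≤ t → G.IsFree γ p (γ.get i, s)) (ht' : p (finRotate _ i) < t')
    (hf' : ∀ s, p (finRotate _ i) < s → s ≤ t' → G.IsFree γ p (γ.get (finRotate _ i), s)) :
    G.SameRegion γ p (γ.get i, t) (γ.get (finRotate _ i), t') := by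
  have hft := hf t ht le_rfl
  have hft' := hf' t' ht' le_rfl
  have h0t : t ≤ 1 := hft.2.1
  have hpi := hp.pos i
  have hpi1 := hp.lt_one i
  have hpr := hp.pos (finRotate _ i)
  refine (sameRegion_flip hft).trans (.rel _ _ (.face _ _ (isFree_flip hft) hft' (hγ.2 i)
    fun j hj => hp.noncrossing j i ?_))
  have h1 := hp.pos j
  have h2 := hp.pos (finRotate _ j)
  have h3 := hp.lt_one (finRotate _ j)
  -- Sliding the two points back to the ends of chord `i` passes no end of chord `j`, so a
  -- separating chord `j` would cross chord `i`. The coincidence of an end with the crossing itself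
  -- is excluded by `ne_of_rev`.
  have e1 : G.OnArc (G.chordStart γ p j) (G.rev (γ.get i), 1 - t) (chordEnd γ p j) ↔
      G.OnArc (G.chordStart γ p j) (G.chordStart γ p i) (chordEnd γ p j) := by
    refine onArc_segment (by simp [chordStart, h1]) h2 h3 (by linarith) (by linarith)
      (by linarith) ?_ ?_
    · intro hd hle
      by_contra hc
      simp only [chordStart, not_le] at hd hle hc
      refine ((hf (p j) (by linarith) (by linarith)).2.2 j).1 ?_
      rw [G.rev.injective hd]
    · intro hd hle
      by_contra hc
      simp only [chordEnd, not_lt] at hd hle hc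
      have hne := hp.ne_of_rev _ _ hd
      refine ((hf (1 - p (finRotate _ j)) ?_ (by linarith)).2.2 (finRotate _ j)).2 ?_
      · refine lt_of_le_of_ne (by linarith) fun h => hne (by linarith)
      · rw [hd, G.rev_rev]
  have e2 : G.OnArc (G.chordStart γ p j) (chordEnd γ p i) (chordEnd γ p j) ↔
      G.OnArc (G.chordStart γ p j) (γ.get (finRotate _ i), t') (chordEnd γ p j) := by
    refine onArc_segment (by simp [chordStart, h1]) h2 h3 hpr.le ht'.le hft'.2.1 ?_ ?_
    · intro hd hle
      by_contra hc
      simp only [chordStart, not_le] at hd hle hc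
      have hne := hp.ne_of_rev _ _ hd.symm
      refine ((hf' (1 - p j) (lt_of_le_of_ne hle hne) hc.le).2.2 j).2 ?_
      rw [hd]
    · intro hd hle
      by_contra hc
      simp only [chordEnd, not_lt] at hd hle hc
      refine ((hf' (p (finRotate _ j)) hle hc).2.2 (finRotate _ j)).1 ?_
      rw [hd]
  rw [Separates] at hj ⊢
  rwa [← e1, e2]

end PlaneGraph

/-! ### The two sides of a clockwise curve and its crossings with an arc. -/

namespace PlaneGraph

variable {n D : ℕ} {G : PlaneGraph n D} {γ : List (Fin D)} {p : Fin γ.length → ℝ}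

/-- There are finitely many crossings, so those beyond `c` keep a distance from it. It is harmless
to avoid the positions `p i` and `1 - p i` of all steps, whatever arc they cross. -/
theorem exists_isFree_right (d : Fin D) {c : ℝ} (hc0 : 0 ≤ c) (hc1 : c < 1) :
    ∃ t, c < t ∧ ∀ s, c < s → s ≤ t → G.IsFree γ p (d, s) := by
  have hlt : ∀ v : ℝ, ∀ᶠ t in nhdsWithin c (Set.Ioi c), v ≤ c ∨ t < v := by
    intro v
    rcases le_or_gt v c with hv | hv
    · exact .of_forall fun _ => .inl hv
    · filter_upwards [Ioo_mem_nhdsGT hv] with t ht using .inr ht.2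
  have h : ∀ᶠ t in nhdsWithin c (Set.Ioi c), (c < t ∧ t < 1) ∧
      ∀ i, (p i ≤ c ∨ t < p i) ∧ (1 - p i ≤ c ∨ t < 1 - p i) := by
    refine .and ?_ (Filter.eventually_all.2 fun i => (hlt _).and (hlt _))
    filter_upwards [Ioo_mem_nhdsGT hc1] with t ht using ht
  obtain ⟨t, ⟨ht, ht1⟩, h⟩ := h.exists
  refine ⟨t, ht, fun s hs hst => ⟨by simp only; linarith, by simp only; linarith, fun i =>
    ⟨fun he => ?_, fun he => ?_⟩⟩⟩ <;> rw [Prod.mk.injEq] at he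
  · rcases (h i).1 with h | h <;> linarith [he.2]
  · rcases (h i).2 with h | h <;> linarith [he.2]

theorem exists_isFree_left (d : Fin D) {c : ℝ} (hc0 : 0 < c) (hc1 : c ≤ 1) :
    ∃ t, t < c ∧ ∀ s, t ≤ s → s < c → G.IsFree γ p (d, s) := by
  obtain ⟨t, ht, h⟩ := exists_isFree_right (G := G) (γ := γ) (p := p) (G.rev d)
    (c := 1 - c) (by linarith) (by linarith)
  refine ⟨1 - t, by linarith, fun s h1 h2 => ?_⟩
  simpa [G.rev_rev] using isFree_flip (h (1 - s) (by linarith) (by linarith))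

/-- The curve crosses the arc `d` at the fraction `c` in its step `i`. -/
def CrossesAt (G : PlaneGraph n D) (γ : List (Fin D)) (p : Fin γ.length → ℝ) (d : Fin D)
    (i : Fin γ.length) (c : ℝ) : Prop :=
  γ.get i = d ∧ p i = c ∨ G.rev (γ.get i) = d ∧ 1 - p i = c

theorem isFree_iff {d : Fin D} {s : ℝ} :
    G.IsFree γ p (d, s) ↔ 0 ≤ s ∧ s ≤ 1 ∧ ∀ i, ¬ G.CrossesAt γ p d i s := by
  simp only [IsFree, CrossesAt, ne_eq, Prod.mk.injEq, not_or, @eq_comm _ d, @eq_comm _ s]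

theorem CrossesAt.mem_Ioo (hp : G.IsSimplePerturbation γ p) {d : Fin D} {i : Fin γ.length} {c : ℝ}
    (h : G.CrossesAt γ p d i c) : 0 < c ∧ c < 1 := by
  have h0 := hp.pos i
  have h1 := hp.lt_one i
  rcases h with ⟨-, rfl⟩ | ⟨-, rfl⟩ <;> constructor <;> linarith

theorem CrossesAt.eq_of_eq (hp : G.IsSimplePerturbation γ p) {d : Fin D} {i j : Fin γ.length}
    {c : ℝ} (h : G.CrossesAt γ p d i c) (h' : G.CrossesAt γ p d j c) : i = j := by
  by_contra hij
  rcases h with ⟨h1, h2⟩ | ⟨h1, h2⟩ <;> rcases h' with ⟨h3, h4⟩ | ⟨h3, h4⟩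
  · exact hp.ne_of_eq i j hij (h1.trans h3.symm) (h2.trans h4.symm)
  · exact hp.ne_of_rev i j (h1.trans h3.symm) (h2.trans h4.symm)
  · exact hp.ne_of_rev j i (h3.trans h1.symm) (h4.trans h2.symm)
  · exact hp.ne_of_eq i j hij (G.rev.injective (h1.trans h3.symm)) (by linarith)

/-- Going back along an arc one meets the tail or a crossing. -/
theorem isFree_or_exists_crossesAt (hp : G.IsSimplePerturbation γ p) {d : Fin D} {s : ℝ} (hs : G.IsFree γ p (d, s)) :
    (∀ t, 0 ≤ t → t ≤ s → G.IsFree γ p (d, t)) ∨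
      ∃ i c, G.CrossesAt γ p d i c ∧ c < s ∧ ∀ t, c < t → t ≤ s → G.IsFree γ p (d, t) := by
  classical
  obtain ⟨h0, h1, hfree⟩ := isFree_iff.1 hs
  -- The only place where step `i` can cross `d`: no step crosses `d` in both directions, by
  -- `rev_ne`. The crossing wanted is the one with the largest such value below `s`.
  let val : Fin γ.length → ℝ := fun i => if γ.get i = d then p i else 1 - p i
  have hval : ∀ i c, G.CrossesAt γ p d i c → val i = c := by
    rintro i c (⟨h, h'⟩ | ⟨h, h'⟩)
    · simp only [val, h, if_true, h']
    · have : γ.get i ≠ d := by rw [← h]; exact (G.rev_ne _).symm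
      simp only [val, this, if_false, h']
  let S := Finset.univ.filter fun i => G.CrossesAt γ p d i (val i) ∧ val i < s
  rcases S.eq_empty_or_nonempty with hS | hS
  · left
    intro t ht hts
    refine isFree_iff.2 ⟨ht, by linarith, fun i hi => ?_⟩
    have hv := hval i t hi
    have hne : t ≠ s := by rintro rfl; exact hfree i hi
    have : i ∈ S := by simpa [S, hv, hi] using lt_of_le_of_ne hts hne
    simp [hS] at this
  · right
    obtain ⟨i, hiS, hmax⟩ := S.exists_max_image val hS
    simp only [S, Finset.mem_filter, Finset.mem_univ, true_and] at hiS hmax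
    refine ⟨i, val i, hiS.1, hiS.2, fun t ht hts => isFree_iff.2 ⟨?_, by linarith, fun j hj => ?_⟩⟩
    · exact ((hiS.1.mem_Ioo hp).1.trans ht).le
    · have hv := hval j t hj
      have hne : t ≠ s := by rintro rfl; exact hfree j hj
      have := hmax j ⟨by rwa [hv], by rw [hv]; exact lt_of_le_of_ne hts hne⟩
      linarith

/-- `IsClockwise` supplies one interior point immediately to the right of the crossing; a segment
without crossings joins it to the given one. -/
theorem inside_of_right (hp : G.IsSimplePerturbation γ p) {o : Fin D}
    (hcw : G.IsClockwise γ p o) {i : Fin γ.length} {t : ℝ} (ht : t < p i)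
    (h : ∀ s, t ≤ s → s < p i → G.IsFree γ p (γ.get i, s)) : G.Inside γ p o (γ.get i, t) := by
  obtain ⟨s, hs, hfree, hin⟩ := hcw i
  rcases le_total s t with hst | hst
  · exact ((sameRegion_segment hp hst fun u hu hu' =>
      hfree u hu (hu'.trans_lt ht)).inside_iff o).1 hin
  · exact ((sameRegion_segment hp hst fun u hu hu' =>
      h u hu (hu'.trans_lt hs)).inside_iff o).2 hin

/-- The points to the left of a clockwise curve are not in its interior. -/
theorem not_inside_of_left (hp : G.IsSimplePerturbation γ p) (hγ : G.IsClosedDualWalk γ)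
    {o : Fin D} (hcw : G.IsClockwise γ p o) {i : Fin γ.length} {t : ℝ} (ht : p i < t)
    (h : ∀ s, p i < s → s ≤ t → G.IsFree γ p (γ.get i, s)) :
    ¬ G.Inside γ p o (γ.get i, t) := by
  intro hin
  -- If one point just left of the curve is interior, this spreads along the left side of the whole
  -- closed curve.
  have left : ∀ j, ∀ t, p j < t → (∀ s, p j < s → s ≤ t → G.IsFree γ p (γ.get j, s)) →
      G.Inside γ p o (γ.get j, t) := by
    refine finRotate_induction (i := i) (fun t' ht' h' => ?_) (fun j ih t' ht' h' => ?_)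
    · rcases le_total t t' with htt | htt
      · exact ((sameRegion_segment hp htt fun u hu hu' =>
          h' u (ht.trans_le hu) hu').inside_iff o).1 hin
      · exact ((sameRegion_segment hp htt fun u hu hu' =>
          h u (ht'.trans_le hu) hu').inside_iff o).2 hin
    · obtain ⟨u, hu, hfu⟩ := exists_isFree_right (G := G) (γ := γ) (p := p) (γ.get j)
        (hp.pos j).le (hp.lt_one j)
      exact ((sameRegion_left hp hγ hu hfu ht' h').inside_iff o).1 (ih u hu hfu)
  -- The part of an arc after its last crossing lies immediately to the left or to the right of the
  -- curve, and by now both sides are interior.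
  have arc : ∀ d, (∀ t, 0 ≤ t → t ≤ 1 → G.IsFree γ p (d, t)) ∨ G.Inside γ p o (d, 1) := by
    intro d
    refine (isFree_or_exists_crossesAt hp (isFree_one hp d)).imp_right ?_
    rintro ⟨j, c, ⟨rfl, rfl⟩ | ⟨rfl, rfl⟩, hc, hfree⟩
    · exact left j 1 hc hfree
    · rw [← head_mem_interiorVertices hp, head, G.rev_rev, mem_interiorVertices hp]
      refine inside_of_right hp hcw (hp.pos j) fun s hs hs' => ?_
      simpa [G.rev_rev] using isFree_flip (hfree (1 - s) (by linarith) (by linarith))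
  have prop : ∀ d, G.tail d ∈ G.interiorVertices γ p o → G.head d ∈ G.interiorVertices γ p o := by
    intro d hd
    rw [mem_interiorVertices hp] at hd
    rw [head_mem_interiorVertices hp]
    rcases arc d with hfree | h1
    · exact ((sameRegion_segment hp zero_le_one hfree).inside_iff o).1 hd
    · exact h1
  have start : G.head (γ.get i) ∈ G.interiorVertices γ p o := by
    rw [head_mem_interiorVertices hp]
    refine (arc (γ.get i)).resolve_left fun hfree => ?_
    exact ((hfree (p i) (hp.pos i).le (hp.lt_one i).le).2.2 i).1 rfl
  -- By connectedness every vertex is interior. This fails for the tail of `o`, which lies in the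
  -- region of infinity.
  have all : ∀ v, v ∈ G.interiorVertices γ p o := by
    intro v
    have hc := G.connected (G.head (γ.get i)) v
    induction hc with
    | refl => exact start
    | tail _ hd ih =>
      obtain ⟨d, rfl, rfl⟩ := hd
      exact prop d ih
  exact (mem_interiorVertices hp).1 (all (G.tail o)) (.refl _)

open Classical in
/-- The signed number of crossings before a point of an arc. -/
theorem sum_crossings_before (hp : G.IsSimplePerturbation γ p) (hγ : G.IsClosedDualWalk γ)
    {o : Fin D} (hcw : G.IsClockwise γ p o) (d : Fin D) {s : ℝ} (hs : G.IsFree γ p (d, s)) :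
    (∑ i, ((if γ.get i = d ∧ p i < s then (1 : ℤ) else 0) -
        (if G.rev (γ.get i) = d ∧ 1 - p i < s then 1 else 0))) =
      (if G.Inside γ p o (d, 0) then 1 else 0) - (if G.Inside γ p o (d, s) then 1 else 0) := by
  -- Induction on the number of crossings before the point: the last one, `i`, is removed by
  -- stepping back to a free point `t` just before it.
  generalize hN : (Finset.univ.filter fun i => ∃ c < s, G.CrossesAt γ p d i c).card = N
  induction N using Nat.strong_induction_on generalizing s with
  | _ N ih =>
    obtain ⟨h0, h1, hfree⟩ := isFree_iff.1 hs
    rcases isFree_or_exists_crossesAt hp hs with hf | ⟨i, c, hi, hcs, hf⟩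
    · rw [(sameRegion_segment hp h0 hf).inside_iff o, sub_self]
      refine Finset.sum_eq_zero fun i _ => ?_
      have h2 := hp.pos i
      have h3 := hp.lt_one i
      rw [if_neg, if_neg, sub_self]
      · rintro ⟨h4, h5⟩
        exact (isFree_iff.1 (hf _ (by linarith) h5.le)).2.2 i (.inr ⟨h4, rfl⟩)
      · rintro ⟨h4, h5⟩
        exact (isFree_iff.1 (hf _ h2.le h5.le)).2.2 i (.inl ⟨h4, rfl⟩)
    · have hc := hi.mem_Ioo hp
      obtain ⟨t, ht, hft⟩ := exists_isFree_left (G := G) (γ := γ) (p := p) d hc.1 hc.2.le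
      have hne : ∀ j ≠ i, ∀ c', G.CrossesAt γ p d j c' → (c' < s ↔ c' < t) := by
        intro j hj c' hc'
        refine ⟨fun h => ?_, fun h => by linarith⟩
        by_contra hle
        rcases lt_trichotomy c' c with hlt | rfl | hlt
        · exact (isFree_iff.1 (hft _ (not_lt.1 hle) hlt)).2.2 j hc'
        · exact hj (hc'.eq_of_eq hp hi)
        · exact (isFree_iff.1 (hf _ hlt h.le)).2.2 j hc'
      have hlt : (Finset.univ.filter fun i => ∃ c < t, G.CrossesAt γ p d i c).card < N := by
        rw [← hN]
        refine Finset.card_lt_card (Finset.ssubset_iff_of_subset ?_ |>.2 ⟨i, ?_, ?_⟩)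
        · intro j
          simp only [Finset.mem_filter, Finset.mem_univ, true_and]
          rintro ⟨c', h, h'⟩
          exact ⟨c', by linarith, h'⟩
        · simp only [Finset.mem_filter, Finset.mem_univ, true_and]
          exact ⟨c, hcs, hi⟩
        · simp only [Finset.mem_filter, Finset.mem_univ, true_and]
          rintro ⟨c', h, h'⟩
          have : c = c' := by
            rcases hi with ⟨h1, h2⟩ | ⟨h1, h2⟩ <;> rcases h' with ⟨h3, h4⟩ | ⟨h3, h4⟩
            · linarith
            · exact absurd (h3.trans h1.symm) (G.rev_ne _)
            · exact absurd (h1.trans h3.symm) (G.rev_ne _)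
            · linarith
          linarith
      have ht' := ih _ hlt (hft t le_rfl ht) rfl
      rw [← Finset.add_sum_erase _ _ (Finset.mem_univ i)] at ht' ⊢
      have hsum : ∀ j ∈ Finset.univ.erase i,
          ((if γ.get j = d ∧ p j < s then (1 : ℤ) else 0) -
            (if G.rev (γ.get j) = d ∧ 1 - p j < s then 1 else 0)) =
          ((if γ.get j = d ∧ p j < t then (1 : ℤ) else 0) -
            (if G.rev (γ.get j) = d ∧ 1 - p j < t then 1 else 0)) := by
        intro j hj
        have hji := Finset.ne_of_mem_erase hj
        have e1 : (γ.get j = d ∧ p j < s) ↔ (γ.get j = d ∧ p j < t) :=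
          and_congr_right fun h => hne j hji _ (.inl ⟨h, rfl⟩)
        have e2 : (G.rev (γ.get j) = d ∧ 1 - p j < s) ↔ (G.rev (γ.get j) = d ∧ 1 - p j < t) :=
          and_congr_right fun h => hne j hji _ (.inr ⟨h, rfl⟩)
        simp only [e1, e2]
      rw [Finset.sum_congr rfl hsum]
      -- A crossing along `d` leads from the inside at `t` to the outside at `s` and contributes
      -- `1`; a crossing along the reversal does the opposite.
      rcases hi with ⟨rfl, rfl⟩ | ⟨rfl, rfl⟩
      · have hin := inside_of_right hp hcw ht hft
        have hout := not_inside_of_left hp hγ hcw hcs hf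
        simp only [hin, hout, G.rev_ne, hcs, not_lt.2 ht.le, if_true, if_false, and_true,
          and_false, false_and] at ht' ⊢
        linarith
      · have hout : ¬ G.Inside γ p o (G.rev (γ.get i), t) := by
          have := not_inside_of_left hp hγ hcw (i := i) (t := 1 - t) (by linarith)
            fun u hu hu' => by
              simpa [G.rev_rev] using isFree_flip (hft (1 - u) (by linarith) (by linarith))
          rwa [(sameRegion_flip (hft t le_rfl ht)).inside_iff, G.rev_rev]
        have hin : G.Inside γ p o (G.rev (γ.get i), s) := by
          have := inside_of_right hp hcw (i := i) (t := 1 - s) (by linarith)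
            fun u hu hu' => by
              simpa [G.rev_rev] using isFree_flip (hf (1 - u) (by linarith) (by linarith))
          rwa [(sameRegion_flip hs).inside_iff, G.rev_rev]
        simp only [hin, hout, (G.rev_ne _).symm, hcs, not_lt.2 ht.le, if_true, if_false, and_true,
          and_false, false_and] at ht' ⊢
        linarith

open Classical in
/-- The signed number of crossings of an arc by a clockwise curve. -/
theorem sum_crossings (hp : G.IsSimplePerturbation γ p) (hγ : G.IsClosedDualWalk γ)
    {o : Fin D} (hcw : G.IsClockwise γ p o) (e : Fin D) :
    (γ.map fun d => (if d = e then (1 : ℤ) else 0) - (if G.rev d = e then 1 else 0)).sum =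
      (if G.tail e ∈ G.interiorVertices γ p o then 1 else 0) -
        (if G.head e ∈ G.interiorVertices γ p o then 1 else 0) := by
  rw [mem_interiorVertices hp, head_mem_interiorVertices hp,
    ← sum_crossings_before hp hγ hcw e (isFree_one hp e), ← Fin.sum_univ_fun_getElem]
  refine Finset.sum_congr rfl fun i _ => ?_
  have h0 := hp.pos i
  have h1 := hp.lt_one i
  have h2 : 1 - p i < 1 := by linarith
  simp [h1, h2]

/-! ### Counting with a spanning tree -/

/-- The lists `path v` of arcs lead from `v` back to `x₀`. -/
def IsTreePath (G : PlaneGraph n D) (x₀ : Fin n) (path : Fin n → List (Fin D)) (v : Fin n) :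
    Prop :=
  path v = [] ∧ v = x₀ ∨ ∃ d, path v = d :: path (G.tail d) ∧ G.head d = v

/-- The arcs of the list point away from the root, so the differences telescope. -/
theorem sum_path (path : Fin n → List (Fin D)) {x₀ : Fin n}
    (hpath : ∀ v, G.IsTreePath x₀ path v) (χ : Fin n → ℤ) (v : Fin n) :
    ((path v).map fun e => χ (G.tail e) - χ (G.head e)).sum = χ x₀ - χ v := by
  generalize hl : path v = l
  induction l generalizing v with
  | nil =>
    rcases hpath v with ⟨-, rfl⟩ | ⟨d, h, -⟩
    · simp
    · simp [hl] at h
  | cons e l ih =>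
    rcases hpath v with ⟨h, -⟩ | ⟨d, h, rfl⟩
    · simp [hl] at h
    · rw [hl, List.cons.injEq] at h
      obtain ⟨rfl, rfl⟩ := h
      rw [List.map_cons, List.sum_cons, ih _ rfl]
      ring

/-- Both sides count, with sign, the pairs of a step of `γ` and an arc of `l` that it crosses. -/
theorem sum_count_comm (l : List (Fin D)) (γ : List (Fin D)) :
    (γ.map fun d => (l.count d : ℤ) - l.count (G.rev d)).sum =
      (l.map fun e => (γ.map fun d => (if d = e then (1 : ℤ) else 0) -
        (if G.rev d = e then 1 else 0)).sum).sum := by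
  induction l with
  | nil => simp
  | cons e l ih =>
    rw [List.map_cons, List.sum_cons, ← ih, ← List.sum_map_add]
    congr 1
    refine List.map_congr_left fun d _ => ?_
    simp only [List.count_cons, beq_iff_eq, @eq_comm _ e]
    push_cast
    ring

open Classical in
/-- The number of vertices of a finite set that are in the interior of a clockwise curve. -/
theorem sum_table (hp : G.IsSimplePerturbation γ p) (hγ : G.IsClosedDualWalk γ)
    {o : Fin D} (hcw : G.IsClockwise γ p o) {x₀ : Fin n} (hx₀ : x₀ ∈ G.interiorVertices γ p o)
    (path : Fin n → List (Fin D)) (hpath : ∀ v, G.IsTreePath x₀ path v) (U : Finset (Fin n)) :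
    (γ.map fun d => ∑ v ∈ U, (((path v).count d : ℤ) - (path v).count (G.rev d))).sum =
      U.card - (U.filter fun v => v ∈ G.interiorVertices γ p o).card := by
  rw [← Fin.sum_univ_fun_getElem, Finset.sum_comm]
  -- The signed crossings with the tree path of `v`: the term `1` is the indicator of `x₀`, which is
  -- interior.
  have key : ∀ v ∈ U, ∑ i : Fin γ.length,
      (((path v).count γ[i.val] : ℤ) - (path v).count (G.rev γ[i.val])) =
      1 - (if v ∈ G.interiorVertices γ p o then 1 else 0) := by
    intro v _
    have h1 := sum_count_comm (G := G) (path v) γ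
    simp only [sum_crossings hp hγ hcw] at h1
    rw [sum_path path hpath (fun v => if v ∈ G.interiorVertices γ p o then 1 else 0), if_pos hx₀,
      ← Fin.sum_univ_fun_getElem] at h1
    exact h1
  rw [Finset.sum_congr rfl key]
  simp

/-! ### Simple plane graphs have linearly many arcs -/

/-- If every face has at least three arcs on its boundary, then three times the number of faces is
at most `D`, and Euler's formula gives the bound. A shorter face forces the graph to be a single
edge. -/
theorem card_arcs_le (hG : G.Simple) : D ≤ 6 * n := by
  classical
  by_cases h2 : ∃ d, G.faceNext (G.faceNext d) = d
  · obtain ⟨d, hd⟩ := h2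
    have htail : ∀ e, G.tail (G.rot e) = G.tail e := fun e =>
      ((G.rot_sameCycle e (G.rot e)).1 ⟨1, by simp⟩).symm
    -- A face of length at most two: `faceNext d` and `rev d` have the same ends, hence agree
    -- without parallel edges. Both ends of `d` then have degree one.
    have e1 : G.faceNext d = G.rev d := by
      refine hG.2 _ _ (by simp [faceNext, htail]) ?_
      have := congrArg G.tail hd
      rw [faceNext, Equiv.trans_apply, htail] at this
      rw [head, faceNext, this, head, G.rev_rev]
    have e2 : G.rot d = d := by
      rw [e1] at hd
      simpa [faceNext, G.rev_rev] using hd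
    have e3 : G.rot (G.rev d) = G.rev d := e1
    have fix : ∀ a b, G.rot a = a → G.tail b = G.tail a → b = a := by
      intro a b ha hb
      obtain ⟨k, -, rfl⟩ := ((G.rot_sameCycle a b).2 hb.symm).exists_pow_eq'
      exact Equiv.Perm.pow_apply_eq_self_of_apply_eq_self ha k
    have hv : ∀ v, v = G.tail d ∨ v = G.head d := by
      intro v
      induction G.connected (G.tail d) v with
      | refl => exact .inl rfl
      | tail _ hb ih =>
        obtain ⟨b, rfl, rfl⟩ := hb
        rcases ih with h | h
        · rw [fix d b e2 h]; exact .inr rfl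
        · rw [fix _ b e3 h, G.rev_rev]; exact .inl rfl
    have hD : (Finset.univ : Finset (Fin D)) ⊆ {d, G.rev d} := by
      intro b _
      rcases hv (G.tail b) with h | h
      · simp [fix d b e2 h]
      · simp [fix _ b e3 h]
    have h3 := (Finset.card_le_card hD).trans Finset.card_le_two
    have h4 := (G.tail d).pos
    simp at h3
    omega
  -- Excluding faces of length two through `faceNext (faceNext d) = d` also excludes those of length
  -- one.
  · push Not at h2
    have h1 : ∀ d, G.faceNext d ≠ d := fun d h => h2 d (by rw [h, h])
    let π : Fin D → Quotient (Equiv.Perm.SameCycle.setoid (G.rev.trans G.rot)) :=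
      fun d => Quotient.mk _ d
    have hsucc : ∀ d, π (G.faceNext d) = π d := fun d =>
      Quotient.sound (s := Equiv.Perm.SameCycle.setoid (G.rev.trans G.rot))
        (Equiv.Perm.SameCycle.symm ⟨1, by simp [faceNext]⟩)
    have hfib : ∀ q ∈ (Finset.univ : Finset (Quotient (Equiv.Perm.SameCycle.setoid
        (G.rev.trans G.rot)))), 3 ≤ (Finset.univ.filter fun d => π d = q).card := by
      intro q _
      obtain ⟨d, rfl⟩ := Quotient.exists_rep q
      have hsub : ({d, G.faceNext d, G.faceNext (G.faceNext d)} : Finset (Fin D)) ⊆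
          Finset.univ.filter fun e => π e = π d := by
        intro e he
        simp only [Finset.mem_insert, Finset.mem_singleton] at he
        rcases he with rfl | rfl | rfl <;> simp [hsucc]
      refine le_trans (le_of_eq ?_) (Finset.card_le_card hsub)
      rw [Finset.card_eq_three.2 ⟨_, _, _, (h1 d).symm, (h2 d).symm, (h1 _).symm, rfl⟩]
    have hcard := Finset.card_nsmul_le_sum _ _ 3 hfib
    rw [← Finset.card_eq_sum_card_fiberwise (fun _ _ => Finset.mem_univ _)] at hcard
    have he := G.euler
    rw [Nat.card_eq_fintype_card] at he
    simp only [Finset.card_univ, smul_eq_mul, Fintype.card_fin] at hcard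
    omega

end PlaneGraph

-- Reading the input, word bounds and offsets of walks.

attribute [simp] WExp.eval WExp.Ok WExp.cost Cond.Ok Cond.holds Cond.cost AState.setVar
  AState.setArr AState.setReal AState.tick Cmd.vars Cmd.arrs Cmd.rarrs

@[simp] theorem WExp.cost_addr (a : Fin 8) (e : WExp) : (WExp.addr a e).cost = e.cost + 4 := rfl

@[simp] theorem Cmd.vars_forTo (x y : ℕ) (c : Cmd) :
    (Cmd.forTo x y c).vars = x :: (c.vars ++ [x]) := rfl

@[simp] theorem Cmd.arrs_forTo (x y : ℕ) (c : Cmd) :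
    (Cmd.forTo x y c).arrs = c.arrs ++ [] := rfl

@[simp] theorem Cmd.rarrs_forTo (x y : ℕ) (c : Cmd) :
    (Cmd.forTo x y c).rarrs = c.rarrs ++ [] := rfl

/-- What the preprocessing program reads. -/
structure ReadsGraph {n D : ℕ} (G : PlaneGraph n D) (walks : List (List (Fin D))) (ω : Fin n → ℝ)
    (inp : MachineInput) : Prop where
  tail : ∀ d : Fin D, inp.word (4 + (d.val : ℤ)) = (G.tail d).val
  rev : ∀ d : Fin D, inp.word (4 + (D : ℤ) + (d.val : ℤ)) = (G.rev d).val
  length : ∀ i < walks.length,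
    inp.word (4 + 3 * (D : ℤ) + (i : ℤ)) = ((walks.getD i []).length : ℤ)
  arc : ∀ j (h : j < walks.flatten.length),
    inp.word (4 + 3 * (D : ℤ) + (walks.length : ℤ) + (j : ℤ)) = (walks.flatten[j].val : ℤ)
  weight : ∀ v : Fin n, inp.real (v.val : ℤ) = ω v

/-- Bounds for the words that occur: `W` bounds the numbers, and `B` has room for addresses. -/
structure WordBounds (n D l m W B : ℕ) : Prop where
  one_le : 1 ≤ W
  n_le : n ≤ W
  D_le : D ≤ W
  l_le : l ≤ m
  m_le : m ≤ W
  -- The number of cells of the table; the next field bounds its entries, sums of at most `m` terms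
  -- of size at most `n * n`.
  cells : (n + 1) * (m + 1) ≤ 4 * W
  counts : (m + 1) * (n * n) ≤ 2 * W
  le_B : 1000 * W ≤ B

/-- The position of a walk in the concatenation of all walks. -/
def walkOffset {α : Type*} (walks : List (List α)) (i : ℕ) : ℕ :=
  ((walks.take i).map List.length).sum

theorem walkOffset_succ {α : Type*} (walks : List (List α)) {i : ℕ} (hi : i < walks.length) :
    walkOffset walks (i + 1) = walkOffset walks i + (walks.getD i []).length := by
  rw [walkOffset, walkOffset, List.take_add_one, List.map_append, List.sum_append,
    List.getElem?_eq_getElem hi, List.getD_eq_getElem _ _ hi]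
  simp only [Option.toList_some, List.map_cons, List.map_nil, List.sum_cons, List.sum_nil,
    add_zero]

theorem walkOffset_length {α : Type*} (walks : List (List α)) :
    walkOffset walks walks.length = walks.flatten.length := by
  simp [walkOffset, List.length_flatten]

theorem walkOffset_le {α : Type*} (walks : List (List α)) (i : ℕ) :
    walkOffset walks i ≤ walks.flatten.length := by
  rw [walkOffset, List.length_flatten]
  conv_rhs => rw [← List.take_append_drop i walks]
  simp only [List.map_append, List.sum_append]
  omega

/-- Nonempty walks are needed here: the time and word bounds involve `m`, but the number of walks
must be covered as well. -/
theorem length_le_length_flatten {α : Type*} {walks : List (List α)} (h : ∀ π ∈ walks, π ≠ []) :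
    walks.length ≤ walks.flatten.length := by
  induction walks with
  | nil => simp
  | cons π walks ih =>
    have h1 := List.length_pos_iff.2 (h π (by simp))
    have h2 := ih fun π' h' => h π' (by simp [h'])
    simp only [List.length_cons, List.flatten_cons, List.length_append]
    omega

/-! ### Preprocessing: offsets of the walks in their concatenation. -/

namespace Preprocessing

open WExp Cmd

/-- `var 5` becomes the total length `m` of the walks, array `4` the offsets of the walks. -/
def offsets : Cmd :=
  assign 5 (const 0) ;;
  forTo 6 3 (
    store 4 (var 6) (var 5) ;;
    assign 5 (add (var 5) (input (add (add (const 4) (mul (const 3) (var 2))) (var 6)))))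

section

variable {n D : ℕ} {G : PlaneGraph n D} {walks : List (List (Fin D))} {ω : Fin n → ℝ}
  {inp : MachineInput} {m W B : ℕ}

theorem wp_offsets (hinp : ReadsGraph G walks ω inp) (hB : WordBounds n D walks.length m W B)
    (hm : m = walks.flatten.length) {s : AState} (h2 : s.var 2 = D) (h3 : s.var 3 = walks.length) :
    offsets.wp B inp (fun s' => s'.time ≤ s.time + 50 * (m + 1) ∧
      s'.var 5 = m ∧ ∀ i < walks.length, s'.arr 4 (i : ℤ) = walkOffset walks i) s := by
  have ⟨b1, b2, b3, b4, b5, b6, b7, b8⟩ := hB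
  rw [offsets, wp_seq, wp_assign]
  refine ⟨by simp, ?_⟩
  refine wp_forTo walks.length 27 (fun k v a _ => v 5 = walkOffset walks k ∧
    ∀ i < k, a 4 (i : ℤ) = walkOffset walks i) (by simp) (by simp) (by simp)
    (by simpa using h3) (by omega) (by simp [walkOffset]) ?_ ?_
  · rintro k hk s' h6 ha ⟨h5, hoff⟩
    have h2' : s'.var 2 = D := by rw [ha.var 2 (by simp)]; simpa using h2
    have hle := walkOffset_le walks k
    have hle' := walkOffset_le walks (k + 1)
    have hs := walkOffset_succ walks hk
    have hl := hinp.length k hk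
    simp only [wp_seq, wp_store, wp_assign]
    refine ⟨addr_ok (by simp) (by simp [h6]; omega), by simp, ?_, ?_, ?_, ?_⟩
    · simp [abs_le, h5, h6, h2', hl, -List.getD_eq_getElem?_getD]
      omega
    · simp
    · simp [h5, h6, h2', hl, hs, -List.getD_eq_getElem?_getD]
    · intro i hi
      by_cases hik : i = k
      · simp [hik, h5, h6]
      · simpa [hik, h6] using hoff i (by omega)
  · rintro s' h6 ha ht ⟨h5, hoff⟩
    refine ⟨?_, ?_, hoff⟩
    · simp at ht; omega
    · rw [h5, walkOffset_length, hm]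

end

end Preprocessing

/-! ### Sorting by ranks -/

section Rank

variable {n : ℕ} (ω : Fin n → ℝ)

/-- The order by weight, ties being broken by the number of the vertex. -/
def Before (u v : Fin n) : Prop := ω u ≤ ω v ∧ (ω v ≤ ω u → u < v)

open Classical in
/-- The number of vertices with number less than `k` before `v`. -/
noncomputable def rankBelow (v : Fin n) (k : ℕ) : ℕ :=
  (Finset.univ.filter fun u : Fin n => u.val < k ∧ Before ω u v).card

open Classical in
theorem rankBelow_succ (v u : Fin n) :
    rankBelow ω v (u.val + 1) = rankBelow ω v u.val + if Before ω u v then 1 else 0 := by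
  have h : (Finset.univ.filter fun w : Fin n => w.val < u.val + 1 ∧ Before ω w v) =
      (Finset.univ.filter fun w : Fin n => w.val < u.val ∧ Before ω w v) ∪
        (if Before ω u v then {u} else ∅) := by
    ext w
    split_ifs with hu
    · simp only [Finset.mem_filter, Finset.mem_univ, true_and, Finset.mem_union,
        Finset.mem_singleton, Fin.ext_iff]
      constructor
      · rintro ⟨h1, h2⟩
        by_cases hw : w.val = u.val
        · exact .inr hw
        · exact .inl ⟨by omega, h2⟩
      · rintro (⟨h1, h2⟩ | h1)
        · exact ⟨by omega, h2⟩
        · obtain rfl : w = u := Fin.ext h1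
          exact ⟨by omega, hu⟩
    · simp only [Finset.mem_filter, Finset.mem_univ, true_and, Finset.union_empty]
      refine and_congr_left fun hw => ⟨fun h1 => ?_, fun h1 => by omega⟩
      have : w ≠ u := by rintro rfl; exact hu hw
      have : w.val ≠ u.val := fun h => this (Fin.ext h)
      omega
  rw [rankBelow, h, Finset.card_union_of_disjoint]
  · split_ifs <;> simp [rankBelow]
  · split_ifs <;> simp

open Classical in
theorem rankBelow_le (v : Fin n) (k : ℕ) : rankBelow ω v k ≤ n := by
  have := Finset.card_le_univ (Finset.univ.filter fun u : Fin n => u.val < k ∧ Before ω u v)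
  simpa [rankBelow] using this

theorem rankBelow_zero (v : Fin n) : rankBelow ω v 0 = 0 := by simp [rankBelow]

theorem before_trans {u v w : Fin n} (h : Before ω u v) (h' : Before ω v w) : Before ω u w := by
  refine ⟨h.1.trans h'.1, fun hw => ?_⟩
  exact (h.2 (h'.1.trans hw)).trans (h'.2 (hw.trans h.1))

theorem rankBelow_lt {u v : Fin n} (h : Before ω u v) : rankBelow ω u n < rankBelow ω v n := by
  refine Finset.card_lt_card (Finset.ssubset_iff_of_subset ?_ |>.2 ⟨u, ?_, ?_⟩)
  · intro w
    simp only [Finset.mem_filter, Finset.mem_univ, true_and]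
    exact fun hw => ⟨hw.1, before_trans ω hw.2 h⟩
  · simp [h]
  · simp [Before]

theorem before_or_before {u v : Fin n} (h : u ≠ v) : Before ω u v ∨ Before ω v u := by
  have h1 : u < v ∨ v < u := lt_or_gt_of_ne h
  rcases lt_trichotomy (ω u) (ω v) with h2 | h2 | h2
  · exact .inl ⟨h2.le, fun h3 => absurd h3 (not_le.2 h2)⟩
  · exact h1.imp (fun h3 => ⟨h2.le, fun _ => h3⟩) fun h3 => ⟨h2.ge, fun _ => h3⟩
  · exact .inr ⟨h2.le, fun h3 => absurd h3 (not_le.2 h2)⟩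

/-- Breaking ties makes `Before` a strict total order. So ranks are distinct, and they are less than
`n` because no vertex is before itself. -/
theorem exists_rank : ∃ ρ : Equiv.Perm (Fin n), (∀ v, (ρ v).val = rankBelow ω v n) ∧
    ∀ u v, ρ u ≤ ρ v → ω u ≤ ω v := by
  classical
  have hlt : ∀ v, rankBelow ω v n < n := by
    intro v
    have : (Finset.univ.filter fun u : Fin n => u.val < n ∧ Before ω u v).card <
        (Finset.univ : Finset (Fin n)).card := by
      refine Finset.card_lt_card (Finset.ssubset_iff_of_subset (Finset.subset_univ _) |>.2
        ⟨v, Finset.mem_univ _, by simp [Before]⟩)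
    simpa [rankBelow] using this
  have hinj : Function.Injective fun v : Fin n => (⟨rankBelow ω v n, hlt v⟩ : Fin n) := by
    intro u v huv
    simp only [Fin.mk.injEq] at huv
    by_contra hne
    rcases before_or_before ω hne with h | h
    · exact (rankBelow_lt ω h).ne huv
    · exact (rankBelow_lt ω h).ne' huv
  refine ⟨Equiv.ofBijective _ (Finite.injective_iff_bijective.1 hinj), fun v => rfl, ?_⟩
  intro u v huv
  by_cases h : u = v
  · rw [h]
  · rcases before_or_before ω h with h | h
    · exact h.1
    · exact absurd huv (not_le.2 (rankBelow_lt ω h))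

end Rank

/-! ### Preprocessing: sorting the vertices by weight. -/

namespace Preprocessing

open WExp Cmd

/-- The real array `0` becomes the array of the weights. -/
def weights : Cmd := forTo 6 1 (realRead 0 (var 6) (var 6))

/-- `var 8` becomes the rank of the vertex `var 6`. -/
def rank : Cmd :=
  assign 8 (const 0) ;;
  forTo 7 1 (ite (.rle 0 (var 7) 0 (var 6))
    (ite (.rle 0 (var 6) 0 (var 7))
      (ite (.le (add (var 7) (const 1)) (var 6)) (assign 8 (add (var 8) (const 1))) skip)
      (assign 8 (add (var 8) (const 1)))) skip)

/-- Array `3` becomes the list of the vertices sorted by weight, and the real array `1` the sorted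
list of the weights. -/
def sort : Cmd := forTo 6 1 (rank ;; store 3 (var 8) (var 6) ;; realCopy 1 (var 8) 0 (var 6))

section

variable {n D : ℕ} {G : PlaneGraph n D} {walks : List (List (Fin D))} {ω : Fin n → ℝ}
  {inp : MachineInput} {l m W B : ℕ}

theorem wp_weights (hinp : ReadsGraph G walks ω inp) (hB : WordBounds n D l m W B)
    {s : AState} (h1 : s.var 1 = n) :
    weights.wp B inp (fun s' => s'.time ≤ s.time + 50 * (n + 1) ∧
      ∀ v : Fin n, s'.rarr 0 (v.val : ℤ) = ω v) s := by
  have ⟨b1, b2, b3, b4, b5, b6, b7, b8⟩ := hB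
  refine wp_forTo n 20 (fun k _ _ r => ∀ v : Fin n, v.val < k → r 0 (v.val : ℤ) = ω v) (by simp)
    (by simp) (by simp) h1 (by omega) (by simp) ?_ ?_
  · intro k hk s' h6 ha hr
    refine ⟨addr_ok (by simp) (by simp [h6]; omega), by simp, by simp, ?_⟩
    intro v hv
    by_cases hvk : v.val = k
    · simp [h6, hvk, ← hinp.weight]
    · simpa [h6, hvk] using hr v (by omega)
  · intro s' h6 ha ht hr
    exact ⟨by omega, fun v => hr v v.isLt⟩

theorem wp_rank (hB : WordBounds n D l m W B) {s : AState} (h1 : s.var 1 = n) (v : Fin n)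
    (h6 : s.var 6 = (v.val : ℤ)) (hw : ∀ v : Fin n, s.rarr 0 (v.val : ℤ) = ω v) :
    rank.wp B inp (fun s' => s'.time ≤ s.time + 100 * (n + 1) ∧
      s'.var 8 = (rankBelow ω v n : ℤ)) s := by
  have ⟨b1, b2, b3, b4, b5, b6, b7, b8⟩ := hB
  have hvn := v.isLt
  rw [rank, wp_seq, wp_assign]
  refine ⟨by simp, ?_⟩
  refine wp_forTo n 70 (fun k va _ _ => va 8 = (rankBelow ω v k : ℤ)) (by simp) (by simp) (by simp)
    (by simpa using h1) (by omega) (by simp [rankBelow_zero]) ?_ ?_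
  · intro k hk s' h7 ha h8
    have h6' : s'.var 6 = v.val := by rw [ha.var 6 (by simp)]; simpa using h6
    have hw' : ∀ v : Fin n, s'.rarr 0 (v.val : ℤ) = ω v := fun v => by
      rw [ha.rarr 0 (by simp)]; simpa using hw v
    have hk' := hw' ⟨k, hk⟩
    have hs := rankBelow_succ ω v ⟨k, hk⟩
    have hle := rankBelow_le ω v k
    have hbef : Before ω ⟨k, hk⟩ v ↔ ω ⟨k, hk⟩ ≤ ω v ∧ (ω v ≤ ω ⟨k, hk⟩ → k < v.val) := Iff.rfl
    simp only at hk' hs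
    have ok1 : |(k : ℤ) + 1| ≤ B := by grind
    have ok2 : |(rankBelow ω v k : ℤ) + 1| ≤ B := by grind
    have ok3 : (1 : ℕ) ≤ B := by omega
    simp only [wp_ite, wp_assign, wp_skip]
    refine ⟨⟨addr_ok (by simp) (by simp [h7]; omega), addr_ok (by simp) (by simp [h6']; omega)⟩,
      fun hc1 => ⟨⟨addr_ok (by simp) (by simp [h6']; omega), addr_ok (by simp)
        (by simp [h7]; omega)⟩, fun hc2 => ⟨by simp [h7, ok1, ok3], fun hc3 =>
        ⟨by simp [h8, ok2, ok3], by simp, ?_⟩, fun hc3 => ⟨by simp, ?_⟩⟩,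
        fun hc2 => ⟨by simp [h8, ok2, ok3], by simp, ?_⟩⟩, fun hc1 => ⟨by simp, ?_⟩⟩
    all_goals simp [h6', h7, hw', hk'] at hc1
    · simp [h6', h7, hw', hk'] at hc2 hc3
      rw [if_pos (hbef.2 ⟨hc1, fun _ => by omega⟩)] at hs
      simp [h8, hs]
    · simp [h6', h7, hw', hk'] at hc2 hc3
      rw [if_neg (fun h => by have := (hbef.1 h).2 hc2; omega)] at hs
      simp [h8, hs]
    · simp [h6', h7, hw', hk'] at hc2
      rw [if_pos (hbef.2 ⟨hc1, fun h => absurd h (not_le.2 hc2)⟩)] at hs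
      simp [h8, hs]
    · rw [if_neg (fun h => absurd (hbef.1 h).1 (not_le.2 hc1))] at hs
      simp [h8, hs]
  · intro s' h7 ha ht h8
    refine ⟨?_, h8⟩
    simp at ht
    omega

/-- Each vertex is written to the cell given by its rank. Ranks form a permutation, so nothing is
overwritten. -/
theorem wp_sort (hB : WordBounds n D l m W B) {s : AState} (h1 : s.var 1 = n)
    (hw : ∀ v : Fin n, s.rarr 0 (v.val : ℤ) = ω v) (ρ : Equiv.Perm (Fin n))
    (hρ : ∀ v, (ρ v).val = rankBelow ω v n) :
    sort.wp B inp (fun s' => s'.time ≤ s.time + 200 * (n * (n + 1)) + 11 ∧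
      (∀ v : Fin n, s'.arr 3 ((ρ v).val : ℤ) = (v.val : ℤ)) ∧
      ∀ v : Fin n, s'.rarr 1 ((ρ v).val : ℤ) = ω v) s := by
  have ⟨b1, b2, b3, b4, b5, b6, b7, b8⟩ := hB
  refine wp_forTo n (100 * (n + 1) + 40) (fun k _ a r => ∀ v : Fin n, v.val < k →
    a 3 ((ρ v).val : ℤ) = (v.val : ℤ) ∧ r 1 ((ρ v).val : ℤ) = ω v) (by simp [rank])
    (by simp [rank]) (by simp) h1 (by omega) (by simp) ?_ ?_
  · intro k hk s' h6 ha hr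
    have h1' : s'.var 1 = n := by rw [ha.var 1 (by simp [rank]), h1]
    have hw' : ∀ v : Fin n, s'.rarr 0 (v.val : ℤ) = ω v := fun v => by
      rw [ha.rarr 0 (by simp [rank]), hw]
    rw [wp_seq]
    refine wp_call (wp_rank hB h1' ⟨k, hk⟩ h6 hw') ?_
    rintro s2 ha2 ⟨ht2, h8⟩
    rw [← hρ] at h8
    have hlt := (ρ ⟨k, hk⟩).isLt
    have h62 : s2.var 6 = k := by rw [ha2.var 6 (by simp [rank]), h6]
    have hw2 : s2.rarr 0 (k : ℤ) = ω ⟨k, hk⟩ := by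
      rw [ha2.rarr 0 (by simp [rank])]; exact hw' ⟨k, hk⟩
    simp only [wp_seq, wp_store, wp_realCopy]
    refine ⟨addr_ok (by simp) (by simp [h8]; omega), by simp, addr_ok (by simp)
      (by simp [h8]; omega), addr_ok (by simp) (by simp [h62]; omega), by simp; omega, ?_⟩
    intro v hv
    by_cases hvk : v.val = k
    · obtain rfl : v = ⟨k, hk⟩ := Fin.ext hvk
      simp [h62, h8, hw2]
    · have hne : (ρ v).val ≠ (ρ ⟨k, hk⟩).val := fun h =>
        hvk (congrArg Fin.val (ρ.injective (Fin.ext h)))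
      have := hr v (by omega)
      rw [← ha2.arr 3 (by simp [rank]), ← ha2.rarr 1 (by simp [rank])] at this
      simpa [h62, h8, hne] using this
  · intro s' h6 ha ht hr
    exact ⟨by nlinarith, fun v => (hr v v.isLt).1, fun v => (hr v v.isLt).2⟩

end

end Preprocessing

/-! ### A spanning tree -/

namespace Preprocessing

open WExp Cmd

/-- `var 9` becomes an arc from a vertex of the tree to another vertex, or `-1`. -/
def findArc : Cmd :=
  assign 9 (const (-1)) ;;
  forTo 7 2 (
    assign 8 (input (add (const 4) (input (add (add (const 4) (var 2)) (var 7))))) ;;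
    ite (.le (const 1) (arr 1 (input (add (const 4) (var 7)))))
      (ite (.le (arr 1 (var 8)) (const 0)) (assign 9 (var 7)) skip) skip)

/-- Array `1` becomes the array of the tree arcs entering the vertices, increased by `2`; its
entry for the root is `1`. -/
def tree : Cmd :=
  store 1 (var 4) (const 1) ;;
  forTo 6 1 (
    findArc ;;
    ite (.le (const 0) (var 9))
      (store 1 (input (add (const 4) (input (add (add (const 4) (var 2)) (var 9)))))
        (add (var 9) (const 2))) skip)

/-- The array `a` holds the tree arc that enters `v`. -/
def TreeEntry {n D : ℕ} (G : PlaneGraph n D) (x₀ : Fin n) (path : Fin n → List (Fin D))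
    (a : ℤ → ℤ) (v : Fin n) : Prop :=
  path v = [] ∧ v = x₀ ∧ a (v.val : ℤ) = 1 ∨
    ∃ d, path v = d :: path (G.tail d) ∧ G.head d = v ∧ a (v.val : ℤ) = (d.val : ℤ) + 2

/-- The array `a` holds a tree with vertex set `M`. -/
structure IsTreeOn {n D : ℕ} (G : PlaneGraph n D) (x₀ : Fin n) (path : Fin n → List (Fin D))
    (a : ℤ → ℤ) (M : Finset (Fin n)) (r : ℕ) : Prop where
  root : x₀ ∈ M
  not_mem : ∀ v ∉ M, a (v.val : ℤ) = 0
  entry : ∀ v ∈ M, TreeEntry G x₀ path a v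
  closed : ∀ v ∈ M, ∀ d l, path v = d :: l → G.tail d ∈ M
  length : ∀ v ∈ M, (path v).length ≤ r
  -- Every round adds a vertex unless the tree already spans; after `n` rounds the first alternative
  -- is impossible.
  card : r + 1 ≤ M.card ∨ M = Finset.univ

section

variable {n D : ℕ} {G : PlaneGraph n D} {walks : List (List (Fin D))} {ω : Fin n → ℝ}
  {inp : MachineInput} {l m W B r : ℕ} {x₀ : Fin n} {path : Fin n → List (Fin D)} {a : ℤ → ℤ}
  {M : Finset (Fin n)}

/-- The shift by two keeps entries apart: `0` is untouched memory, `1` the root, and larger values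
are arcs. -/
theorem IsTreeOn.mem_iff (h : IsTreeOn G x₀ path a M r) (v : Fin n) :
    1 ≤ a (v.val : ℤ) ↔ v ∈ M := by
  constructor
  · intro hv
    by_contra hM
    rw [h.not_mem v hM] at hv
    omega
  · intro hv
    rcases h.entry v hv with ⟨-, -, h⟩ | ⟨d, -, -, h⟩ <;> omega

theorem IsTreeOn.succ_of_eq_univ (h : IsTreeOn G x₀ path a Finset.univ r) :
    IsTreeOn G x₀ path a Finset.univ (r + 1) :=
  ⟨h.root, h.not_mem, h.entry, h.closed, fun v hv => (h.length v hv).trans (Nat.le_succ r),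
    .inr rfl⟩

theorem IsTreeOn.eq_univ (h : IsTreeOn G x₀ path a M r)
    (hM : ∀ d, G.tail d ∈ M → G.head d ∈ M) : M = Finset.univ := by
  ext v
  simp only [Finset.mem_univ, iff_true]
  induction G.connected x₀ v with
  | refl => exact h.root
  | tail _ hb ih =>
    obtain ⟨b, rfl, rfl⟩ := hb
    exact hM b ih

/-- The tails of tree arcs stay in `M`, so the paths of old vertices do not refer to the path
changed at the new vertex. -/
theorem IsTreeOn.insert (h : IsTreeOn G x₀ path a M r) {d : Fin D} (hd : G.tail d ∈ M)
    (hd' : G.head d ∉ M) :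
    IsTreeOn G x₀ (Function.update path (G.head d) (d :: path (G.tail d)))
      (Function.update a ((G.head d).val : ℤ) ((d.val : ℤ) + 2)) (insert (G.head d) M) (r + 1) := by
  have hne : ∀ v ∈ M, v ≠ G.head d := by
    rintro v hv rfl
    exact hd' hv
  have hval : ∀ v, v ≠ G.head d → (v.val : ℤ) ≠ ((G.head d).val : ℤ) := fun v hv h =>
    hv (Fin.ext (by exact_mod_cast h))
  refine ⟨Finset.mem_insert_of_mem h.root, ?_, ?_, ?_, ?_, ?_⟩
  · intro v hv
    rw [Finset.mem_insert, not_or] at hv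
    rw [Function.update_of_ne (hval v hv.1), h.not_mem v hv.2]
  · intro v hv
    rw [Finset.mem_insert] at hv
    rcases hv with rfl | hv
    · exact .inr ⟨d, by simp [hne _ hd], rfl, by simp⟩
    · have hv' := hne v hv
      rcases h.entry v hv with ⟨h1, h2, h3⟩ | ⟨e, h1, h2, h3⟩
      · exact .inl ⟨by simp [hv', h1], h2, by rw [Function.update_of_ne (hval v hv'), h3]⟩
      · refine .inr ⟨e, ?_, h2, by rw [Function.update_of_ne (hval v hv'), h3]⟩
        rw [Function.update_of_ne hv', Function.update_of_ne (hne _ (h.closed v hv e _ h1)), h1]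
  · intro v hv e l hl
    rw [Finset.mem_insert] at hv
    rcases hv with rfl | hv
    · rw [Function.update_self, List.cons.injEq] at hl
      rw [← hl.1]
      exact Finset.mem_insert_of_mem hd
    · rw [Function.update_of_ne (hne v hv)] at hl
      exact Finset.mem_insert_of_mem (h.closed v hv e l hl)
  · intro v hv
    rw [Finset.mem_insert] at hv
    rcases hv with rfl | hv
    · simpa using h.length _ hd
    · rw [Function.update_of_ne (hne v hv)]
      exact (h.length v hv).trans (Nat.le_succ r)
  · rcases h.card with h | h
    · left
      rw [Finset.card_insert_of_notMem hd']
      omega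
    · simp [h] at hd'

theorem wp_findArc (hinp : ReadsGraph G walks ω inp) (hB : WordBounds n D l m W B)
    {s : AState} (h2 : s.var 2 = D) (htree : IsTreeOn G x₀ path (s.arr 1) M r) :
    findArc.wp B inp (fun s' => s'.time ≤ s.time + 100 * (D + 1) ∧
      ((s'.var 9 = -1 ∧ ∀ d, G.tail d ∈ M → G.head d ∈ M) ∨
        ∃ d : Fin D, s'.var 9 = (d.val : ℤ) ∧ G.tail d ∈ M ∧ G.head d ∉ M)) s := by
  have ⟨b1, b2, b3, b4, b5, b6, b7, b8⟩ := hB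
  have one_le : 1 ≤ B := by omega
  rw [findArc, wp_seq, wp_assign]
  refine ⟨by simpa using one_le, ?_⟩
  refine wp_forTo D 70 (fun k v _ _ => (v 9 = -1 ∧ ∀ d : Fin D, d.val < k → G.tail d ∈ M →
    G.head d ∈ M) ∨ ∃ d : Fin D, v 9 = (d.val : ℤ) ∧ G.tail d ∈ M ∧ G.head d ∉ M)
    (by simp) (by simp) (by simp) (by simpa using h2) (by omega) (by simp) ?_ ?_
  · intro k hk s' h7 ha hI
    have h2' : s'.var 2 = D := by rw [ha.var 2 (by simp)]; simpa using h2
    have h1' : s'.arr 1 = s.arr 1 := by rw [ha.arr 1 (by simp)]; rfl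
    have hrev : inp.word (4 + (D : ℤ) + (k : ℤ)) = (G.rev ⟨k, hk⟩).val := hinp.rev ⟨k, hk⟩
    have htail : inp.word (4 + (k : ℤ)) = (G.tail ⟨k, hk⟩).val := hinp.tail ⟨k, hk⟩
    have hhead := hinp.tail (G.rev ⟨k, hk⟩)
    rw [← PlaneGraph.head] at hhead
    have l1 := (G.rev ⟨k, hk⟩).isLt
    have l2 := (G.tail ⟨k, hk⟩).isLt
    have l3 := (G.head ⟨k, hk⟩).isLt
    have m1 := htree.mem_iff (G.tail ⟨k, hk⟩)
    have m2 := htree.mem_iff (G.head ⟨k, hk⟩)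
    simp only [wp_seq, wp_assign, wp_ite, wp_skip]
    refine ⟨?_, ⟨?_, fun hc1 => ⟨?_, fun hc2 => ⟨by simp, by simp, .inr ⟨⟨k, hk⟩, ?_⟩⟩,
      fun hc2 => ⟨by simp, ?_⟩⟩, fun hc1 => ⟨by simp, ?_⟩⟩⟩
    · simp [h2', h7, hrev, abs_le]; omega
    · simp [h2', h7, htail, abs_le]; omega
    · simp [h2', h7, hrev, hhead]; omega
    · simp [h2', h7, hrev, hhead, htail, h1'] at hc1 hc2
      rw [← m1, ← m2]
      simp [h7]
      omega
    · simp [h2', h7, hrev, hhead, htail, h1'] at hc1 hc2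
      simp
      refine hI.imp_left ?_
      rintro ⟨h9, hall⟩
      refine ⟨h9, fun d hd ht => ?_⟩
      by_cases hdk : d.val = k
      · obtain rfl : d = ⟨k, hk⟩ := Fin.ext hdk
        rw [← m2]
        omega
      · exact hall d (by omega) ht
    · simp [h2', h7, hrev, hhead, htail, h1'] at hc1
      simp
      refine hI.imp_left ?_
      rintro ⟨h9, hall⟩
      refine ⟨h9, fun d hd ht => ?_⟩
      by_cases hdk : d.val = k
      · obtain rfl : d = ⟨k, hk⟩ := Fin.ext hdk
        rw [← m1] at ht
        omega
      · exact hall d (by omega) ht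
  · intro s' h7 ha ht hI
    refine ⟨?_, hI.imp_left fun h => ⟨h.1, fun d => h.2 d d.isLt⟩⟩
    simp at ht
    omega

/-- A scan that finds no arc leaving the tree proves, by connectedness, that the tree spans. Each
path has length at most the number of rounds. -/
theorem wp_tree (hinp : ReadsGraph G walks ω inp) (hB : WordBounds n D l m W B)
    {s : AState} (h1 : s.var 1 = n) (h2 : s.var 2 = D) (h4 : s.var 4 = (x₀.val : ℤ))
    (hz : ∀ i, s.arr 1 i = 0) :
    tree.wp B inp (fun s' => s'.time ≤ s.time + 300 * (n * (D + 1)) + 100 ∧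
      ∃ path, (∀ v, TreeEntry G x₀ path (s'.arr 1) v) ∧ ∀ v, (path v).length ≤ n) s := by
  have ⟨b1, b2, b3, b4, b5, b6, b7, b8⟩ := hB
  have hx := x₀.isLt
  rw [tree, wp_seq, wp_store]
  refine ⟨addr_ok (by simp) (by simp [h4]; omega), by simp; omega, ?_⟩
  refine wp_forTo n (100 * (D + 1) + 100) (fun k _ a _ => ∃ path M, IsTreeOn G x₀ path (a 1) M k)
    (by simp [findArc]) (by simp [findArc]) (by simp) (by simpa using h1) (by omega) ?_ ?_ ?_
  · refine ⟨fun _ => [], {x₀}, by simp, ?_, ?_, ?_, by simp, by simp⟩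
    · intro v hv
      have : (v.val : ℤ) ≠ x₀.val := fun h => by
        simp at hv; exact hv (Fin.ext (by exact_mod_cast h))
      simp [h4, this, hz]
    · intro v hv
      obtain rfl : v = x₀ := by simpa using hv
      exact .inl ⟨rfl, rfl, by simp [h4]⟩
    · simp
  · rintro k hk s' h6 ha ⟨path, M, hM⟩
    have h2' : s'.var 2 = D := by rw [ha.var 2 (by simp [findArc])]; simpa using h2
    rw [wp_seq]
    refine wp_call (wp_findArc hinp hB h2' hM) ?_
    rintro s2 ha2 ⟨ht2, h9⟩
    have h22 : s2.var 2 = D := by rw [ha2.var 2 (by simp [findArc]), h2']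
    have h12 : s2.arr 1 = s'.arr 1 := ha2.arr 1 (by simp [findArc])
    simp only [wp_ite, wp_store, wp_skip]
    refine ⟨by simp, fun hc => ?_, fun hc => ⟨by simp; omega, path, M, ?_⟩⟩
    · rcases h9 with ⟨h9, -⟩ | ⟨d, h9, hd, hd'⟩
      · simp [h9] at hc
      have hrev := hinp.rev d
      have hhead := hinp.tail (G.rev d)
      rw [← PlaneGraph.head] at hhead
      have l1 := (G.rev d).isLt
      have l2 := d.isLt
      have l3 := (G.head d).isLt
      refine ⟨addr_ok ?_ ?_, ?_, by simp; omega, Function.update path (G.head d)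
        (d :: path (G.tail d)), insert (G.head d) M, ?_⟩
      rotate_right
      · convert hM.insert hd hd' using 1
        simp [h22, h9, hrev, hhead, h12]
      · simp [h22, h9, hrev, abs_le]; omega
      · simp [h22, h9, hrev, hhead]; omega
      · simp [h9, abs_le]; omega
    · rcases h9 with ⟨h9, hcl⟩ | ⟨d, h9, hd, hd'⟩
      · obtain rfl := hM.eq_univ hcl
        simpa [h12] using hM.succ_of_eq_univ
      · simp [h9] at hc
  · rintro s' h6 ha ht ⟨path, M, hM⟩
    have hM' : M = Finset.univ := by
      rcases hM.card with h | h
      · have := Finset.card_le_univ M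
        simp at this
        omega
      · exact h
    subst hM'
    refine ⟨?_, path, fun v => hM.entry v (Finset.mem_univ v), fun v =>
      hM.length v (Finset.mem_univ v)⟩
    simp at ht
    nlinarith

end

end Preprocessing

/-! ### The tables of prefix sums -/

section Table

variable {n D : ℕ} (G : PlaneGraph n D) (ρ : Equiv.Perm (Fin n)) (path : Fin n → List (Fin D))

/-- The number of vertices of rank less than `r` whose tree path uses the arc `d`. -/
def arcCount (r : ℕ) (d : Fin D) : ℕ :=
  ∑ v ∈ Finset.univ.filter (fun v => (ρ v).val < r), (path v).count d

/-- The contribution of a crossing of the arc `d`. -/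
def arcTerm (r : ℕ) (d : Fin D) : ℤ := (arcCount ρ path r d : ℤ) - arcCount ρ path r (G.rev d)

/-- The prefix sums of the contributions along a list of arcs. -/
def prefixSum (l : List (Fin D)) (r j : ℕ) : ℤ := ((l.take j).map (arcTerm G ρ path r)).sum

theorem arcCount_zero (d : Fin D) : arcCount ρ path 0 d = 0 := by simp [arcCount]

/-- Consecutive rows differ by the path of one vertex, so the counts are updated in time `O(n)` per
row. -/
theorem arcCount_succ {r : ℕ} (hr : r < n) (d : Fin D) :
    arcCount ρ path (r + 1) d = arcCount ρ path r d + (path (ρ.symm ⟨r, hr⟩)).count d := by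
  have h : Finset.univ.filter (fun v => (ρ v).val < r + 1) =
      insert (ρ.symm ⟨r, hr⟩) (Finset.univ.filter fun v => (ρ v).val < r) := by
    ext v
    simp only [Finset.mem_filter, Finset.mem_univ, true_and, Finset.mem_insert,
      Equiv.eq_symm_apply, Fin.ext_iff]
    omega
  rw [arcCount, h, Finset.sum_insert (by simp), add_comm, arcCount]

variable {path}

theorem arcCount_le (hpath : ∀ v, (path v).length ≤ n) (r : ℕ) (d : Fin D) :
    arcCount ρ path r d ≤ n * n := by
  refine (Finset.sum_le_card_nsmul _ _ n fun v _ => List.count_le_length.trans (hpath v)).trans ?_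
  refine Nat.mul_le_mul_right n ?_
  simpa using Finset.card_le_univ (Finset.univ.filter fun v => (ρ v).val < r)

theorem abs_arcTerm_le (hpath : ∀ v, (path v).length ≤ n) (r : ℕ) (d : Fin D) :
    |arcTerm G ρ path r d| ≤ n * n := by
  have h1 := arcCount_le ρ hpath r d
  have h2 := arcCount_le ρ hpath r (G.rev d)
  rw [arcTerm, abs_le]
  zify at h1 h2
  constructor <;> linarith [Int.natCast_nonneg (arcCount ρ path r d),
    Int.natCast_nonneg (arcCount ρ path r (G.rev d))]

variable {l : List (Fin D)}

theorem prefixSum_zero (r : ℕ) : prefixSum G ρ path l r 0 = 0 := by simp [prefixSum]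

theorem prefixSum_succ (r : ℕ) {j : ℕ} (hj : j < l.length) :
    prefixSum G ρ path l r (j + 1) = prefixSum G ρ path l r j + arcTerm G ρ path r l[j] := by
  rw [prefixSum, List.take_add_one, List.getElem?_eq_getElem hj]
  simp only [Option.toList_some, List.map_append, List.map_cons, List.map_nil, List.sum_append,
    List.sum_cons, List.sum_nil, add_zero, prefixSum]

/-- A crude bound, needed only to keep the words polynomially small. -/
theorem abs_prefixSum_le (hpath : ∀ v, (path v).length ≤ n) (r : ℕ) {j : ℕ} (hj : j ≤ l.length) :
    |prefixSum G ρ path l r j| ≤ j * (n * n) := by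
  induction j with
  | zero => simp [prefixSum_zero]
  | succ j ih =>
    rw [prefixSum_succ _ _ _ (by omega)]
    refine (abs_add_le _ _).trans ?_
    have h1 := ih (by omega)
    have h2 := abs_arcTerm_le G ρ hpath r l[j]
    push_cast
    linarith

end Table

/-! ### Preprocessing: filling the table row by row. -/

namespace Preprocessing

open WExp Cmd

/-- One row of the table of prefix sums, starting in the cell `var 10` of array `5`. -/
def row : Cmd :=
  assign 14 (const 0) ;;
  store 5 (var 10) (const 0) ;;
  forTo 7 5 (
    assign 13 (input (add (add (add (const 4) (mul (const 3) (var 2))) (var 3)) (var 7))) ;;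
    assign 14 (add (var 14) (sub (arr 2 (var 13))
      (arr 2 (input (add (add (const 4) (var 2)) (var 13)))))) ;;
    store 5 (add (add (var 10) (var 7)) (const 1)) (var 14))

/-- The arcs of the tree path of the vertex with rank `var 6` are counted in array `2`. -/
def countPath : Cmd :=
  assign 15 (arr 1 (arr 3 (var 6))) ;;
  loop (.le (const 2) (var 15)) (
    assign 15 (sub (var 15) (const 2)) ;;
    store 2 (var 15) (add (arr 2 (var 15)) (const 1)) ;;
    assign 15 (arr 1 (input (add (const 4) (var 15)))))

/-- A row of the table, and the counts for the next row. -/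
def rowStep : Cmd :=
  row ;;
  assign 10 (add (var 10) (var 12)) ;;
  ite (.le (add (var 6) (const 1)) (var 1)) countPath skip

/-- Array `5` becomes the table of prefix sums. -/
def table : Cmd :=
  assign 12 (add (var 5) (const 1)) ;;
  assign 11 (add (var 1) (const 1)) ;;
  assign 10 (const 0) ;;
  forTo 6 11 rowStep

section

variable {n D : ℕ} {G : PlaneGraph n D} {walks : List (List (Fin D))} {ω : Fin n → ℝ}
  {inp : MachineInput} {m W B r : ℕ} {x₀ : Fin n} {path : Fin n → List (Fin D)}
  {ρ : Equiv.Perm (Fin n)}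

/-- Cell `j` holds the sum of the first `j` terms, whence `m + 1` cells per row. All writes are at
or beyond the start of the row, so earlier rows survive. -/
theorem wp_row (hinp : ReadsGraph G walks ω inp) (hB : WordBounds n D walks.length m W B)
    (hm : m = walks.flatten.length) {s : AState} (h2 : s.var 2 = D) (h3 : s.var 3 = walks.length)
    (h5 : s.var 5 = m) (hr : r ≤ n) (h10 : s.var 10 = ((r * (m + 1) : ℕ) : ℤ))
    (hlen : ∀ v, (path v).length ≤ n) (hcount : ∀ d, s.arr 2 (d.val : ℤ) = arcCount ρ path r d) :
    row.wp B inp (fun s' => s'.time ≤ s.time + 200 * (m + 1) ∧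
      (∀ j ≤ m, s'.arr 5 ((r * (m + 1) + j : ℕ) : ℤ) = prefixSum G ρ path walks.flatten r j) ∧
      ∀ i < r * (m + 1), s'.arr 5 (i : ℤ) = s.arr 5 (i : ℤ)) s := by
  have ⟨b1, b2, b3, b4, b5, b6, b7, b8⟩ := hB
  have hcell : r * (m + 1) + m + 1 ≤ 4 * W := by nlinarith
  generalize hbase : r * (m + 1) = base at *
  simp only [row, wp_seq, wp_assign, wp_store]
  refine ⟨by simp, addr_ok (by simp) (by simp [h10]; omega), by simp, ?_⟩
  refine wp_forTo m 100 (fun k v a _ => v 14 = prefixSum G ρ path walks.flatten r k ∧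
    (∀ j ≤ k, a 5 ((base + j : ℕ) : ℤ) = prefixSum G ρ path walks.flatten r j) ∧
    ∀ i < base, a 5 (i : ℤ) = s.arr 5 (i : ℤ)) (by simp) (by simp) (by simp) (by simpa using h5)
    (by omega) ?_ ?_ ?_
  · refine ⟨by simp [prefixSum_zero], ?_, ?_⟩
    · intro j hj
      obtain rfl : j = 0 := by omega
      simp [h10, prefixSum_zero]
    · intro i hi
      have : (i : ℤ) ≠ base := by omega
      simp [h10, this]
  · rintro k hk s' h7 ha ⟨h14, hrow, hold⟩
    have h2' : s'.var 2 = D := by rw [ha.var 2 (by simp)]; simpa using h2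
    have h3' : s'.var 3 = walks.length := by rw [ha.var 3 (by simp)]; simpa using h3
    have h10' : s'.var 10 = base := by rw [ha.var 10 (by simp)]; simpa using h10
    have hcount' : ∀ d : Fin D, s'.arr 2 (d.val : ℤ) = arcCount ρ path r d := fun d => by
      rw [ha.arr 2 (by simp)]; simpa using hcount d
    have hk' : k < walks.flatten.length := by omega
    have harc := hinp.arc k hk'
    have hrev := hinp.rev walks.flatten[k]
    have hsucc := prefixSum_succ G ρ (path := path) r hk'
    have hle : |prefixSum G ρ path walks.flatten r (k + 1)| ≤ ((k + 1 : ℕ) : ℤ) * (n * n) :=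
      abs_prefixSum_le G ρ hlen r hk'
    have c1 := arcCount_le ρ hlen r walks.flatten[k]
    have c2 := arcCount_le ρ hlen r (G.rev walks.flatten[k])
    have l1 := (walks.flatten[k]).isLt
    have l2 := (G.rev walks.flatten[k]).isLt
    have hnn : n * n ≤ 2 * W := le_trans (by nlinarith) b7
    have hle' : ((k + 1 : ℕ) : ℤ) * (n * n) ≤ 2 * W := by
      have : (k + 1) * (n * n) ≤ 2 * W := le_trans (Nat.mul_le_mul_right _ (by omega)) b7
      exact_mod_cast this
    have hle2 := hle.trans hle'
    rw [abs_le] at hle2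
    rw [arcTerm] at hsucc
    generalize walks.flatten[k] = d at *
    have c1' := hcount' d
    have c2' := hcount' (G.rev d)
    simp only [wp_seq, wp_assign, wp_store]
    refine ⟨?_, ?_, addr_ok ?_ ?_, by simp, by simp, ?_, ?_, ?_⟩
    · simp [h2', h3', h7, abs_le]; omega
    · simp [h2', h3', h7, harc, hrev, c1', c2', h14, abs_le]; omega
    · simp [h10', h7, abs_le]; omega
    · simp [h10', h7]; grind
    · simp [h2', h3', h7, harc, hrev, c1', c2', h14, hsucc]
    · intro j hj
      by_cases hjk : j = k + 1
      · subst hjk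
        rw [show ((base + (k + 1) : ℕ) : ℤ) = base + k + 1 by push_cast; ring]
        simp [h2', h3', h7, h10', harc, hrev, c1', c2', h14, hsucc]
      · have : (base : ℤ) + (j : ℤ) ≠ base + k + 1 := by omega
        simpa [h10', h7, this] using hrow j (by omega)
    · intro i hi
      have : (i : ℤ) ≠ base + k + 1 := by omega
      simpa [h10', h7, this] using hold i hi
  · rintro s' h7 ha ht ⟨h14, hrow, hold⟩
    refine ⟨?_, hrow, hold⟩
    simp at ht
    omega

theorem wp_countPath (hinp : ReadsGraph G walks ω inp) (hB : WordBounds n D walks.length m W B)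
    {s : AState} (hr : r < n) (h6 : s.var 6 = r) (htree : ∀ v, TreeEntry G x₀ path (s.arr 1) v)
    (hlen : ∀ v, (path v).length ≤ n)
    (hsort : ∀ v : Fin n, s.arr 3 ((ρ v).val : ℤ) = (v.val : ℤ))
    (hcount : ∀ d, s.arr 2 (d.val : ℤ) = arcCount ρ path r d) :
    countPath.wp B inp (fun s' => s'.time ≤ s.time + 100 * (n + 1) ∧
      ∀ d, s'.arr 2 (d.val : ℤ) = arcCount ρ path (r + 1) d) s := by
  have ⟨b1, b2, b3, b4, b5, b6, b7, b8⟩ := hB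
  have hnn : n * n ≤ 2 * W := le_trans (by nlinarith) b7
  set v₀ := ρ.symm ⟨r, hr⟩ with hv₀
  have h3 : s.arr 3 (r : ℤ) = v₀.val := by
    have := hsort v₀
    rwa [hv₀, Equiv.apply_symm_apply] at this
  have hv := v₀.isLt
  rw [countPath, wp_seq, wp_assign]
  refine ⟨by simp [h6, h3]; omega, ?_⟩
  -- The walk up the tree has reached `u`: the arcs `l` are counted, those of `path u` remain, at 60
  -- steps for each.
  refine wp_loop (fun s' => ∃ u l, path v₀ = l ++ path u ∧ s'.var 15 = s.arr 1 (u.val : ℤ) ∧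
    (∀ d, s'.arr 2 (d.val : ℤ) = arcCount ρ path r d + (l.count d : ℤ)) ∧
    s'.time + 60 * (path u).length ≤ s.time + 60 * (path v₀).length + 30)
    -- The remaining time budget serves as the measure, since every round makes the clock advance.
    (fun s' => s.time + 60 * (path v₀).length + 31 - s'.time) ?_ ?_
  · exact ⟨v₀, [], rfl, by simp [h6, h3], by simpa using hcount, by simp; omega⟩
  · rintro s' ha ⟨u, l, hl, h15, hc, ht⟩
    have h1' : s'.arr 1 = s.arr 1 := by rw [ha.arr 1 (by simp)]; rfl
    have hlen0 := hlen v₀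
    refine ⟨by simp; omega, fun hcond => ?_, fun hcond => ?_⟩
    · simp [h15] at hcond
      rcases htree u with ⟨-, -, h⟩ | ⟨d, hpu, hd, h⟩
      · rw [h] at hcond
        omega
      rw [h] at h15
      have l1 := d.isLt
      have htail := hinp.tail d
      have l2 := (G.tail d).isLt
      have hcd := hc d
      have hcle := arcCount_le ρ hlen r d
      have hlle : l.count d ≤ n := by
        refine List.count_le_length.trans ?_
        rw [hl, List.length_append] at hlen0
        omega
      rw [hpu, List.length_cons] at ht
      simp only [wp_seq, wp_assign, wp_store]
      refine ⟨?_, addr_ok (by simp) ?_, ?_, ?_, ⟨G.tail d, l ++ [d], ?_, ?_, ?_, ?_⟩, ?_⟩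
      · simp [h15]; omega
      · simp [h15]; omega
      · simp [h15, hcd, abs_le]; omega
      · simp [h15, htail, abs_le]; omega
      · simp [hl, hpu]
      · simp [h15, htail, h1']
      · intro e
        by_cases hed : e = d
        · subst hed
          simp [h15, hcd, add_assoc]
        · have : (e.val : ℤ) ≠ d.val := fun h => hed (Fin.ext (by exact_mod_cast h))
          simp [h15, this, hc e, Ne.symm hed]
      · simp; omega
      · simp; omega
    · simp [h15] at hcond
      rcases htree u with ⟨hpu, -, h⟩ | ⟨d, hpu, hd, h⟩
      · refine ⟨by simp; omega, fun d => ?_⟩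
        rw [arcCount_succ ρ path hr, ← hv₀, hl, hpu]
        simpa using hc d
      · rw [h] at hcond
        omega

/-- There are `n + 1` rows but only `n` vertices: after the last row there is no path left to count,
hence the test in the program and the premise `r + 1 ≤ n`. -/
theorem wp_rowStep (hinp : ReadsGraph G walks ω inp) (hB : WordBounds n D walks.length m W B)
    (hm : m = walks.flatten.length) {s : AState} (h1 : s.var 1 = n) (h2 : s.var 2 = D)
    (h3 : s.var 3 = walks.length) (h5 : s.var 5 = m) (h6 : s.var 6 = r) (h12 : s.var 12 = m + 1)
    (htree : ∀ v, TreeEntry G x₀ path (s.arr 1) v) (hlen : ∀ v, (path v).length ≤ n)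
    (hsort : ∀ v : Fin n, s.arr 3 ((ρ v).val : ℤ) = (v.val : ℤ))
    (hr : r ≤ n) (h10 : s.var 10 = ((r * (m + 1) : ℕ) : ℤ))
    (hcount : ∀ d, s.arr 2 (d.val : ℤ) = arcCount ρ path r d)
    (hrows : ∀ r' < r, ∀ j ≤ m,
      s.arr 5 ((r' * (m + 1) + j : ℕ) : ℤ) = prefixSum G ρ path walks.flatten r' j) :
    rowStep.wp B inp (fun s' => s'.time ≤ s.time + (200 * (m + 1) + 100 * (n + 1) + 50) ∧
      s'.var 10 = (((r + 1) * (m + 1) : ℕ) : ℤ) ∧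
      (r + 1 ≤ n → ∀ d : Fin D, s'.arr 2 (d.val : ℤ) = arcCount ρ path (r + 1) d) ∧
      ∀ r' < r + 1, ∀ j ≤ m,
        s'.arr 5 ((r' * (m + 1) + j : ℕ) : ℤ) = prefixSum G ρ path walks.flatten r' j) s := by
  have ⟨b1, b2, b3, b4, b5, b6, b7, b8⟩ := hB
  have hcell : (r + 1) * (m + 1) ≤ 4 * W := le_trans (Nat.mul_le_mul_right _ (by omega)) b6
  rw [rowStep, wp_seq]
  refine wp_call (wp_row hinp hB hm h2 h3 h5 hr h10 hlen hcount) ?_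
  rintro s2 ha2 ⟨ht2, hrow2, hold2⟩
  have h12' : s2.var 1 = n := by rw [ha2.var 1 (by decide), h1]
  have h62 : s2.var 6 = r := by rw [ha2.var 6 (by decide), h6]
  have hrows2 : ∀ r' < r + 1, ∀ j ≤ m, s2.arr 5 ((r' * (m + 1) + j : ℕ) : ℤ) =
      prefixSum G ρ path walks.flatten r' j := by
    intro r' hr' j hj
    by_cases hrk : r' = r
    · subst hrk
      exact hrow2 j hj
    · have : (r' + 1) * (m + 1) ≤ r * (m + 1) := Nat.mul_le_mul_right _ (by omega)
      rw [hold2 _ (by rw [add_mul] at this; omega)]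
      exact hrows r' (by omega) j hj
  have hnext : s2.var 10 + s2.var 12 = (((r + 1) * (m + 1) : ℕ) : ℤ) := by
    rw [ha2.var 10 (by decide), h10, ha2.var 12 (by decide), h12]
    push_cast
    ring
  have htree2 : s2.arr 1 = s.arr 1 := ha2.arr 1 (by decide)
  have hsort2 : s2.arr 3 = s.arr 3 := ha2.arr 3 (by decide)
  have hcount2 : s2.arr 2 = s.arr 2 := ha2.arr 2 (by decide)
  rw [wp_seq, wp_assign]
  simp only [WExp.Ok, WExp.eval, hnext, true_and]
  refine ⟨by rw [abs_le]; omega, ?_⟩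
  generalize hs3 : s2.setVar 10 (((r + 1) * (m + 1) : ℕ) : ℤ) _ = s3
  have t3 : s3.time = s2.time + 7 := by rw [← hs3]; rfl
  have a3 : s3.arr = s2.arr := by rw [← hs3]; rfl
  have h103 : s3.var 10 = (((r + 1) * (m + 1) : ℕ) : ℤ) := by rw [← hs3]; simp
  have h63 : s3.var 6 = r := by rw [← hs3]; simpa using h62
  have h13 : s3.var 1 = n := by rw [← hs3]; simpa using h12'
  rw [wp_ite, wp_skip]
  simp only [Cond.holds, Cond.Ok, WExp.Ok, WExp.eval, h63, h13, true_and, and_true]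
  refine ⟨by rw [abs_le, abs_le]; omega, fun hc => ?_, fun hc => ⟨?_, h103, fun h => ?_, ?_⟩⟩
  · refine wp_call (wp_countPath hinp hB (r := r) (ρ := ρ) (path := path) (x₀ := x₀) (by omega)
      h63 (fun v => ?_) hlen (fun v => ?_) (fun d => ?_)) ?_
    · simpa only [AState.tick, a3, htree2] using htree v
    · simpa only [AState.tick, a3, hsort2] using hsort v
    · simpa only [AState.tick, a3, hcount2] using hcount d
    · rintro s4 ha4 ⟨ht4, hcount4⟩
      refine ⟨?_, ?_, fun _ d => hcount4 d, fun r' hr' j hj => ?_⟩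
      · simp only [AState.tick, Cond.cost, WExp.cost] at ht4
        omega
      · rw [ha4.var 10 (by decide)]
        exact h103
      · rw [ha4.arr 5 (by decide), AState.tick, a3]
        exact hrows2 r' hr' j hj
  · simp only [AState.tick, Cond.cost, WExp.cost]
    omega
  · omega
  · simp only [AState.tick, a3]
    exact hrows2

theorem wp_table (hinp : ReadsGraph G walks ω inp) (hB : WordBounds n D walks.length m W B)
    (hm : m = walks.flatten.length) {s : AState} (h1 : s.var 1 = n) (h2 : s.var 2 = D)
    (h3 : s.var 3 = walks.length) (h5 : s.var 5 = m)
    (htree : ∀ v, TreeEntry G x₀ path (s.arr 1) v) (hlen : ∀ v, (path v).length ≤ n)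
    (hsort : ∀ v : Fin n, s.arr 3 ((ρ v).val : ℤ) = (v.val : ℤ)) (hz : ∀ i, s.arr 2 i = 0) :
    table.wp B inp (fun s' => s'.time ≤ s.time + 400 * ((n + 1) * (n + m + 2)) ∧
      s'.var 12 = (m : ℤ) + 1 ∧ ∀ r ≤ n, ∀ j ≤ m,
        s'.arr 5 ((r * (m + 1) + j : ℕ) : ℤ) = prefixSum G ρ path walks.flatten r j) s := by
  have ⟨b1, b2, b3, b4, b5, b6, b7, b8⟩ := hB
  simp only [table, wp_seq, wp_assign]
  refine ⟨by simp [h5, abs_le]; omega, by simp [h1, abs_le]; omega, by simp, ?_⟩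
  refine wp_forTo (n + 1) (200 * (m + 1) + 100 * (n + 1) + 50) (fun k v a _ =>
    v 10 = ((k * (m + 1) : ℕ) : ℤ) ∧
    (k ≤ n → ∀ d : Fin D, a 2 (d.val : ℤ) = arcCount ρ path k d) ∧
    ∀ r < k, ∀ j ≤ m, a 5 ((r * (m + 1) + j : ℕ) : ℤ) = prefixSum G ρ path walks.flatten r j)
    (by decide) (by decide) (by decide) (by simp [h1]) (by omega)
    (by simp [arcCount_zero, hz]) ?_ ?_
  · rintro k hk s' h6 ha ⟨h10, hcount, hrows⟩
    have a1 : s'.arr 1 = s.arr 1 := by rw [ha.arr 1 (by decide)]; rfl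
    have a3 : s'.arr 3 = s.arr 3 := by rw [ha.arr 3 (by decide)]; rfl
    refine wp_call (wp_rowStep hinp hB hm (r := k) (ρ := ρ) (path := path) (x₀ := x₀) ?_ ?_ ?_ ?_ h6
      ?_ (fun v => a1 ▸ htree v) hlen (fun v => a3 ▸ hsort v) (by omega) h10
      (hcount (by omega)) hrows) ?_
    · rw [ha.var 1 (by decide)]; simpa using h1
    · rw [ha.var 2 (by decide)]; simpa using h2
    · rw [ha.var 3 (by decide)]; simpa using h3
    · rw [ha.var 5 (by decide)]; simpa using h5
    · rw [ha.var 12 (by decide)]; simp [h5]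
    · rintro s2 - ⟨ht2, h102, hcount2, hrows2⟩
      exact ⟨ht2, by simpa using h102, hcount2, hrows2⟩
  · rintro s' h6 ha ht ⟨h10, hcount, hrows⟩
    refine ⟨?_, ?_, fun r hr => hrows r (by omega)⟩
    · simp only [AState.setVar, WExp.cost] at ht
      nlinarith
    · rw [ha.var 12 (by decide)]
      simp [h5]

end

end Preprocessing

/-- The arrays `a` and `r` hold the data structure. -/
structure HoldsTables {n D : ℕ} (G : PlaneGraph n D) (walks : List (List (Fin D)))
    (ω : Fin n → ℝ) (x₀ : Fin n) (ρ : Equiv.Perm (Fin n)) (path : Fin n → List (Fin D))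
    (a : Fin 8 → ℤ → ℤ) (r : Fin 8 → ℤ → ℝ) : Prop where
  order : a 0 0 = n
  rowLength : a 0 1 = (walks.flatten.length : ℤ) + 1
  offset : ∀ i < walks.length, a 4 (i : ℤ) = walkOffset walks i
  weight : ∀ v, r 1 ((ρ v).val : ℤ) = ω v
  mono : ∀ u v, ρ u ≤ ρ v → ω u ≤ ω v
  treePath : ∀ v, G.IsTreePath x₀ path v
  length : ∀ v, (path v).length ≤ n
  table : ∀ r ≤ n, ∀ j ≤ walks.flatten.length,
    a 5 ((r * (walks.flatten.length + 1) + j : ℕ) : ℤ) = prefixSum G ρ path walks.flatten r j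

/-! ### The complete preprocessing. -/

namespace Preprocessing

open WExp Cmd

/-- The preprocessing program. -/
def program : Cmd :=
  assign 1 (input (const 0)) ;; assign 2 (input (const 1)) ;; assign 3 (input (const 2)) ;;
  assign 4 (input (const 3)) ;; offsets ;; weights ;; sort ;; tree ;; table ;;
  store 0 (const 0) (var 1) ;; store 0 (const 1) (var 12)

variable {n D : ℕ} {G : PlaneGraph n D} {walks : List (List (Fin D))} {ω : Fin n → ℝ}
  {inp : MachineInput} {m W B : ℕ} {x₀ : Fin n}

theorem wp_program (hinp : ReadsGraph G walks ω inp) (hB : WordBounds n D walks.length m W B)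
    (hm : m = walks.flatten.length) (i0 : inp.word 0 = n) (i1 : inp.word 1 = D)
    (i2 : inp.word 2 = walks.length) (i3 : inp.word 3 = (x₀.val : ℤ)) {s : AState}
    (hz : ∀ a i, s.arr a i = 0) :
    program.wp B inp (fun s' => s'.time ≤ s.time + 5000 * (n * (n + D + m)) ∧
      ∃ ρ path, HoldsTables G walks ω x₀ ρ path s'.arr s'.rarr) s := by
  have ⟨b1, b2, b3, b4, b5, b6, b7, b8⟩ := hB
  have hn := x₀.pos
  have h3B : 3 ≤ B := by omega
  obtain ⟨ρ, hρ, hmono⟩ := exists_rank ω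
  simp only [program, wp_seq, wp_assign]
  refine ⟨by simp, by simp; omega, by simp; omega, by simp; omega, ?_⟩
  simp only [WExp.eval, i0, i1, i2, i3]
  generalize hs0 : (((s.setVar 1 (n : ℤ) _).setVar 2 (D : ℤ) _).setVar 3 (walks.length : ℤ) _).setVar
    4 (x₀.val : ℤ) _ = s0
  have v1 : s0.var 1 = n := by rw [← hs0]; simp
  have v2 : s0.var 2 = D := by rw [← hs0]; simp
  have v3 : s0.var 3 = walks.length := by rw [← hs0]; simp
  have v4 : s0.var 4 = (x₀.val : ℤ) := by rw [← hs0]; simp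
  have t0 : s0.time ≤ s.time + 100 := by rw [← hs0]; simp
  have z0 : ∀ a i, s0.arr a i = 0 := by rw [← hs0]; simpa using hz
  clear hs0
  refine wp_call (wp_offsets hinp hB hm v2 v3) ?_
  rintro s1 a1 ⟨t1, hm1, hoff⟩
  refine wp_call (wp_weights hinp hB (by rw [a1.var 1 (by decide), v1])) ?_
  rintro s2 a2 ⟨t2, hw⟩
  refine wp_call (wp_sort hB (by rw [a2.var 1 (by decide), a1.var 1 (by decide), v1]) hw ρ hρ) ?_
  rintro s3 a3 ⟨t3, hsort, hsorted⟩
  refine wp_call (wp_tree (x₀ := x₀) hinp hB ?_ ?_ ?_ fun i => ?_) ?_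
  · rw [a3.var 1 (by decide), a2.var 1 (by decide), a1.var 1 (by decide), v1]
  · rw [a3.var 2 (by decide), a2.var 2 (by decide), a1.var 2 (by decide), v2]
  · rw [a3.var 4 (by decide), a2.var 4 (by decide), a1.var 4 (by decide), v4]
  · rw [a3.arr 1 (by decide), a2.arr 1 (by decide), a1.arr 1 (by decide), z0]
  rintro s4 a4 ⟨t4, path, htree, hlen⟩
  refine wp_call (wp_table (x₀ := x₀) (ρ := ρ) hinp hB hm ?_ ?_ ?_ ?_ htree hlen (fun v => ?_)
    fun i => ?_) ?_
  · rw [a4.var 1 (by decide), a3.var 1 (by decide), a2.var 1 (by decide), a1.var 1 (by decide), v1]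
  · rw [a4.var 2 (by decide), a3.var 2 (by decide), a2.var 2 (by decide), a1.var 2 (by decide), v2]
  · rw [a4.var 3 (by decide), a3.var 3 (by decide), a2.var 3 (by decide), a1.var 3 (by decide), v3]
  · rw [a4.var 5 (by decide), a3.var 5 (by decide), a2.var 5 (by decide), hm1]
  · rw [a4.arr 3 (by decide), hsort]
  · rw [a4.arr 2 (by decide), a3.arr 2 (by decide), a2.arr 2 (by decide), a1.arr 2 (by decide), z0]
  rintro s5 a5 ⟨t5, h12, htable⟩
  have v15 : s5.var 1 = n := by
    rw [a5.var 1 (by decide), a4.var 1 (by decide), a3.var 1 (by decide), a2.var 1 (by decide),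
      a1.var 1 (by decide), v1]
  have off5 : s5.arr 4 = s1.arr 4 := by
    rw [a5.arr 4 (by decide), a4.arr 4 (by decide), a3.arr 4 (by decide), a2.arr 4 (by decide)]
  have r5 : s5.rarr 1 = s3.rarr 1 := by rw [a5.rarr 1 (by decide), a4.rarr 1 (by decide)]
  simp only [wp_store]
  refine ⟨addr_ok (by simp) (by simp; omega), by simp, addr_ok (by simp; omega) (by simp; omega),
    by simp, ?_, ρ, path, ?_⟩
  -- As `n` is positive, the lower-order terms are absorbed by `n * (n + D + m)`.
  · have e1 : n ≤ n * n := Nat.le_mul_of_pos_left n hn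
    have e2 : m ≤ n * m := Nat.le_mul_of_pos_left m hn
    have e3 : 1 ≤ n * n := by omega
    have e4 : D ≤ n * D := Nat.le_mul_of_pos_left D hn
    simp only [AState.setArr, WExp.cost, WExp.cost_addr]
    nlinarith
  · subst hm
    refine ⟨by simp [v15], by simp [h12], fun i hi => ?_, fun v => ?_, fun u v h => hmono u v h,
      fun v => ?_, hlen, fun r hr j hj => ?_⟩
    · simpa [off5] using hoff i hi
    · simpa [r5] using hsorted v
    · rcases htree v with ⟨h1, h2, -⟩ | ⟨d, h1, h2, -⟩
      · exact .inl ⟨h1, h2⟩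
      · exact .inr ⟨d, h1, h2⟩
    · simpa using htable r hr j hj

end Preprocessing

/-! ### Pieces as differences of prefix sums. -/

section Pieces

variable {n D : ℕ} (G : PlaneGraph n D) (ρ : Equiv.Perm (Fin n)) (path : Fin n → List (Fin D))
  {walks : List (List (Fin D))}

theorem take_flatten {α : Type*} {walks : List (List α)} {i j : ℕ} (hi : i < walks.length)
    (hj : j ≤ (walks.getD i []).length) :
    walks.flatten.take (walkOffset walks i + j) =
      (walks.take i).flatten ++ (walks.getD i []).take j := by
  have h : walks.flatten =
      (walks.take i).flatten ++ (walks.getD i [] ++ (walks.drop (i + 1)).flatten) := by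
    conv_lhs => rw [← List.take_append_drop i walks, List.drop_eq_getElem_cons hi]
    rw [List.flatten_append, List.flatten_cons, List.getD_eq_getElem _ _ hi]
  have h' : (walks.take i).flatten.length = walkOffset walks i := by
    rw [List.length_flatten, walkOffset]
  rw [h, ← h', List.take_length_add_append, List.take_append_of_le_length hj]

theorem walkOffset_add_le {α : Type*} {walks : List (List α)} {i j : ℕ} (hi : i < walks.length)
    (hj : j ≤ (walks.getD i []).length) : walkOffset walks i + j ≤ walks.flatten.length := by
  have h1 := walkOffset_le walks (i + 1)
  rw [walkOffset_succ walks hi] at h1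
  omega

/-- The contribution of a piece, by prefix sums. -/
theorem sum_subwalk {c : Piece} (hc : c.Valid walks) (r : ℕ) :
    ((c.subwalk walks).map (arcTerm G ρ path r)).sum =
      prefixSum G ρ path walks.flatten r (walkOffset walks c.idx + c.hi) -
        prefixSum G ρ path walks.flatten r (walkOffset walks c.idx + c.lo) := by
  obtain ⟨h1, h2, h3⟩ := hc
  rw [prefixSum, prefixSum, take_flatten h1 h3, take_flatten h1 (h2.trans h3), Piece.subwalk]
  generalize walks.getD c.idx [] = w
  have h4 : w.take c.hi = w.take c.lo ++ (w.take c.hi).drop c.lo := by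
    conv_lhs => rw [← List.take_append_drop c.lo (w.take c.hi)]
    rw [List.take_take, min_eq_left h2]
  rw [List.map_append, List.map_append, List.sum_append, List.sum_append]
  conv_rhs => rw [h4]
  rw [List.map_append, List.sum_append]
  ring

end Pieces

/-! ### The query: binary search and summation over the pieces. -/

namespace Query

open WExp Cmd

/-- `var 4` becomes the number of weights that are at most the real number in array `2`. -/
def search : Cmd :=
  assign 4 (const 0) ;; assign 5 (var 1) ;;
  loop (.le (add (var 4) (const 1)) (var 5)) (
    assign 6 (div (add (var 4) (var 5)) (const 2)) ;;
    ite (.rle 1 (var 6) 2 (const 0)) (assign 4 (add (var 6) (const 1))) (assign 5 (var 6)))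

/-- `var 7` becomes the sum of the contributions of the pieces, `var 8` being the first cell of the
row of the table. -/
def sumPieces : Cmd :=
  assign 7 (const 0) ;;
  forTo 9 3 (
    assign 10 (add (var 8) (arr 4 (input (add (mul (const 3) (var 9)) (const 1))))) ;;
    assign 7 (add (var 7) (sub
      (arr 5 (add (var 10) (input (add (mul (const 3) (var 9)) (const 3)))))
      (arr 5 (add (var 10) (input (add (mul (const 3) (var 9)) (const 2))))))))

/-- The query program. -/
def program : Cmd :=
  assign 1 (arr 0 (const 0)) ;; assign 2 (arr 0 (const 1)) ;; assign 3 (input (const 0)) ;;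
  realRead 2 (const 0) (const 0) ;;
  search ;;
  assign 8 (mul (var 4) (var 2)) ;;
  sumPieces ;;
  assign 0 (sub (var 4) (var 7))

variable {n D : ℕ} {G : PlaneGraph n D} {walks : List (List (Fin D))} {ω : Fin n → ℝ}
  {inp : MachineInput} {m W B : ℕ} {x₀ : Fin n} {ρ : Equiv.Perm (Fin n)}
  {path : Fin n → List (Fin D)} {δ : ℝ}

theorem wp_search {s : AState} (hn : n ≤ W) (hW : 1 ≤ W) (hB : 1000 * W ≤ B) (h1 : s.var 1 = n)
    (hw : ∀ v, s.rarr 1 ((ρ v).val : ℤ) = ω v) (hmono : ∀ u v, ρ u ≤ ρ v → ω u ≤ ω v)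
    (hδ : s.rarr 2 0 = δ) (hn0 : n ≠ 0) :
    search.wp B inp (fun s' => s'.time ≤ s.time + 100 * Nat.log 2 n + 200 ∧
      ∃ K ≤ n, s'.var 4 = (K : ℤ) ∧ ∀ v, (ρ v).val < K ↔ ω v ≤ δ) s := by
  simp only [search, wp_seq, wp_assign]
  refine ⟨by simp, by simp, ?_⟩
  -- The potential `Nat.log 2 (2 * (hi - lo))` bounds the remaining rounds, each paid with 100
  -- steps. The factor two makes it `0` for an empty interval and `1` for length one.
  refine wp_loop (fun s' => ∃ lo hi : ℕ, lo ≤ hi ∧ hi ≤ n ∧ s'.var 4 = lo ∧ s'.var 5 = hi ∧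
    (∀ v, (ρ v).val < lo → ω v ≤ δ) ∧ (∀ v, hi ≤ (ρ v).val → δ < ω v) ∧
    s'.time + 100 * Nat.log 2 (2 * (hi - lo)) ≤ s.time + 100 * Nat.log 2 n + 150)
    (fun s' => (s'.var 5 - s'.var 4).toNat) ?_ ?_
  · refine ⟨0, n, by omega, le_rfl, by simp, by simp [h1], by simp, fun v hv => ?_, ?_⟩
    · have := (ρ v).isLt
      omega
    · rw [mul_comm 2, Nat.sub_zero, Nat.log_mul_base (by omega) hn0]
      simp
      omega
  · rintro s' ha ⟨lo, hi, hle, hin, h4, h5, hlo, hhi, ht⟩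
    have hw' : ∀ v, s'.rarr 1 ((ρ v).val : ℤ) = ω v := fun v => by
      rw [ha.rarr 1 (by decide)]; exact hw v
    have hδ' : s'.rarr 2 0 = δ := by rw [ha.rarr 2 (by decide)]; exact hδ
    refine ⟨by simp [h4, abs_le]; omega, fun hc => ?_, fun hc => ?_⟩
    · simp [h4, h5] at hc
      obtain ⟨mid, hmid⟩ : ∃ mid : ℕ, mid = (lo + hi) / 2 := ⟨_, rfl⟩
      have hmid' : ((lo : ℤ) + hi) / 2 = mid := by omega
      have hlt : mid < n := by omega
      have hwm : s'.rarr 1 (mid : ℤ) = ω (ρ.symm ⟨mid, hlt⟩) := by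
        rw [← hw' (ρ.symm ⟨mid, hlt⟩), Equiv.apply_symm_apply]
      -- Both possible remaining intervals have at most half the length.
      have hlog : ∀ g, 2 * g ≤ hi - lo →
          Nat.log 2 (2 * g) + 1 ≤ Nat.log 2 (2 * (hi - lo)) := by
        intro g hg
        rw [mul_comm 2 (hi - lo), Nat.log_mul_base (by omega) (by omega)]
        exact Nat.succ_le_succ (Nat.log_mono_right hg)
      have l1 := hlog (hi - (mid + 1)) (by omega)
      have l2 := hlog (mid - lo) (by omega)
      simp only [wp_seq, wp_assign, wp_ite]
      refine ⟨?_, ⟨addr_ok (by simp) ?_, addr_ok (by simp) (by simp; omega)⟩, fun hc2 => ⟨?_,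
        ⟨mid + 1, hi, by omega, hin, ?_, by simp [h5], fun v hv => ?_, hhi, ?_⟩, ?_⟩,
        fun hc2 => ⟨by simp, ⟨lo, mid, by omega, by omega, by simp [h4], ?_, hlo,
          fun v hv => ?_, ?_⟩, ?_⟩⟩
      · simp [h4, h5, hmid', abs_le]; omega
      · simp [h4, h5, hmid']; omega
      · simp [h4, h5, hmid', abs_le]; omega
      · simp [h4, h5, hmid']
      · simp [h4, h5, hmid', hwm, hδ'] at hc2
        refine (hmono v (ρ.symm ⟨mid, hlt⟩) ?_).trans hc2
        rw [Equiv.apply_symm_apply]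
        exact Nat.lt_succ_iff.1 hv
      · simp; omega
      · simp [h4, h5, hmid']; omega
      · simp [h4, h5, hmid']
      · simp [h4, h5, hmid', hwm, hδ'] at hc2
        refine hc2.trans_le (hmono (ρ.symm ⟨mid, hlt⟩) v ?_)
        rw [Equiv.apply_symm_apply]
        exact hv
      · simp; omega
      · simp [h4, h5, hmid']; omega
    · simp [h4, h5] at hc
      obtain rfl : hi = lo := by omega
      refine ⟨by simp; omega, hi, hin, h4, fun v => ⟨hlo v, fun h => ?_⟩⟩
      by_contra hv
      exact absurd h (not_le.2 (hhi v (not_lt.1 hv)))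

/-- The query program reads the pieces. -/
structure ReadsPieces (q : List Piece) (δ : ℝ) (inp : MachineInput) : Prop where
  length : inp.word 0 = q.length
  idx : ∀ i (h : i < q.length), inp.word (3 * (i : ℤ) + 1) = q[i].idx
  lo : ∀ i (h : i < q.length), inp.word (3 * (i : ℤ) + 2) = q[i].lo
  hi : ∀ i (h : i < q.length), inp.word (3 * (i : ℤ) + 3) = q[i].hi
  real : inp.real 0 = δ

variable {q : List Piece}

theorem wp_sumPieces {s : AState} (hB : WordBounds n D walks.length m W B)
    (hm : m = walks.flatten.length) (hq : ReadsPieces q δ inp) (hval : ∀ c ∈ q, c.Valid walks)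
    (hqW : (q.length + 1) * ((m + 1) * (n * n)) ≤ 2 * W) (hqW' : q.length ≤ W) {K : ℕ} (hK : K ≤ n)
    (hT : HoldsTables G walks ω x₀ ρ path s.arr s.rarr) (h3 : s.var 3 = q.length)
    (h8 : s.var 8 = ((K * (m + 1) : ℕ) : ℤ)) :
    sumPieces.wp B inp (fun s' => s'.time ≤ s.time + 100 * (q.length + 1) ∧
      s'.var 7 = ((concatPieces walks q).map (arcTerm G ρ path K)).sum ∧ |s'.var 7| ≤ 4 * W) s := by
  have ⟨b1, b2, b3, b4, b5, b6, b7, b8⟩ := hB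
  have hcell : (K + 1) * (m + 1) ≤ 4 * W := le_trans (Nat.mul_le_mul_right _ (by omega)) b6
  rw [add_mul, one_mul] at hcell
  -- Each piece adds a difference of two prefix sums of size at most `(m + 1) * (n * n)`. Partial
  -- sums therefore grow with the number of pieces, which the word bound has to include.
  have hbd : ∀ k ≤ q.length, k * (2 * ((m + 1) * (n * n))) ≤ 4 * W := by
    intro k hk
    have : k * ((m + 1) * (n * n)) ≤ 2 * W := le_trans (Nat.mul_le_mul_right _ (by omega)) hqW
    calc k * (2 * ((m + 1) * (n * n))) = 2 * (k * ((m + 1) * (n * n))) := by ring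
      _ ≤ 4 * W := by omega
  rw [sumPieces, wp_seq, wp_assign]
  refine ⟨by simp, ?_⟩
  refine wp_forTo q.length 80 (fun k v _ _ =>
    v 7 = ((concatPieces walks (q.take k)).map (arcTerm G ρ path K)).sum ∧
    |v 7| ≤ ((k * (2 * ((m + 1) * (n * n))) : ℕ) : ℤ)) (by decide) (by decide) (by decide)
    (by simpa using h3) (by omega) (by simp [concatPieces]) ?_ ?_
  · rintro k hk s' h9 ha ⟨h7, h7'⟩
    have h8' : s'.var 8 = ((K * (m + 1) : ℕ) : ℤ) := by rw [ha.var 8 (by decide)]; simpa using h8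
    have a4 : s'.arr 4 = s.arr 4 := by rw [ha.arr 4 (by decide)]; rfl
    have a5 : s'.arr 5 = s.arr 5 := by rw [ha.arr 5 (by decide)]; rfl
    have hc := hval q[k] (List.getElem_mem hk)
    have ⟨c1, c2, c3⟩ := hc
    have i1 := hq.idx k hk
    have i2 := hq.lo k hk
    have i3 := hq.hi k hk
    have hsum := sum_subwalk G ρ path hc K
    have p1 := walkOffset_add_le c1 c3
    have p2 := walkOffset_add_le c1 (c2.trans c3)
    have hoff := hT.offset _ c1
    have t1 := hT.table K hK _ p1
    have t2 := hT.table K hK _ p2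
    rw [← hm] at t1 t2
    have q1 := abs_prefixSum_le G ρ hT.length K p1
    have q2 := abs_prefixSum_le G ρ hT.length K p2
    have q3 : ∀ j, j ≤ walks.flatten.length → ((j : ℕ) : ℤ) * (n * n) ≤
        (((m + 1) * (n * n) : ℕ) : ℤ) := by
      intro j hj
      have : j * (n * n) ≤ (m + 1) * (n * n) := Nat.mul_le_mul_right _ (by omega)
      exact_mod_cast this
    have q1' := q1.trans (q3 _ p1)
    have q2' := q2.trans (q3 _ p2)
    have htake : concatPieces walks (q.take (k + 1)) =
        concatPieces walks (q.take k) ++ q[k].subwalk walks := by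
      rw [concatPieces, List.take_add_one, List.getElem?_eq_getElem hk,
        List.flatMap_append, Option.toList_some, List.flatMap_singleton, concatPieces]
    have hb1 := hbd k hk.le
    have hb2 := hbd (k + 1) hk
    rw [add_mul, one_mul] at hb2
    generalize hgc : q[k] = c at *
    generalize prefixSum G ρ path walks.flatten K (walkOffset walks c.idx + c.hi) = x1 at *
    generalize prefixSum G ρ path walks.flatten K (walkOffset walks c.idx + c.lo) = x2 at *
    generalize K * (m + 1) = base at *
    have t1' : s.arr 5 ((base : ℤ) + walkOffset walks c.idx + c.hi) = x1 := by
      rw [← t1]; congr 1; push_cast; ring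
    have t2' : s.arr 5 ((base : ℤ) + walkOffset walks c.idx + c.lo) = x2 := by
      rw [← t2]; congr 1; push_cast; ring
    have habs : |s'.var 7 + (x1 - x2)| ≤
        (((k + 1) * (2 * ((m + 1) * (n * n))) : ℕ) : ℤ) := by
      rw [add_mul, one_mul]
      generalize (m + 1) * (n * n) = N at *
      rw [abs_le] at *
      push_cast at *
      constructor <;> linarith [q1'.1, q1'.2, q2'.1, q2'.2, h7'.1, h7'.2]
    have habs' : |x1 - x2| ≤ 4 * W := by
      rw [abs_le] at *
      omega
    have habs'' : |s'.var 7 + (x1 - x2)| ≤ B := by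
      refine habs.trans ?_
      rw [add_mul, one_mul]
      omega
    simp only [wp_seq, wp_assign]
    refine ⟨?_, ?_, ?_, ?_, ?_⟩
    · simp [h8', h9, i1, a4, hoff, abs_le]; omega
    · have e1 : |(base : ℤ) + walkOffset walks c.idx + c.hi| =
          (base : ℤ) + walkOffset walks c.idx + c.hi := abs_of_nonneg (by omega)
      have e2 : |(base : ℤ) + walkOffset walks c.idx + c.lo| =
          (base : ℤ) + walkOffset walks c.idx + c.lo := abs_of_nonneg (by omega)
      simp [h8', h9, i1, i2, i3, a4, a5, hoff, t1', t2', e1, e2, habs'']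
      rw [abs_of_nonneg (by omega : (0 : ℤ) ≤ 3 * (k : ℤ) + 3),
        abs_of_nonneg (by omega : (0 : ℤ) ≤ 3 * (k : ℤ) + 2)]
      omega
    · simp
    · simp [h8', h9, i1, i2, i3, a4, a5, hoff, t1', t2', htake, hsum, h7]
    · simpa [h8', h9, i1, i2, i3, a4, a5, hoff, t1', t2'] using habs
  · rintro s' h9 ha ht ⟨h7, h7'⟩
    refine ⟨?_, ?_, h7'.trans ?_⟩
    · simp only [AState.setVar, WExp.cost] at ht
      omega
    · rw [h7, List.take_length]
    · exact_mod_cast hbd _ le_rfl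

theorem wp_program {s : AState} (hB : WordBounds n D walks.length m W B)
    (hm : m = walks.flatten.length) (hq : ReadsPieces q δ inp) (hval : ∀ c ∈ q, c.Valid walks)
    (hqW : (q.length + 1) * ((m + 1) * (n * n)) ≤ 2 * W) (hqW' : q.length ≤ W)
    (hT : HoldsTables G walks ω x₀ ρ path s.arr s.rarr) :
    program.wp B inp (fun s' => s'.time ≤ s.time + 1000 * (Nat.log 2 n + q.length + 1) ∧
      ∃ K ≤ n, (∀ v, (ρ v).val < K ↔ ω v ≤ δ) ∧
        s'.var 0 = K - ((concatPieces walks q).map (arcTerm G ρ path K)).sum) s := by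
  have ⟨b1, b2, b3, b4, b5, b6, b7, b8⟩ := hB
  have hn := x₀.pos
  simp only [program, wp_seq, wp_assign, wp_realRead]
  refine ⟨by simp; omega, by simp; omega, by simp, addr_ok (by simp) (by simp; omega), by simp, ?_⟩
  simp only [WExp.eval]
  generalize hs0 : AState.setReal _ _ _ _ _ = s0
  have v1 : s0.var 1 = n := by rw [← hs0]; simp [hT.order]
  have v2 : s0.var 2 = m + 1 := by rw [← hs0]; simp [hT.rowLength, hm]
  have v3 : s0.var 3 = q.length := by rw [← hs0]; simp [hq.length]
  have t0 : s0.time ≤ s.time + 100 := by rw [← hs0]; simp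
  have hδ : s0.rarr 2 0 = δ := by rw [← hs0]; simp [hq.real]
  have a0 : s0.arr = s.arr := by rw [← hs0]; rfl
  have r0 : s0.rarr 1 = s.rarr 1 := by rw [← hs0]; simp
  clear hs0
  refine wp_call (wp_search b2 b1 b8 v1 (fun v => by rw [r0, hT.weight]) hT.mono hδ hn.ne') ?_
  rintro s1 a1 ⟨t1, K, hK, h4, hKδ⟩
  have v21 : s1.var 2 = m + 1 := by rw [a1.var 2 (by decide), v2]
  have v31 : s1.var 3 = q.length := by rw [a1.var 3 (by decide), v3]
  have hcell : K * (m + 1) ≤ 4 * W := le_trans (Nat.mul_le_mul_right _ (by omega)) b6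
  have hprod : s1.var 4 * s1.var 2 = ((K * (m + 1) : ℕ) : ℤ) := by rw [h4, v21]; push_cast; ring
  have hT1 : HoldsTables G walks ω x₀ ρ path s1.arr s1.rarr := by
    have e1 : s1.arr = s.arr := by
      rw [← a0]; exact funext fun a => a1.arr a (by simp [search])
    have e2 : s1.rarr 1 = s.rarr 1 := by rw [a1.rarr 1 (by decide), r0]
    exact ⟨e1 ▸ hT.order, e1 ▸ hT.rowLength, e1 ▸ hT.offset, fun v => by rw [e2, hT.weight],
      hT.mono, hT.treePath, hT.length, e1 ▸ hT.table⟩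
  refine ⟨?_, ?_⟩
  · simp only [WExp.Ok, WExp.eval, hprod, abs_le, true_and]
    omega
  simp only [hprod]
  refine wp_call (wp_sumPieces (s := s1.setVar 8 _ _) hB hm hq hval hqW hqW' hK hT1 (by simpa using v31)
    (by simp)) ?_
  rintro s2 a2 ⟨t2, h7, h7'⟩
  have v42 : s2.var 4 = K := by rw [a2.var 4 (by decide)]; simpa using h4
  refine ⟨?_, ?_, K, hK, hKδ, ?_⟩
  · simp only [WExp.Ok, WExp.eval, v42, true_and]
    rw [abs_le] at *
    omega
  · simp only [AState.setVar, WExp.cost] at t2 ⊢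
    omega
  · simp [v42, h7]

end Query

/-! ### The layout and the size of the inputs. -/

theorem getD_toNat_append {α : Type*} (l l' : List α) (x : α) (z : ℤ) (k : ℕ)
    (hz : z.toNat = l.length + k) : (l ++ l').getD z.toNat x = l'.getD k x := by
  rw [hz, List.getD_append_right _ _ _ _ (by omega), Nat.add_sub_cancel_left]

section Input

variable {n D : ℕ} (G : PlaneGraph n D) (x₀ : Fin n) (walks : List (List (Fin D))) (ω : Fin n → ℝ)

theorem readsGraph_preprocessingInput :
    ReadsGraph G walks ω (preprocessingInput G x₀ walks ω) where
  tail d := by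
    simp only [MachineInput.word, preprocessingInput, List.append_assoc]
    rw [getD_toNat_append _ _ _ _ d.val (by simp; omega), List.getD_append _ _ _ _ (by simp)]
    simp
  rev d := by
    simp only [MachineInput.word, preprocessingInput]
    rw [List.append_assoc, List.append_assoc, List.append_assoc,
      getD_toNat_append _ _ _ _ d.val (by simp; omega), List.getD_append _ _ _ _ (by simp)]
    simp
  length i hi := by
    simp only [MachineInput.word, preprocessingInput]
    rw [List.append_assoc, getD_toNat_append _ _ _ _ i (by simp; omega),
      List.getD_append _ _ _ _ (by simpa using hi)]
    simp [hi]
  arc j hj := by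
    simp only [MachineInput.word, preprocessingInput]
    rw [getD_toNat_append _ _ _ _ j (by simp; omega), List.getD_eq_getElem _ _ (by rwa [List.length_map]),
      List.getElem_map]
  weight v := by
    simp [MachineInput.real, preprocessingInput]

theorem preprocessingInput_words_le {B : ℕ}
    (hB : n + D + walks.length + walks.flatten.length ≤ B) :
    ∀ v ∈ (preprocessingInput G x₀ walks ω).words, |v| ≤ (B : ℤ) := by
  have hx := x₀.isLt
  have nat : ∀ k : ℕ, k ≤ B → |(k : ℤ)| ≤ B := fun k hk => by
    rw [abs_of_nonneg (by omega)]; exact_mod_cast hk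
  intro v hv
  simp only [preprocessingInput, List.mem_append, List.mem_cons, List.not_mem_nil, or_false,
    List.mem_ofFn, List.mem_map] at hv
  rcases hv with ((((((rfl | rfl | rfl | rfl) | ⟨d, rfl⟩) | ⟨d, rfl⟩) | ⟨d, rfl⟩) | ⟨π, hπ, rfl⟩) |
    ⟨d, -, rfl⟩)
  · exact nat _ (by omega)
  · exact nat _ (by omega)
  · exact nat _ (by omega)
  · exact nat _ (by omega)
  · exact nat _ (by have := (G.tail d).isLt; omega)
  · exact nat _ (by have := (G.rev d).isLt; omega)
  · exact nat _ (by have := (G.rot d).isLt; omega)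
  · refine nat _ ?_
    have : π.length ≤ (walks.map List.length).sum := List.single_le_sum (by simp) _
      (List.mem_map_of_mem hπ)
    rw [← List.length_flatten] at this
    omega
  · exact nat _ (by have := d.isLt; omega)

variable (q : List Piece) (δ : ℝ)

theorem getD_flatMap_piece {q : List Piece} {i : ℕ} (hi : i < q.length) (j : ℕ) (hj : j < 3) :
    (q.flatMap fun c => [(c.idx : ℤ), (c.lo : ℤ), (c.hi : ℤ)]).getD (3 * i + j) 0 =
      [(q[i].idx : ℤ), (q[i].lo : ℤ), (q[i].hi : ℤ)].getD j 0 := by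
  induction q generalizing i with
  | nil => simp at hi
  | cons c q ih =>
    rw [List.flatMap_cons]
    cases i with
    | zero => rw [Nat.mul_zero, Nat.zero_add, List.getD_append _ _ _ _ (by simpa using hj)]; rfl
    | succ i =>
      rw [List.getD_append_right _ _ _ _ (by simp; omega)]
      have : 3 * (i + 1) + j - [(c.idx : ℤ), (c.lo : ℤ), (c.hi : ℤ)].length = 3 * i + j := by
        simp; omega
      rw [this, ih (by simpa using hi)]
      rfl

theorem readsPieces_queryInput : Query.ReadsPieces q δ (queryInput q δ) where
  length := by simp [MachineInput.word, queryInput]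
  idx i hi := by
    have h : (3 * (i : ℤ) + 1).toNat = (3 * i + 0) + 1 := by omega
    rw [MachineInput.word, queryInput, h, List.getD_cons_succ]
    exact getD_flatMap_piece hi 0 (by omega)
  lo i hi := by
    have h : (3 * (i : ℤ) + 2).toNat = (3 * i + 1) + 1 := by omega
    rw [MachineInput.word, queryInput, h, List.getD_cons_succ, getD_flatMap_piece hi _ (by omega)]
    rfl
  hi i hi := by
    have h : (3 * (i : ℤ) + 3).toNat = (3 * i + 2) + 1 := by omega
    rw [MachineInput.word, queryInput, h, List.getD_cons_succ, getD_flatMap_piece hi _ (by omega)]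
    rfl
  real := by simp [MachineInput.real, queryInput]

theorem queryInput_words_le {B : ℕ} {walks : List (List (Fin D))}
    (hq : ∀ c ∈ q, c.Valid walks)
    (hB : walks.length + walks.flatten.length + q.length ≤ B) :
    ∀ v ∈ (queryInput q δ).words, |v| ≤ (B : ℤ) := by
  have nat : ∀ k : ℕ, k ≤ B → |(k : ℤ)| ≤ B := fun k hk => by
    rw [abs_of_nonneg (by omega)]; exact_mod_cast hk
  intro v hv
  simp only [queryInput, List.mem_cons, List.mem_flatMap, List.not_mem_nil, or_false] at hv
  rcases hv with rfl | ⟨c, hc, hv⟩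
  · exact nat _ (by omega)
  · obtain ⟨h1, h2, h3⟩ := hq c hc
    have h4 := walkOffset_add_le h1 h3
    rcases hv with rfl | rfl | rfl
    · exact nat _ (by omega)
    · exact nat _ (by omega)
    · exact nat _ (by omega)

end Input

/-! ### Assembling the main theorem. -/

theorem wordBounds_pow {n D l m Z B : ℕ} (hn : 0 < n) (hZ : n + D + m ≤ Z) (hl : l ≤ m)
    (hB : 1000 * Z ^ 4 ≤ B) : WordBounds n D l m (Z ^ 4) B := by
  have h1 : 1 ≤ Z := by omega
  have h2 : Z ≤ Z ^ 4 := Nat.le_self_pow (by omega) Z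
  have h3 : Z ^ 2 ≤ Z ^ 4 := Nat.pow_le_pow_right h1 (by omega)
  have h4 : Z ^ 3 ≤ Z ^ 4 := Nat.pow_le_pow_right h1 (by omega)
  refine ⟨by omega, by omega, by omega, hl, by omega, ?_, ?_, hB⟩
  · calc (n + 1) * (m + 1) ≤ (2 * Z) * Z := Nat.mul_le_mul (by omega) (by omega)
      _ = 2 * Z ^ 2 := by ring
      _ ≤ 4 * Z ^ 4 := by omega
  · calc (m + 1) * (n * n) ≤ Z * (Z * Z) :=
        Nat.mul_le_mul (by omega) (Nat.mul_le_mul (by omega) (by omega))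
      _ = Z ^ 3 := by ring
      _ ≤ 2 * Z ^ 4 := by omega

/-- The eight arrays cover the whole memory, so agreement of all arrays transfers bounds to every
cell. -/
theorem exists_array_address (z : ℤ) : ∃ (a : Fin 8) (i : ℤ), i * 8 + (a.val : ℤ) = z :=
  ⟨⟨(z % 8).toNat, by omega⟩, z / 8, by simp only; omega⟩

/-- The number of vertices counted by a query. -/
theorem countLe_interiorVertices {n D : ℕ} {G : PlaneGraph n D} {γ : List (Fin D)}
    {p : Fin γ.length → ℝ} (hp : G.IsSimplePerturbation γ p) (hγ : G.IsClosedDualWalk γ)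
    {o : Fin D} (hcw : G.IsClockwise γ p o) {x₀ : Fin n} (hx₀ : x₀ ∈ G.interiorVertices γ p o)
    {path : Fin n → List (Fin D)} (hpath : ∀ v, G.IsTreePath x₀ path v)
    {ρ : Equiv.Perm (Fin n)} {ω : Fin n → ℝ} {δ : ℝ} {K : ℕ} (hK : K ≤ n)
    (hKδ : ∀ v, (ρ v).val < K ↔ ω v ≤ δ) :
    (K : ℤ) - (γ.map (arcTerm G ρ path K)).sum = countLe ω (G.interiorVertices γ p o) δ := by
  classical
  have hU : (Finset.univ.filter fun v => (ρ v).val < K).card = K := by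
    have h : (Finset.univ.filter fun v => (ρ v).val < K) =
        (Finset.univ.filter fun v : Fin n => v.val < K).map ρ.symm.toEmbedding := by
      ext v
      simp [Finset.mem_map_equiv]
    rw [h, Finset.card_map, Fin.card_filter_val_lt, min_eq_right hK]
  have hterm : arcTerm G ρ path K = fun d => ∑ v ∈ Finset.univ.filter (fun v => (ρ v).val < K),
      (((path v).count d : ℤ) - (path v).count (G.rev d)) := by
    funext d
    rw [arcTerm, arcCount, arcCount, Finset.sum_sub_distrib]
    push_cast
    rfl
  rw [hterm, PlaneGraph.sum_table hp hγ hcw hx₀ path hpath, hU, sub_sub_cancel, countLe,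
    ← Set.ncard_coe_finset]
  congr 2
  ext v
  simp only [Finset.coe_filter, Finset.mem_filter, Finset.mem_univ, true_and, Set.mem_ofPred_eq,
    hKδ]
  exact and_comm

/-- There are a preprocessing program, a query program and constants that work for all plane graphs
`G`, weights `ω`, vertices `x₀` and families of dual walks. The predicate `Ready` describes the
memories that hold the data structure: the preprocessing produces such a memory, and each query
starts from and leaves behind such a memory, so that any number of queries can be answered. The
query works for every simple perturbation `p` of the queried walk and every position `o` of the
outer face. -/
theorem mainTheorem10 :
    ∃ (pre query : List Instr) (C c : ℕ),
      ∀ (n D : ℕ) (G : PlaneGraph n D) (ω : Fin n → ℝ) (x₀ : Fin n)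
        (walks : List (List (Fin D))) (m : ℕ),
        (∀ π ∈ walks, π ≠ [] ∧ G.IsDualWalk π) → m = walks.flatten.length →
        ∃ Ready : Memory → Prop,
          (∃ (t : ℕ) (s : State),
            HaltsWithin pre (preprocessingInput G x₀ walks ω) Memory.blank t
              (C * (n + D + m) ^ c) s ∧
            t ≤ C * (n * (n + D + m)) ∧
            (G.Simple → t ≤ C * (n * (n + m))) ∧
            Ready s.mem) ∧
          ∀ (M : Memory), Ready M →
            ∀ (δ : ℝ) (q : List Piece) (o : Fin D)
              (p : Fin (concatPieces walks q).length → ℝ),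
              (∀ a ∈ q, a.Valid walks) →
              G.IsClosedDualWalk (concatPieces walks q) →
              G.IsSimplePerturbation (concatPieces walks q) p →
              G.IsClockwise (concatPieces walks q) p o →
              x₀ ∈ G.interiorVertices (concatPieces walks q) p o →
              ∃ (t : ℕ) (s : State),
                HaltsWithin query (queryInput q δ) M t (C * (n + D + m + q.length) ^ c) s ∧
                t ≤ C * (q.length + Nat.log 2 n) ∧
                s.regs 0 = countLe ω (G.interiorVertices (concatPieces walks q) p o) δ ∧
                Ready s.mem := by
  -- The constant is `5000 * 8`: preprocessing takes at most `5000 * (n * (n + D + m))` steps, and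
  -- `D ≤ 6 * n` gives `n + D + m ≤ 8 * (n + m)`. The exponent 4 covers the product of the number of
  -- pieces, `m` and `n * n`.
  refine ⟨Preprocessing.program.compile 0, Query.program.compile 0, 40000, 4, ?_⟩
  intro n D G ω x₀ walks m hwalks hm
  have hn := x₀.pos
  have hl : walks.length ≤ m := hm ▸ length_le_length_flatten fun π hπ => (hwalks π hπ).1
  set Z := n + D + m with hZ
  have hZ4 : Z ≤ Z ^ 4 := Nat.le_self_pow (by omega) Z
  -- Besides the tables, `Ready` must bound all words in memory, because a query starts from
  -- whatever is stored there.
  refine ⟨fun M => (∀ a, |M.words a| ≤ ((40000 * Z ^ 4 : ℕ) : ℤ)) ∧ ∃ ρ path,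
    HoldsTables G walks ω x₀ ρ path (fun a i => M.words (i * 8 + (a.val : ℤ)))
      (fun a i => M.reals (i * 8 + (a.val : ℤ))), ?_, ?_⟩
  · have hwp := Preprocessing.wp_program (x₀ := x₀) (readsGraph_preprocessingInput G x₀ walks ω)
      (wordBounds_pow (B := 40000 * Z ^ 4) hn le_rfl hl (Nat.mul_le_mul_right _ (by omega))) hm
      (by simp [MachineInput.word, preprocessingInput])
      (by simp [MachineInput.word, preprocessingInput])
      (by simp [MachineInput.word, preprocessingInput])
      (by simp [MachineInput.word, preprocessingInput])
      (s := ⟨fun _ => 0, fun a i => Memory.blank.words (i * 8 + (a.val : ℤ)),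
        fun a i => Memory.blank.reals (i * 8 + (a.val : ℤ)), 0⟩) (fun _ _ => rfl)
    obtain ⟨st, s, hhalt, hrep, ht, ρ, path, hT⟩ := Cmd.haltsWithin_of_wp
      (preprocessingInput_words_le G x₀ walks ω (by omega)) (fun _ => by simp [Memory.blank]) hwp
    rw [Nat.zero_add, ← hZ] at ht
    refine ⟨s.time, st, hhalt, by omega, fun hG => ?_, hrep.fits.2, ρ, path, ?_⟩
    · have hD : Z ≤ 8 * (n + m) := by
        have := PlaneGraph.card_arcs_le hG
        omega
      have := Nat.mul_le_mul_left n hD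
      rw [Nat.mul_left_comm] at this
      omega
    · simpa only [hrep.arr, hrep.rarr] using hT
  · rintro M ⟨hM, ρ, path, hT⟩ δ q o p hval hγ hp hcw hx₀
    set Zq := n + D + m + q.length with hZq
    have hZZ : Z ^ 4 ≤ Zq ^ 4 := Nat.pow_le_pow_left (by omega) 4
    have hZq4 : Zq ≤ Zq ^ 4 := Nat.le_self_pow (by omega) Zq
    have hprod : (q.length + 1) * ((m + 1) * (n * n)) ≤ 2 * Zq ^ 4 := by
      calc (q.length + 1) * ((m + 1) * (n * n)) ≤ Zq * (Zq * (Zq * Zq)) :=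
          Nat.mul_le_mul (by omega) (Nat.mul_le_mul (by omega)
            (Nat.mul_le_mul (by omega) (by omega)))
        _ = Zq ^ 4 := by ring
        _ ≤ 2 * Zq ^ 4 := by omega
    -- A closed walk is nonempty, so there is at least one piece; this absorbs the additive constant
    -- of the time bound.
    have hq0 : 1 ≤ q.length := by
      by_contra h
      have : q = [] := List.length_eq_zero_iff.1 (by omega)
      exact hγ.1 (by simp [this, concatPieces])
    have hwp := Query.wp_program (x₀ := x₀) (inp := queryInput q δ) (ω := ω) (G := G)
      (s := ⟨fun _ => 0, fun a i => M.words (i * 8 + (a.val : ℤ)),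
        fun a i => M.reals (i * 8 + (a.val : ℤ)), 0⟩)
      (wordBounds_pow (Z := Zq) (B := 40000 * Zq ^ 4) hn (by omega) hl
        (Nat.mul_le_mul_right _ (by omega))) hm (readsPieces_queryInput q δ) hval hprod (by omega) hT
    obtain ⟨st, s, hhalt, hrep, ⟨ht, K, hK, hKδ, hres⟩, hag⟩ := Cmd.haltsWithin_of_wp
      (queryInput_words_le q δ hval (by omega))
      (fun a => (hM a).trans (by exact_mod_cast Nat.mul_le_mul_left _ hZZ))
      (Cmd.wp_agree (fun _ => id) (fun _ => id) (fun _ => id) (Agree.refl _ _ _ _) hwp)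
    -- A query writes no word array and only the real array `2`, so the tables survive for the next
    -- query.
    have harr : ∀ a, s.arr a = fun i => M.words (i * 8 + (a.val : ℤ)) := fun a =>
      hag.arr a (by simp [Query.program, Query.search, Query.sumPieces])
    have hrarr : s.rarr 1 = fun i => M.reals (i * 8 + (((1 : Fin 8)).val : ℤ)) :=
      hag.rarr 1 (by decide)
    refine ⟨s.time, st, hhalt, ?_, ?_, ?_, ρ, path, ?_⟩
    · simp only at ht
      omega
    · rw [← countLe_interiorVertices hp hγ hcw hx₀ hT.treePath hK hKδ, ← hres, ← hrep.var]
    · intro z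
      obtain ⟨a, i, rfl⟩ := exists_array_address z
      rw [hrep.arr, harr]
      exact hM _
    · simp only [hrep.arr, hrep.rarr, harr]
      exact ⟨hT.order, hT.rowLength, hT.offset, fun v => by rw [hrarr]; exact hT.weight v, hT.mono,
        hT.treePath, hT.length, hT.table⟩
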